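/- Work in the category of finite groups, whose epimorphisms are the surjections. The isomorphism classes of quotients of a finite group $G$ form a finite lattice, where $H\ge F$ if $G\to F$ factors through $G\to H$. For a surjection $\pi\colon G\to F$ let $[F,G]$ be the interval of quotients of $G$ that are $\ge F$, let $\mu(\pi)=\mu(F,G)$ be the value of the Möbius function of this lattice, and let $Z(\pi)$ be the number of $H\in[F,G]$ with $H\vee(K_1\wedge K_2)=(H\vee K_1)\wedge(H\vee K_2)$ for all $K_1,K_2\in[F,G]$. Put $\hat\mu(F,G)=\sum_{\pi\in \mathrm{Sur}(G,F)/\mathrm{Aut}(F)}\mu(\pi)$. A \emph{level} $\mathcal C$ is the smallest set of isomorphism classes of finite groups that contains a given finite set and the trivial group, is closed under quotients, and is closed under joins (if $G$ has quotients $H,F\in\mathcal C$, then $H\vee F\in\mathcal C$). For real numbers $M_G$ indexed by the isomorphism classes of finite groups, $(M_G)_G$ is \emph{well-behaved} if $$\sum_{G\in\mathcal C}\ \sum_{\pi\in\mathrm{Sur}(G,F)}\frac{|\mu(\pi)|}{|\mathrm{Aut}(G)|}\,Z(\pi)^3\,|M_G|<\infty$$ for every level $\mathcal C$ and every $F\in\mathcal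 C$; and $v_{\mathcal C,F}=\sum_{G\in\mathcal C}\frac{\hat\mu(F,G)}{|\mathrm{Aut}(G)|}M_G$. For a finite group $F$, an \emph{$[F]$-group} is a group $N$ with a homomorphism $F\to\mathrm{Out}(N)$. A morphism of $[F]$-groups $N\to N'$ is a homomorphism $f$ such that for each $g\in F$ and each lift $\sigma_1\in\mathrm{Aut}(N)$ of the image of $g$ in $\mathrm{Out}(N)$ there is a lift $\sigma_2\in\mathrm{Aut}(N')$ of the image of $g$ in $\mathrm{Out}(N')$ with $\sigma_2 f=f\sigma_1$; $\mathrm{Aut}_{[F]}(N)$ is the group of automorphisms of $N$ as an $[F]$-group; $N$ is \emph{simple} if it is nontrivial and its only normal subgroups fixed by $F$ are $1$ and $N$. \textbf{Lemma.} Let $u$ be a real number and let $M_G=|G|^{-u}$ for each finite group $G$. (1) $(M_G)_G$ is well-behaved. (2) Let $\mathcal C$ be a level and $F\in\mathcal C$. There are finitely many isomorphism classes of irreducible representations $V$ of $F$ over prime fields with $V\rtimes F\in\mathcal C$, and finitely many isomorphism classes of finite non-abelian simple $[F]$-groups $N$ with $F\times_{\mathrm{Out}(N)}\mathrm{Aut}(N)\in\mathcal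 C$. Let $V_1,\dots,V_n$ and $N_1,\dots,N_m$ be representatives of these classes. Let $q_i$ be the order of the endomorphism field of $V_i$, and let $W_i\subseteq H^2(F,V_i)$ be the set of classes whose associated extension of $F$ by $V_i$ is in $\mathcal C$. Then the sum defining $v_{\mathcal C,F}$ converges absolutely, the infinite products below converge, and $$v_{\mathcal C,F}=\frac{|F|^{-u}}{|\mathrm{Aut}(F)|}\ \prod_{i=1}^n\ \prod_{j=1}^{\infty}\left(1-\frac{|H^0(F,V_i)|\,|W_i|}{|V_i|^{u+1}\,|H^1(F,V_i)|}\,q_i^{-j}\right)\ \prod_{i=1}^m \exp\left(-\frac{1}{|N_i|^{u}\,|\mathrm{Aut}_{[F]}(N_i)|}\right).$$ (3) If $u$ is an integer, then $v_{\mathcal C,F}\ge 0$ for every level $\mathcal C$ and every $F\in\mathcal C$. -/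

import Mathlib

/-! ### Quotients of a finite group, Möbius function, distributive elements -/

/-- The normal subgroups of `G`, as a sublattice of the lattice of subgroups. -/
def normalSublattice (G : Type*) [Group G] : Sublattice (Subgroup G) where
  carrier := {N | N.Normal}
  supClosed' := fun _ hA _ hB =>
    have := Set.mem_ofPred.mp hA
    have := Set.mem_ofPred.mp hB
    Subgroup.sup_normal _ _
  infClosed' := fun _ hA _ hB =>
    have := Set.mem_ofPred.mp hA
    have := Set.mem_ofPred.mp hB
    Subgroup.normal_inf_normal _ _

/-- The lattice of isomorphism classes of quotients of `G`. A quotient `π : G → H` is recorded by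
its kernel, and `H ≥ F` (that is, `G → F` factors through `G → H`) means `ker (G → H) ≤ ker (G → F)`,
so this is the order dual of the lattice of normal subgroups. -/
abbrev QuotientLattice (G : Type*) [Group G] : Type _ := (normalSublattice G)ᵒᵈ

/-- The quotient of `G` given by a homomorphism (used for surjective ones). -/
def quotientOf {G F : Type*} [Group G] [Group F] (π : G →* F) : QuotientLattice G :=
  OrderDual.toDual ⟨π.ker, MonoidHom.normal_ker π⟩

/-- `G` as a quotient of itself. -/
def quotientSelf (G : Type*) [Group G] : QuotientLattice G := quotientOf (MonoidHom.id G)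

/-- The Möbius function of a finite partially ordered set. -/
noncomputable def posetMoebius {α : Type*} [PartialOrder α] [Finite α] (a b : α) : ℤ := by
  classical
  letI : Fintype α := Fintype.ofFinite α
  letI : LocallyFiniteOrder α := Fintype.toLocallyFiniteOrder
  exact IncidenceAlgebra.mu ℤ a b

/-- The epimorphisms `G → F`. -/
abbrev Sur (G F : Type*) [Group G] [Group F] : Type _ := {π : G →* F // Function.Surjective π}

/-- `μ(π) = μ(F, G)` for `π : G → F`. -/
noncomputable def muHom {G F : Type*} [Group G] [Finite G] [Group F] (π : G →* F) : ℤ :=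
  posetMoebius (quotientOf π) (quotientSelf G)

/-- Two epimorphisms `G → F` are identified when they differ by an automorphism of `F`. -/
def surSetoid (G F : Type*) [Group G] [Group F] : Setoid (Sur G F) where
  r π π' := ∃ α : F ≃* F, π'.1 = α.toMonoidHom.comp π.1
  iseqv :=
    { refl := fun _ => ⟨MulEquiv.refl F, rfl⟩
      symm := by
        rintro π π' ⟨α, h⟩
        refine ⟨α.symm, ?_⟩
        rw [h]
        ext x
        simp
      trans := by
        rintro π π' π'' ⟨α, h⟩ ⟨β, h'⟩
        refine ⟨α.trans β, ?_⟩
        rw [h', h]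
        rfl }

theorem muHom_eq_of_surSetoid {G F : Type*} [Group G] [Finite G] [Group F] (π π' : Sur G F)
    (h : (surSetoid G F).r π π') : muHom π.1 = muHom π'.1 := by
  obtain ⟨α, h⟩ := h
  have hk : π.1.ker = π'.1.ker := by
    ext x
    simp [h, MonoidHom.mem_ker]
  unfold muHom quotientOf
  congr 1
  exact congrArg OrderDual.toDual (Subtype.ext hk)

/-- `μ̂(F, G)`, the sum of `μ(π)` over `π ∈ Epi(G, F) / Aut(F)`. -/
noncomputable def muHat (F G : Type*) [Group F] [Group G] [Finite G] : ℤ :=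
  ∑ᶠ c : Quotient (surSetoid G F),
    Quotient.lift (fun π : Sur G F => muHom π.1) muHom_eq_of_surSetoid c

/-- `Z(π)`: the number of `H ∈ [F, G]` with `H ∨ (K₁ ∧ K₂) = (H ∨ K₁) ∧ (H ∨ K₂)` for all
`K₁, K₂ ∈ [F, G]`. -/
noncomputable def distribCount {G F : Type*} [Group G] [Group F] (π : G →* F) : ℕ :=
  Nat.card {H : QuotientLattice G //
    H ∈ Set.Icc (quotientOf π) (quotientSelf G) ∧
    ∀ K₁ ∈ Set.Icc (quotientOf π) (quotientSelf G),
    ∀ K₂ ∈ Set.Icc (quotientOf π) (quotientSelf G),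
      H ⊔ (K₁ ⊓ K₂) = (H ⊔ K₁) ⊓ (H ⊔ K₂)}

/-! ### Isomorphism classes of finite groups, formations and levels -/

/-- Isomorphism of finite groups. -/
def finGrpSetoid : Setoid FiniteGrp.{0} where
  r G H := Nonempty (G ≃* H)
  iseqv :=
    { refl := fun G => ⟨MulEquiv.refl G⟩
      symm := fun ⟨e⟩ => ⟨e.symm⟩
      trans := fun ⟨e⟩ ⟨e'⟩ => ⟨e.trans e'⟩ }

/-- Isomorphism classes of finite groups. -/
def FinGrpClass : Type 1 := Quotient finGrpSetoid

/-- The isomorphism class of a finite group. -/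
def grpClass (G : Type) [Group G] [Finite G] : FinGrpClass :=
  Quotient.mk finGrpSetoid (FiniteGrp.of G)

/-- A group in a given isomorphism class. -/
noncomputable def FinGrpClass.rep (c : FinGrpClass) : FiniteGrp.{0} := Quotient.out c

/-- Whenever `H` is a quotient of `G ∈ L`, also `H ∈ L`. -/
def DownwardClosed (L : Set FinGrpClass) : Prop :=
  ∀ (G H : Type) [Group G] [Finite G] [Group H] [Finite H] (π : G →* H),
    Function.Surjective π → grpClass G ∈ L → grpClass H ∈ L

/-- Whenever quotients `H`, `F` of `G` are in `L`, so is their join `H ∨ F`, which is the quotient of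
`G` by the intersection of the two kernels. -/
def JoinClosed (L : Set FinGrpClass) : Prop :=
  ∀ (G H F : Type) [Group G] [Finite G] [Group H] [Finite H] [Group F] [Finite F]
    (π : G →* H) (ρ : G →* F), Function.Surjective π → Function.Surjective ρ →
    grpClass H ∈ L → grpClass F ∈ L → grpClass (G ⧸ (π.ker ⊓ ρ.ker)) ∈ L

/-- An isomorphism class is minimal if its members have only one quotient. -/
def FinGrpClass.IsMinimal (c : FinGrpClass) : Prop := Subsingleton (QuotientLattice c.rep)

/-- The smallest downward-closed join-closed set containing `B` and all minimal objects. -/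
def generatedBy (B : Set FinGrpClass) : Set FinGrpClass :=
  ⋂₀ {L | DownwardClosed L ∧ JoinClosed L ∧ (∀ c : FinGrpClass, c.IsMinimal → c ∈ L) ∧ B ⊆ L}

/-- A level is generated by a finite set. -/
def IsLevel (L : Set FinGrpClass) : Prop :=
  ∃ B : Set FinGrpClass, B.Finite ∧ L = generatedBy B

/-! ### Well-behaved moments and the numbers `v` -/

/-- `M` is well-behaved at `L`: for every `F ∈ L` the sum over `G ∈ L` and `π ∈ Epi(G, F)` of
`|μ(π)| Z(π)³ |M_G| / |Aut G|` is finite. -/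
def WellBehavedAt (L : Set FinGrpClass) (M : FinGrpClass → ℝ) : Prop :=
  ∀ (F : Type) [Group F] [Finite F], grpClass F ∈ L →
    Summable fun x : Σ G : L, Sur G.1.rep F =>
      (|muHom x.2.1| : ℝ) / (Nat.card (MulAut x.1.1.rep) : ℝ) *
        (distribCount x.2.1 : ℝ) ^ 3 * |M x.1.1|

/-- `M` is well-behaved if it is well-behaved at every level. -/
def WellBehaved (M : FinGrpClass → ℝ) : Prop := ∀ L, IsLevel L → WellBehavedAt L M

/-- The term of index `G` in the sum defining `v`. -/
noncomputable def vTerm (F : Type) [Group F] (M : FinGrpClass → ℝ) (G : FinGrpClass) : ℝ :=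
  (muHat F G.rep : ℝ) / (Nat.card (MulAut G.rep) : ℝ) * M G

/-- `v_{L,F} = ∑_{G ∈ L} μ̂(F, G) / |Aut G| * M_G`. -/
noncomputable def vSum (L : Set FinGrpClass) (F : Type) [Group F] (M : FinGrpClass → ℝ) : ℝ :=
  ∑' G : L, vTerm F M G.1

/-- The moments `M_G = |G|^{-u}`. -/
noncomputable def cardMoment (u : ℝ) (G : FinGrpClass) : ℝ := (Nat.card G.rep : ℝ) ^ (-u)

/-- `f` is a system of representatives, without repetition, of the `r`-classes of the objects that
satisfy `P`. -/
def IsRepSystem {X ι : Type*} (r : X → X → Prop) (P : X → Prop) (f : ι → X) : Prop :=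
  (∀ i, P (f i)) ∧ (∀ i j, r (f i) (f j) → i = j) ∧ ∀ x, P x → ∃ i, r x (f i)

/-! ### Irreducible representations over prime fields and extensions by them -/

/-- An irreducible representation of `F` over a finite prime field, on a finite vector space (as it
always is when `F` is finite). -/
structure PrimeIrrep (F : Type) [Group F] where
  p : ℕ
  [prime : Fact p.Prime]
  V : Rep.{0} (ZMod p) F
  [finite : Finite V]
  irreducible : V.ρ.IsIrreducible

namespace PrimeIrrep

attribute [instance] PrimeIrrep.prime PrimeIrrep.finite

variable {F : Type} [Group F]

/-- Isomorphism of representations. Additive bijections between vector spaces over prime fields are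
linear, and the prime is determined by the (nonzero) additive group. -/
def Iso (A B : PrimeIrrep F) : Prop :=
  ∃ e : A.V ≃+ B.V, ∀ (g : F) (v : A.V), e (A.V.ρ g v) = B.V.ρ g (e v)

/-- The action of `F` on `V`, written multiplicatively. -/
def action (A : PrimeIrrep F) : F →* MulAut (Multiplicative A.V) where
  toFun g :=
    { toFun := fun v => Multiplicative.ofAdd (A.V.ρ g v.toAdd)
      invFun := fun v => Multiplicative.ofAdd (A.V.ρ g⁻¹ v.toAdd)
      left_inv := fun v => by
        change Multiplicative.ofAdd (A.V.ρ g⁻¹ (A.V.ρ g v.toAdd)) = v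
        rw [← Module.End.mul_apply, ← map_mul]
        simp
      right_inv := fun v => by
        change Multiplicative.ofAdd (A.V.ρ g (A.V.ρ g⁻¹ v.toAdd)) = v
        rw [← Module.End.mul_apply, ← map_mul]
        simp
      map_mul' := fun v w => by
        rw [toAdd_mul, map_add, ofAdd_add] }
  map_one' := by
    ext v
    change Multiplicative.ofAdd (A.V.ρ 1 v.toAdd) = v
    simp
  map_mul' g h := by
    ext v
    change Multiplicative.ofAdd (A.V.ρ (g * h) v.toAdd) =
      Multiplicative.ofAdd (A.V.ρ g (A.V.ρ h v.toAdd))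
    rw [map_mul, Module.End.mul_apply]

/-- The semidirect product `V ⋊ F`. -/
abbrev Semidirect (A : PrimeIrrep F) : Type := Multiplicative A.V ⋊[A.action] F

instance (A : PrimeIrrep F) [Finite F] : Finite A.Semidirect :=
  Finite.of_equiv _ SemidirectProduct.equivProd.symm

/-- The order of the endomorphism field of `V`. -/
noncomputable def q (A : PrimeIrrep F) : ℕ := Nat.card (A.V.ρ.IntertwiningMap A.V.ρ)

end PrimeIrrep

/-- The extension of `F` by `A` given by the 2-cocycle `f`: the set `A × F` with
`(a, g) (b, h) = (a + g b + f(g, h), g h)`. -/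
@[ext]
structure CocycleExtension {k F : Type} [CommRing k] [Group F] {A : Rep.{0} k F}
    (f : groupCohomology.cocycles₂ A) where
  fst : A
  snd : F

namespace CocycleExtension

variable {k F : Type} [CommRing k] [Group F] {A : Rep.{0} k F} (f : groupCohomology.cocycles₂ A)

instance : Mul (CocycleExtension f) :=
  ⟨fun x y => ⟨x.fst + A.ρ x.snd y.fst + f (x.snd, y.snd), x.snd * y.snd⟩⟩

instance : One (CocycleExtension f) := ⟨⟨-f (1, 1), 1⟩⟩

instance : Inv (CocycleExtension f) :=
  ⟨fun x => ⟨-A.ρ x.snd⁻¹ x.fst - f (x.snd⁻¹, x.snd) - f (1, 1), x.snd⁻¹⟩⟩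

instance : Group (CocycleExtension f) :=
  Group.ofLeftAxioms
    (by
      intro x y z
      have h := (groupCohomology.mem_cocycles₂_iff (f : F × F → A)).1 f.2 x.snd y.snd z.snd
      ext
      · change x.fst + A.ρ x.snd y.fst + f (x.snd, y.snd) + A.ρ (x.snd * y.snd) z.fst
            + f (x.snd * y.snd, z.snd)
          = x.fst + A.ρ x.snd (y.fst + A.ρ y.snd z.fst + f (y.snd, z.snd))
            + f (x.snd, y.snd * z.snd)
        rw [map_mul, Module.End.mul_apply, map_add, map_add]
        have h' : f (x.snd * y.snd, z.snd)
            = f (x.snd, y.snd * z.snd) + A.ρ x.snd (f (y.snd, z.snd)) - f (x.snd, y.snd) := by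
          rw [eq_sub_iff_add_eq, h, add_comm]
        rw [h']
        abel
      · exact mul_assoc _ _ _)
    (by
      intro x
      ext
      · change -f (1, 1) + A.ρ 1 x.fst + f (1, x.snd) = x.fst
        rw [groupCohomology.cocycles₂_map_one_fst f x.snd, map_one, Module.End.one_apply]
        abel
      · exact one_mul _)
    (by
      intro x
      ext
      · change -A.ρ x.snd⁻¹ x.fst - f (x.snd⁻¹, x.snd) - f (1, 1) + A.ρ x.snd⁻¹ x.fst
            + f (x.snd⁻¹, x.snd) = -f (1, 1)
        abel
      · exact inv_mul_cancel _)

instance [Finite A] [Finite F] : Finite (CocycleExtension f) :=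
  Finite.of_injective (fun x : CocycleExtension f => (x.fst, x.snd)) fun _ _ h =>
    CocycleExtension.ext (congrArg Prod.fst h) (congrArg Prod.snd h)

end CocycleExtension

/-- The subset `W ⊆ H²(F, V)` of the classes whose associated extension of `F` by `V` is in `L`. -/
def admissibleClasses (L : Set FinGrpClass) {F : Type} [Group F] [Finite F] (A : PrimeIrrep F) :
    Set (groupCohomology.H2 A.V) :=
  {α | ∃ f : groupCohomology.cocycles₂ A.V,
    groupCohomology.H2π A.V f = α ∧ grpClass (CocycleExtension f) ∈ L}

/-! ### `[F]`-groups -/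

instance innerNormal (N : Type*) [Group N] : (MulAut.conj : N →* MulAut N).range.Normal where
  conj_mem := by
    rintro _ ⟨n, rfl⟩ σ
    refine ⟨σ n, ?_⟩
    ext x
    simp [MulAut.conj_apply]

/-- The group `Out(N) = Aut(N) / Inn(N)`. -/
abbrev OuterAut (N : Type*) [Group N] : Type _ := MulAut N ⧸ (MulAut.conj : N →* MulAut N).range

/-- The projection `Aut(N) → Out(N)`. -/
def toOuter (N : Type*) [Group N] : MulAut N →* OuterAut N := QuotientGroup.mk' _

/-- A finite `[F]`-group: a finite group `N` with a homomorphism `F → Out(N)`. -/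
structure OuterGroup (F : Type) [Group F] where
  N : Type
  [group : Group N]
  [finite : Finite N]
  act : F →* OuterAut N

namespace OuterGroup

attribute [instance] OuterGroup.group OuterGroup.finite

variable {F : Type} [Group F]

/-- `f` is a morphism of `[F]`-groups. -/
def IsMorphism (A B : OuterGroup F) (f : A.N →* B.N) : Prop :=
  ∀ (g : F) (σ₁ : MulAut A.N), toOuter A.N σ₁ = A.act g →
    ∃ σ₂ : MulAut B.N, toOuter B.N σ₂ = B.act g ∧ ∀ x, σ₂ (f x) = f (σ₁ x)

/-- Isomorphisms of `[F]`-groups: morphisms with an inverse morphism. -/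
def Equiv (A B : OuterGroup F) : Type :=
  {e : A.N ≃* B.N // A.IsMorphism B e.toMonoidHom ∧ B.IsMorphism A e.symm.toMonoidHom}

/-- `N` is nontrivial, and its only normal subgroups fixed by `F` are `1` and `N`. -/
def IsSimple (A : OuterGroup F) : Prop :=
  Nontrivial A.N ∧ ∀ K : Subgroup A.N, K.Normal →
    (∀ (g : F) (σ : MulAut A.N), toOuter A.N σ = A.act g → K.map σ.toMonoidHom = K) →
      K = ⊥ ∨ K = ⊤

/-- `N` is not abelian. -/
def IsNonabelian (A : OuterGroup F) : Prop := ∃ a b : A.N, a * b ≠ b * a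

/-- The fiber product `F ×_{Out(N)} Aut(N)`. -/
abbrev fiberProduct (A : OuterGroup F) : Subgroup (F × MulAut A.N) :=
  (A.act.comp (MonoidHom.fst F (MulAut A.N))).eqLocus
    ((toOuter A.N).comp (MonoidHom.snd F (MulAut A.N)))

instance finiteMulAut (A : OuterGroup F) : Finite (MulAut A.N) :=
  Finite.of_injective (fun σ : MulAut A.N => (σ : A.N → A.N)) DFunLike.coe_injective

end OuterGroup

/-- `V₁, …, Vₙ` represent the isomorphism classes of irreducible representations of `F` over prime
fields such that `V ⋊ F ∈ L`. -/
def IsIrrepSystem (L : Set FinGrpClass) {F : Type} [Group F] [Finite F] {n : ℕ}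
    (V : Fin n → PrimeIrrep F) : Prop :=
  IsRepSystem PrimeIrrep.Iso (fun A : PrimeIrrep F => grpClass A.Semidirect ∈ L) V

/-- `N₁, …, Nₘ` represent the isomorphism classes of finite non-abelian simple `[F]`-groups such that
`F ×_{Out(N)} Aut(N) ∈ L`. -/
def IsNonabelianSystem (L : Set FinGrpClass) {F : Type} [Group F] [Finite F] {m : ℕ}
    (N : Fin m → OuterGroup F) : Prop :=
  IsRepSystem (fun A B : OuterGroup F => Nonempty (A.Equiv B))
    (fun A : OuterGroup F => A.IsSimple ∧ A.IsNonabelian ∧ grpClass A.fiberProduct ∈ L) N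

/-- The number `|H⁰(F,V)| |W| / (|V|^{u+1} |H¹(F,V)|)`. -/
noncomputable def irrepRatio (L : Set FinGrpClass) {F : Type} [Group F] [Finite F] (u : ℝ)
    (A : PrimeIrrep F) : ℝ :=
  ((Nat.card (groupCohomology.H0 A.V) : ℝ) * (Nat.card (admissibleClasses L A) : ℝ)) /
    ((Nat.card A.V : ℝ) ^ (u + 1) * (Nat.card (groupCohomology.H1 A.V) : ℝ))

/-! ### The Möbius function of a finite lattice -/

section Moebius

variable {α β : Type*} [PartialOrder α] [Finite α] [PartialOrder β] [Finite β]

/-! Fix a level `L` and `F ∈ L`. The sum over groups `G` with weight `1 / |Aut G|` becomes a sum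
over the possible structures of the kernel of `π : G → F`, and that sum factors over the simple
`[F]`-groups.

Weisner's theorem (`muHom_eq_neg_sum`) shows that `μ(π) ≠ 0` forces every proper normal subgroup of
`G` inside `ker π` to miss a minimal normal one (`exists_isMinimalNormal_not_le`). Hence `ker π`
acts on each minimal normal subgroup in it by inner automorphisms, each of these is a simple
`[F]`-group, and `ker π` is a direct product of them (`exists_framing`). Such a decomposition is a
framing; the multiplicities `t i` of the isomorphism types depend only on `π`.

All counts come from one function: `E i c`, the number of normal equivariant embeddings of the
`i`-th simple group into a product containing `c` copies of it. It is `q ^ c - 1` for a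
representation (diagonals are allowed) and `c * |Aut|` for a non-abelian group (they are not).
Counting framings as one counts bases gives `∏ (E i (t i) - E i s)` over `s < t i` and all `i`;
Weisner's theorem, applied to the product of all factors but one, gives `μ(π)` as the product of
`-(E i (s + 1) - E i s) / E i 1` (`muHom_eq_muType`).

A group with a full framing is a fibre product over `F` of extensions of `F` by the single factors,
and it lies in `L` exactly when these extensions do. Counting isomorphisms with such fibre products
in two ways gives the total mass of framed groups as a product of masses of single extensions
(`hasSum_fullFraming`). The mass is `1` for a non-abelian `N` and `|W| |H⁰| / (|V| |H¹|)` for a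
representation `V`.

So the sum is `|F|^{-u}` times a product over types of power series, with coefficients `(-1)^t / ∏
(q^k - 1)` or `(-1)^t / (t! |Aut|^t)`. Euler's identity turns the first kind into the infinite
product and the second is an exponential. The coefficients are at most `1 / t!` in absolute value,
so everything converges absolutely at every argument; as `Z(π) ≤ 2 ^ r` when the kernel has `r`
factors, the weight `Z(π)³` only multiplies each argument by `8`, which gives well-behavedness.

For integral `u` the argument of Euler's product is an integral power of `q`, because `V` and the
set of cocycles with extension in `L` are vector spaces over the endomorphism field. Then either no
factor is negative or one of them vanishes. The finiteness of the two systems holds because chief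
factors of groups in a level have bounded order. -/

theorem posetMoebius_self (a : α) : posetMoebius a a = 1 := by
  unfold posetMoebius
  simp

open Classical in
theorem sum_Icc_posetMoebius [Fintype α] (a b : α) :
    ∑ x ∈ Finset.univ.filter (fun x => a ≤ x ∧ x ≤ b), posetMoebius a x = if a = b then 1 else 0 := by
  let : LocallyFiniteOrder α := Fintype.toLocallyFiniteOrder
  have h := IncidenceAlgebra.sum_Icc_mu_right (𝕜 := ℤ) a b
  rw [← h]
  refine Finset.sum_congr ?_ fun x _ => ?_
  · ext x
    simp
  · unfold posetMoebius
    -- The definition of `posetMoebius` picks its own instances; all choices are equal.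
    congr!

open Classical in
theorem posetMoebius_of_lt [Fintype α] {a b : α} (h : a < b) :
    posetMoebius a b = -∑ x ∈ Finset.univ.filter (fun x => a ≤ x ∧ x < b), posetMoebius a x := by
  have hs := sum_Icc_posetMoebius a b
  rw [if_neg h.ne] at hs
  have : Finset.univ.filter (fun x => a ≤ x ∧ x ≤ b) =
      insert b (Finset.univ.filter (fun x => a ≤ x ∧ x < b)) := by
    ext x
    simp only [Finset.mem_filter, Finset.mem_univ, true_and, Finset.mem_insert, le_iff_lt_or_eq (b := b)]
    constructor
    · rintro ⟨h1, h2 | h2⟩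
      · exact Or.inr ⟨h1, h2⟩
      · exact Or.inl h2
    · rintro (rfl | h1)
      · exact ⟨h.le, Or.inr rfl⟩
      · exact ⟨h1.1, Or.inl h1.2⟩
  rw [this, Finset.sum_insert (by simp)] at hs
  linarith

/-- The Möbius function only depends on the interval. -/
theorem posetMoebius_map (f : α ↪o β) (a b : α) (hab : a ≤ b)
    (hf : ∀ y, f a ≤ y → y ≤ f b → ∃ x, f x = y) :
    posetMoebius (f a) (f b) = posetMoebius a b := by
  classical
  let : Fintype α := Fintype.ofFinite α
  let : Fintype β := Fintype.ofFinite β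
  induction b using WellFoundedLT.induction with
  | _ b ih =>
    rcases hab.eq_or_lt with rfl | hlt
    · rw [posetMoebius_self, posetMoebius_self]
    · rw [posetMoebius_of_lt hlt, posetMoebius_of_lt (f.lt_iff_lt.2 hlt)]
      congr 1
      symm
      refine Finset.sum_bij (fun x _ => f x) ?_ ?_ ?_ ?_
      · intro x hx
        simpa using hx
      · intro x _ y _ h
        exact f.injective h
      · intro y hy
        simp only [Finset.mem_filter, Finset.mem_univ, true_and] at hy
        obtain ⟨x, rfl⟩ := hf y hy.1 hy.2.le
        exact ⟨x, by simpa using hy, rfl⟩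
      · intro x hx
        simp only [Finset.mem_filter, Finset.mem_univ, true_and] at hx
        exact (ih x hx.2 hx.1 fun y h1 h2 => hf y h1 (h2.trans (f.le_iff_le.2 hx.2.le))).symm

end Moebius

open Classical in
/-- Weisner's theorem. -/
theorem sum_posetMoebius_sup_eq {α : Type*} [Lattice α] [Fintype α] {lo b hi : α} (h1 : lo < b)
    (h2 : b ≤ hi) :
    ∑ x ∈ Finset.univ.filter (fun x => lo ≤ x ∧ x ⊔ b = hi), posetMoebius lo x = 0 := by
  induction hi using WellFoundedLT.induction with
  | _ c ih =>
    -- Sorting the `x` in `[lo, c]` by `d = x ⊔ b` splits the vanishing sum of `μ(lo, x)` over this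
    -- interval. Induction kills the parts with `d < c`, and the part `d = c` is the claim.
    have key : ∑ d ∈ Finset.univ.filter (fun d => b ≤ d ∧ d ≤ c),
        ∑ x ∈ Finset.univ.filter (fun x => lo ≤ x ∧ x ⊔ b = d), posetMoebius lo x = 0 := by
      have := sum_Icc_posetMoebius lo c
      rw [if_neg (h1.trans_le h2).ne] at this
      rw [← this, Finset.sum_sigma']
      refine Finset.sum_bij (fun x _ => x.2) ?_ ?_ ?_ ?_
      · rintro ⟨d, x⟩ hx
        simp only [Finset.mem_sigma, Finset.mem_filter, Finset.mem_univ, true_and] at hx ⊢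
        exact ⟨hx.2.1, le_sup_left.trans (hx.2.2.le.trans hx.1.2)⟩
      · rintro ⟨d, x⟩ hx ⟨d', x'⟩ hx' h
        simp only [Finset.mem_sigma, Finset.mem_filter, Finset.mem_univ, true_and] at hx hx' h
        subst h
        obtain rfl : d = d' := hx.2.2.symm.trans hx'.2.2
        rfl
      · intro x hx
        simp only [Finset.mem_filter, Finset.mem_univ, true_and] at hx
        exact ⟨⟨x ⊔ b, x⟩, by simp [hx.1, hx.2, h2], rfl⟩
      · intros
        rfl
    rw [Finset.sum_eq_single c] at key
    · exact key
    · intro d hd hne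
      simp only [Finset.mem_filter, Finset.mem_univ, true_and] at hd
      exact ih d (lt_of_le_of_ne hd.2 hne) hd.1
    · intro h
      simp [h2] at h

/-! ### The Möbius function of an epimorphism -/

section MuHom

variable {G F : Type*} [Group G] [Group F]

instance [Finite G] : Finite (normalSublattice G) := Subtype.finite

instance normalSublattice.normal (A : normalSublattice G) : (A : Subgroup G).Normal := A.2

/-- The homomorphism `G ⧸ A → F` induced by `π : G → F`. -/
def quotMap (π : G →* F) (A : Subgroup G) [A.Normal] (h : A ≤ π.ker) : G ⧸ A →* F :=
  QuotientGroup.lift A π h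

theorem quotMap_surjective {π : G →* F} (hπ : Function.Surjective π) (A : Subgroup G) [A.Normal]
    (h : A ≤ π.ker) : Function.Surjective (quotMap π A h) := fun f => by
  obtain ⟨x, rfl⟩ := hπ f
  exact ⟨x, rfl⟩

theorem ker_quotMap (π : G →* F) (A : Subgroup G) [A.Normal] (h : A ≤ π.ker) :
    (quotMap π A h).ker = π.ker.map (QuotientGroup.mk' A) := by
  ext x
  obtain ⟨x, rfl⟩ := QuotientGroup.mk_surjective x
  constructor
  · intro hx
    exact ⟨x, hx, rfl⟩
  · rintro ⟨y, hy, hxy⟩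
    rw [← hxy]
    exact hy

/-- The quotients of `G ⧸ A` as quotients of `G`. -/
def quotientLatticeComap (A : Subgroup G) [A.Normal] : QuotientLattice (G ⧸ A) ↪o QuotientLattice G where
  toFun B := OrderDual.toDual ⟨(OrderDual.ofDual B).1.comap (QuotientGroup.mk' A),
    (OrderDual.ofDual B).2.comap _⟩
  inj' B C h := by
    have : (OrderDual.ofDual B).1.comap (QuotientGroup.mk' A) =
      (OrderDual.ofDual C).1.comap (QuotientGroup.mk' A) := congrArg (fun x => (OrderDual.ofDual x).1) h
    exact OrderDual.ofDual.injective (Subtype.ext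
      (Subgroup.comap_injective (QuotientGroup.mk'_surjective A) this))
  map_rel_iff' {B C} := by
    change (OrderDual.ofDual C).1.comap (QuotientGroup.mk' A) ≤
      (OrderDual.ofDual B).1.comap (QuotientGroup.mk' A) ↔ (OrderDual.ofDual C).1 ≤ (OrderDual.ofDual B).1
    exact Subgroup.comap_le_comap_of_surjective (QuotientGroup.mk'_surjective A)

/-- The quotients of `G ⧸ A` above `F` are the quotients of `G` between `F` and `G ⧸ A`. This makes
the terms of Weisner's sum Möbius functions of epimorphisms again, so that induction can run. -/
theorem muHom_quotMap [Finite G] (π : G →* F) (A : normalSublattice G) (h : (A : Subgroup G) ≤ π.ker) :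
    muHom (quotMap π A h) = posetMoebius (quotientOf π) (OrderDual.toDual A) := by
  unfold muHom
  have h1 : quotientLatticeComap (A : Subgroup G) (quotientOf (quotMap π A h)) = quotientOf π := by
    apply OrderDual.ofDual.injective
    apply Subtype.ext
    ext x
    rfl
  have h2 : quotientLatticeComap (A : Subgroup G) (quotientSelf (G ⧸ (A : Subgroup G))) =
      OrderDual.toDual A := by
    apply OrderDual.ofDual.injective
    apply Subtype.ext
    ext x
    change (QuotientGroup.mk x : G ⧸ (A : Subgroup G)) = 1 ↔ _
    exact QuotientGroup.eq_one_iff x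
  rw [← h1, ← h2]
  refine (posetMoebius_map (quotientLatticeComap (A : Subgroup G)) _ _ ?_ ?_).symm
  · change (MonoidHom.id (G ⧸ (A : Subgroup G))).ker ≤ _
    rw [MonoidHom.ker_id]
    exact bot_le
  · intro B _ hB
    rw [h2] at hB
    change (A : Subgroup G) ≤ (OrderDual.ofDual B).1 at hB
    refine ⟨OrderDual.toDual ⟨(OrderDual.ofDual B).1.map (QuotientGroup.mk' (A : Subgroup G)),
      (OrderDual.ofDual B).2.map _ (QuotientGroup.mk'_surjective _)⟩, ?_⟩
    apply OrderDual.ofDual.injective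
    apply Subtype.ext
    change ((OrderDual.ofDual B).1.map (QuotientGroup.mk' (A : Subgroup G))).comap
      (QuotientGroup.mk' (A : Subgroup G)) = (OrderDual.ofDual B).1
    rw [Subgroup.comap_map_eq, QuotientGroup.ker_mk', sup_eq_left.2 hB]

/-- Weisner's theorem for the Möbius function of an epimorphism. -/
theorem muHom_eq_neg_sum [Finite G] (π : G →* F) (B : Subgroup G) [hB : B.Normal] (h : B < π.ker)
    (s : Finset {A : normalSublattice G // (A : Subgroup G) ≤ π.ker})
    (hs : ∀ A, A ∈ s ↔ (A.1 : Subgroup G) ≠ ⊥ ∧ (A.1 : Subgroup G) ⊓ B = ⊥) :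
    muHom π = -∑ A ∈ s, muHom (quotMap π A.1 A.2) := by
  classical
  let : Fintype (QuotientLattice G) := Fintype.ofFinite _
  have hself : quotientSelf G = OrderDual.toDual ⟨⊥, Subgroup.normal_bot⟩ := by
    apply OrderDual.ofDual.injective
    apply Subtype.ext
    exact MonoidHom.ker_id
  -- In the dual order a join is an intersection of kernels and `G` is `⊥`, so the condition `x ⊔ b
  -- = hi` becomes `A ⊓ B = ⊥`. The term `A = ⊥`, split off next, is `μ(π)` itself.
  have hW := sum_posetMoebius_sup_eq (α := QuotientLattice G) (lo := quotientOf π)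
    (b := OrderDual.toDual ⟨B, hB⟩) (hi := quotientSelf G) h (by
      rw [hself]; exact (bot_le : ⊥ ≤ B))
  rw [← Finset.add_sum_erase _ _ (a := quotientSelf G)] at hW
  · change muHom π + _ = 0 at hW
    rw [eq_neg_of_add_eq_zero_left hW]
    congr 1
    symm
    refine Finset.sum_bij (fun A _ => OrderDual.toDual A.1) ?_ ?_ ?_ ?_
    · intro A hA
      rw [hs] at hA
      simp only [Finset.mem_erase, Finset.mem_filter, Finset.mem_univ, true_and, hself]
      refine ⟨fun h => hA.1 ?_, A.2, ?_⟩
      · exact congrArg (fun x => (OrderDual.ofDual x).1) h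
      · apply OrderDual.ofDual.injective
        apply Subtype.ext
        exact hA.2
    · intro A _ A' _ h
      exact Subtype.ext (OrderDual.toDual.injective h)
    · intro A hA
      simp only [Finset.mem_erase, Finset.mem_filter, Finset.mem_univ, true_and, hself] at hA
      refine ⟨⟨OrderDual.ofDual A, hA.2.1⟩, (hs _).2 ⟨fun h => hA.1 ?_, ?_⟩, rfl⟩
      · apply OrderDual.ofDual.injective
        apply Subtype.ext
        exact h
      · exact congrArg (fun x => (OrderDual.ofDual x).1) hA.2.2
    · intro A _
      exact muHom_quotMap π A.1 A.2
  · simp only [Finset.mem_filter, Finset.mem_univ, true_and, hself]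
    refine ⟨bot_le (a := π.ker), ?_⟩
    apply OrderDual.ofDual.injective
    apply Subtype.ext
    exact bot_inf_eq B

theorem muHom_eq_one_of_ker_eq_bot [Finite G] (π : G →* F) (h : π.ker = ⊥) : muHom π = 1 := by
  unfold muHom
  have : quotientOf π = quotientSelf G := by
    apply OrderDual.ofDual.injective
    apply Subtype.ext
    exact h.trans (MonoidHom.ker_id).symm
  rw [this, posetMoebius_self]

end MuHom

/-! ### Morphisms of `[F]`-groups -/

namespace OuterGroup

variable {F : Type} [Group F]

theorem exists_lift (A : OuterGroup F) (g : F) : ∃ σ : MulAut A.N, toOuter A.N σ = A.act g :=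
  QuotientGroup.mk'_surjective _ _

theorem exists_conj_of_toOuter_eq {N : Type*} [Group N] {σ σ' : MulAut N}
    (h : toOuter N σ = toOuter N σ') : ∃ n : N, σ' = σ * MulAut.conj n := by
  obtain ⟨n, hn⟩ := QuotientGroup.eq.1 h
  exact ⟨n, by rw [hn, mul_inv_cancel_left]⟩

theorem toOuter_mul_conj {N : Type*} [Group N] (σ : MulAut N) (n : N) :
    toOuter N (σ * MulAut.conj n) = toOuter N σ := by
  symm
  exact QuotientGroup.eq.2 ⟨n, by simp⟩

/-- It suffices to test one lift for every element of `F`. -/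
theorem isMorphism_of_exists {A B : OuterGroup F} {f : A.N →* B.N}
    (h : ∀ g : F, ∃ (σ : MulAut A.N) (σ' : MulAut B.N), toOuter A.N σ = A.act g ∧
      toOuter B.N σ' = B.act g ∧ ∀ x, σ' (f x) = f (σ x)) : A.IsMorphism B f := by
  intro g σ₁ h₁
  obtain ⟨σ, σ', hσ, hσ', hc⟩ := h g
  obtain ⟨n, rfl⟩ := exists_conj_of_toOuter_eq (hσ.trans h₁.symm)
  refine ⟨σ' * MulAut.conj (f n), by rw [toOuter_mul_conj, hσ'], fun x => ?_⟩
  simp [MulAut.conj_apply, hc]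

theorem IsMorphism.comp {A B C : OuterGroup F} {f : A.N →* B.N} {f' : B.N →* C.N}
    (hf' : B.IsMorphism C f') (hf : A.IsMorphism B f) : A.IsMorphism C (f'.comp f) := by
  intro g σ h
  obtain ⟨σ₂, h₂, hc⟩ := hf g σ h
  obtain ⟨σ₃, h₃, hc'⟩ := hf' g σ₂ h₂
  exact ⟨σ₃, h₃, fun x => by simp [hc', hc]⟩

theorem IsMorphism.symm {A B : OuterGroup F} {e : A.N ≃* B.N} (h : A.IsMorphism B e.toMonoidHom) :
    B.IsMorphism A e.symm.toMonoidHom := by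
  refine isMorphism_of_exists fun g => ?_
  obtain ⟨σ, hσ⟩ := A.exists_lift g
  obtain ⟨σ', hσ', hc⟩ := h g σ hσ
  refine ⟨σ', σ, hσ', hσ, fun x => ?_⟩
  obtain ⟨y, rfl⟩ := e.surjective x
  have := hc y
  simp only [MulEquiv.toMonoidHom_eq_coe, MonoidHom.coe_coe] at this ⊢
  rw [this]
  simp

theorem isMorphism_id (A : OuterGroup F) : A.IsMorphism A (MonoidHom.id _) :=
  fun _ σ h => ⟨σ, h, fun _ => rfl⟩

/-- An automorphism-invariant normal subgroup only has to be tested on one lift. -/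
theorem IsSimple.eq_bot_or_top {A : OuterGroup F} (hA : A.IsSimple) (K : Subgroup A.N) [hK : K.Normal]
    (h : ∀ g : F, ∃ σ : MulAut A.N, toOuter A.N σ = A.act g ∧ ∀ x ∈ K, σ x ∈ K) :
    K = ⊥ ∨ K = ⊤ := by
  refine hA.2 K hK fun g σ hσ => ?_
  obtain ⟨σ', hσ', hK'⟩ := h g
  obtain ⟨n, rfl⟩ := exists_conj_of_toOuter_eq (hσ'.trans hσ.symm)
  have hle : K.map (σ' * MulAut.conj n).toMonoidHom ≤ K := by
    rintro _ ⟨x, hx, rfl⟩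
    exact hK' _ (hK.conj_mem x hx n)
  refine Subgroup.eq_of_le_of_card_ge hle ?_
  rw [Nat.card_congr (K.equivMapOfInjective (σ' * MulAut.conj n).toMonoidHom
    (σ' * MulAut.conj n).injective).toEquiv]

/-- A morphism of simple `[F]`-groups with normal image is trivial or bijective. -/
theorem IsMorphism.eq_one_or_bijective {A B : OuterGroup F} (hA : A.IsSimple) (hB : B.IsSimple)
    {f : A.N →* B.N} (hf : A.IsMorphism B f) (hn : f.range.Normal) :
    f = 1 ∨ Function.Bijective f := by
  rcases hA.eq_bot_or_top f.ker (fun g => by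
    obtain ⟨σ, hσ⟩ := A.exists_lift g
    obtain ⟨σ', -, hc⟩ := hf g σ hσ
    refine ⟨σ, hσ, fun x hx => ?_⟩
    rw [MonoidHom.mem_ker] at hx ⊢
    rw [← hc, hx, map_one]) with h | h
  · have hinj := (MonoidHom.ker_eq_bot_iff f).1 h
    rcases hB.eq_bot_or_top f.range (fun g => by
      obtain ⟨σ, hσ⟩ := A.exists_lift g
      obtain ⟨σ', hσ', hc⟩ := hf g σ hσ
      refine ⟨σ', hσ', ?_⟩
      rintro _ ⟨x, rfl⟩
      exact ⟨σ x, (hc x).symm⟩) with h' | h'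
    · left
      ext x
      have : f x ∈ f.range := ⟨x, rfl⟩
      rw [h'] at this
      exact this
    · exact Or.inr ⟨hinj, MonoidHom.range_eq_top.1 h'⟩
  · left
    ext x
    have : x ∈ f.ker := by rw [h]; trivial
    exact this

/-- Morphisms of `[F]`-groups with normal image. -/
abbrev NormalMorphism (A B : OuterGroup F) : Type :=
  {f : A.N →* B.N // A.IsMorphism B f ∧ f.range.Normal}

/-- The isomorphism given by a bijective morphism. -/
noncomputable def equivOfBijective {A B : OuterGroup F} (f : A.N →* B.N) (hf : A.IsMorphism B f)
    (hb : Function.Bijective f) : A.Equiv B :=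
  ⟨MulEquiv.ofBijective f hb, hf, IsMorphism.symm (e := MulEquiv.ofBijective f hb) hf⟩

theorem one_isMorphism (A B : OuterGroup F) : A.IsMorphism B 1 := by
  refine isMorphism_of_exists fun g => ?_
  obtain ⟨σ, hσ⟩ := A.exists_lift g
  obtain ⟨σ', hσ'⟩ := B.exists_lift g
  exact ⟨σ, σ', hσ, hσ', fun x => by simp⟩

theorem normal_range_one (A B : OuterGroup F) : (1 : A.N →* B.N).range.Normal := by
  rw [MonoidHom.range_one]
  infer_instance

instance (A B : OuterGroup F) : Finite (A.N →* B.N) :=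
  Finite.of_injective (fun f : A.N →* B.N => (f : A.N → B.N)) DFunLike.coe_injective

instance (A B : OuterGroup F) : Finite (A.Equiv B) :=
  Finite.of_injective (fun e : A.Equiv B => e.1.toMonoidHom) fun e e' h => by
    apply Subtype.ext
    ext x
    exact DFunLike.congr_fun h x

end OuterGroup

/-! ### Embeddings of `[F]`-groups and products of `[F]`-groups into extensions of `F` -/

open OuterGroup

section Embedding

variable {F : Type} [Group F] {G : Type} [Group G]

/-- `j` embeds `S` as a normal subgroup of `G` inside the kernel of `π : G → F`, compatibly with the
outer actions. -/
structure IsEmb (π : G →* F) (S : OuterGroup F) (j : S.N →* G) : Prop where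
  inj : Function.Injective j
  le_ker : j.range ≤ π.ker
  equivariant : ∀ x : G, ∃ σ : MulAut S.N, toOuter S.N σ = S.act (π x) ∧
    ∀ s, x * j s * x⁻¹ = j (σ s)

/-- `J` embeds a product of `[F]`-groups as a normal subgroup of `G` inside the kernel of
`π : G → F`, compatibly with the outer actions. -/
structure IsFraming (π : G →* F) {κ : Type} (A : κ → OuterGroup F) (J : (∀ k, (A k).N) →* G) :
    Prop where
  inj : Function.Injective J
  le_ker : J.range ≤ π.ker
  equivariant : ∀ x : G, ∃ σ : ∀ k, MulAut (A k).N, (∀ k, toOuter _ (σ k) = (A k).act (π x)) ∧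
    ∀ s, x * J s * x⁻¹ = J fun k => σ k (s k)

variable {π : G →* F}

theorem IsEmb.normal {S : OuterGroup F} {j : S.N →* G} (h : IsEmb π S j) : j.range.Normal := by
  refine ⟨?_⟩
  rintro _ ⟨s, rfl⟩ x
  obtain ⟨σ, -, hσ⟩ := h.equivariant x
  exact ⟨σ s, (hσ s).symm⟩

theorem IsFraming.normal {κ : Type} {A : κ → OuterGroup F} {J : (∀ k, (A k).N) →* G}
    (h : IsFraming π A J) : J.range.Normal := by
  refine ⟨?_⟩
  rintro _ ⟨s, rfl⟩ x
  obtain ⟨σ, -, hσ⟩ := h.equivariant x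
  exact ⟨_, (hσ s).symm⟩

/-- The image of a simple `[F]`-group is a minimal normal subgroup. -/
theorem IsEmb.eq_bot_or_eq {S : OuterGroup F} (hS : S.IsSimple) {j : S.N →* G} (h : IsEmb π S j)
    (hπ : Function.Surjective π) (C : Subgroup G) [hC : C.Normal] (hle : C ≤ j.range) :
    C = ⊥ ∨ C = j.range := by
  rcases hS.eq_bot_or_top (C.comap j) (fun g => by
    obtain ⟨x, rfl⟩ := hπ g
    obtain ⟨σ, hσ, hc⟩ := h.equivariant x
    refine ⟨σ, hσ, fun s hs => ?_⟩
    rw [Subgroup.mem_comap, ← hc]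
    exact hC.conj_mem _ hs x) with h' | h'
  · left
    rw [eq_bot_iff]
    intro x hx
    obtain ⟨s, rfl⟩ := hle hx
    have : s ∈ C.comap j := hx
    rw [h', Subgroup.mem_bot] at this
    rw [this, map_one]
    exact one_mem _
  · right
    refine le_antisymm hle ?_
    rintro _ ⟨s, rfl⟩
    have : s ∈ C.comap j := by rw [h']; trivial
    exact this

theorem IsEmb.disjoint_or_le {S : OuterGroup F} (hS : S.IsSimple) {j : S.N →* G} (h : IsEmb π S j)
    (hπ : Function.Surjective π) (C : Subgroup G) [hC : C.Normal] :
    j.range ⊓ C = ⊥ ∨ j.range ≤ C := by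
  have := h.normal
  rcases h.eq_bot_or_eq hS hπ (j.range ⊓ C) inf_le_left with h' | h'
  · exact Or.inl h'
  · exact Or.inr (inf_eq_left.1 h')

theorem IsEmb.range_ne_bot {S : OuterGroup F} (hS : S.IsSimple) {j : S.N →* G} (h : IsEmb π S j) :
    j.range ≠ ⊥ := by
  intro h'
  have := hS.1
  obtain ⟨a, ha⟩ := exists_ne (1 : S.N)
  apply ha
  apply h.inj
  have : j a ∈ j.range := ⟨a, rfl⟩
  rw [h', Subgroup.mem_bot] at this
  rw [this, map_one]

/-! ### Components of embeddings into a framed product. -/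

section Pi

variable {κ : Type} {A : κ → OuterGroup F} {J : (∀ k, (A k).N) →* G}

/-- The `k`-th component of a framing. -/
def framingComponent [DecidableEq κ] (J : (∀ k, (A k).N) →* G) (k : κ) : (A k).N →* G :=
  J.comp (MonoidHom.mulSingle (fun k => (A k).N) k)

theorem framingComponent_apply [DecidableEq κ] (k : κ) (s : (A k).N) :
    framingComponent J k s = J (Pi.mulSingle k s) := rfl

theorem IsFraming.isEmb_component [DecidableEq κ] (h : IsFraming π A J) (k : κ) :
    IsEmb π (A k) (framingComponent J k) where
  inj := fun s t hst => Pi.mulSingle_injective k (h.inj hst)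
  le_ker := by
    rintro _ ⟨s, rfl⟩
    exact h.le_ker ⟨_, rfl⟩
  equivariant x := by
    obtain ⟨σ, hσ, hc⟩ := h.equivariant x
    refine ⟨σ k, hσ k, fun s => ?_⟩
    rw [framingComponent_apply, framingComponent_apply, hc]
    congr 1
    ext l
    rcases eq_or_ne l k with rfl | hl
    · simp
    · simp [Pi.mulSingle_eq_of_ne hl]

/-- The components of an embedding into the image of a framing. -/
noncomputable def componentHom (h : IsFraming π A J) {S : OuterGroup F} (j : S.N →* G)
    (hle : j.range ≤ J.range) (k : κ) : S.N →* (A k).N :=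
  (Pi.evalMonoidHom _ k).comp ((MonoidHom.ofInjective h.inj).symm.toMonoidHom.comp
    (j.codRestrict J.range fun s => hle ⟨s, rfl⟩))

theorem apply_componentHom (h : IsFraming π A J) {S : OuterGroup F} (j : S.N →* G)
    (hle : j.range ≤ J.range) (s : S.N) : J (fun k => componentHom h j hle k s) = j s := by
  have := (MonoidHom.ofInjective h.inj).apply_symm_apply
    (j.codRestrict J.range (fun s => hle ⟨s, rfl⟩) s)
  have := congrArg Subtype.val this
  exact this

theorem componentHom_eq_iff (h : IsFraming π A J) {S : OuterGroup F} (j : S.N →* G)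
    (hle : j.range ≤ J.range) (s : S.N) (t : ∀ k, (A k).N) :
    j s = J t ↔ ∀ k, componentHom h j hle k s = t k := by
  rw [← apply_componentHom h j hle, h.inj.eq_iff, funext_iff]

/-- Conjugation by elements of the `k`-th factor preserves `j(S)`, which makes the image of the
component normal there. So each component is trivial or bijective once the groups are simple. -/
theorem componentHom_isMorphism (h : IsFraming π A J) {S : OuterGroup F} {j : S.N →* G}
    (hj : IsEmb π S j) (hπ : Function.Surjective π) (hle : j.range ≤ J.range) (k : κ) :
    S.IsMorphism (A k) (componentHom h j hle k) ∧ (componentHom h j hle k).range.Normal := by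
  constructor
  · refine isMorphism_of_exists fun g => ?_
    obtain ⟨x, rfl⟩ := hπ g
    obtain ⟨σ, hσ, hc⟩ := hj.equivariant x
    obtain ⟨σ', hσ', hc'⟩ := h.equivariant x
    refine ⟨σ, σ' k, hσ, hσ' k, fun s => ?_⟩
    have := hc s
    rw [← apply_componentHom h j hle s, hc', eq_comm, componentHom_eq_iff h j hle] at this
    exact (this k).symm
  · classical
    refine ⟨?_⟩
    rintro _ ⟨s, rfl⟩ a
    obtain ⟨σ, -, hc⟩ := hj.equivariant (J (Pi.mulSingle k a))
    refine ⟨σ s, ?_⟩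
    have := hc s
    rw [← apply_componentHom h j hle s, ← map_mul, ← map_inv, ← map_mul, eq_comm,
      componentHom_eq_iff h j hle] at this
    rw [this k]
    simp

end Pi

/-! ### The number of embeddings into a product -/

variable {κ : Type} {A : κ → OuterGroup F} {J : (∀ k, (A k).N) →* G}

instance [Finite G] (A : κ → OuterGroup F) [Finite κ] : Finite ((∀ k, (A k).N) →* G) :=
  Finite.of_injective (fun f : (∀ k, (A k).N) →* G => (f : (∀ k, (A k).N) → G)) DFunLike.coe_injective

instance [Finite G] (A : OuterGroup F) : Finite (A.N →* G) :=
  Finite.of_injective (fun f : A.N →* G => (f : A.N → G)) DFunLike.coe_injective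

/-- A non-abelian group has no normal diagonal in a product, so an embedding is an isomorphism onto
a single factor. -/
theorem card_emb_nonabelian [Fintype κ] (h : IsFraming π A J) (hπ : Function.Surjective π)
    (hA : ∀ k, (A k).IsSimple) {S : OuterGroup F} (hS : S.IsSimple) (hSn : S.IsNonabelian) :
    Nat.card {j : S.N →* G // IsEmb π S j ∧ j.range ≤ J.range} =
      ∑ k, Nat.card (S.Equiv (A k)) := by
  classical
  rw [← Nat.card_sigma]
  symm
  refine Nat.card_congr (Equiv.ofBijective (fun x : Σ k, S.Equiv (A k) =>
    ⟨(framingComponent J x.1).comp x.2.1.toMonoidHom, ?_, ?_⟩) ⟨?_, ?_⟩)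
  · obtain ⟨k, e, he, he'⟩ := x
    have hk := h.isEmb_component k
    refine ⟨hk.inj.comp e.injective, ?_, fun x => ?_⟩
    · rintro _ ⟨s, rfl⟩
      exact hk.le_ker ⟨_, rfl⟩
    · obtain ⟨σ, hσ, hc⟩ := hk.equivariant x
      obtain ⟨σ', hσ', hc'⟩ := he' _ σ hσ
      refine ⟨σ', hσ', fun s => ?_⟩
      have := hc' (e s)
      simp only [MulEquiv.toMonoidHom_eq_coe, MonoidHom.coe_coe, MulEquiv.symm_apply_apply] at this
      simp [hc, this]
  · rintro _ ⟨s, rfl⟩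
    exact ⟨_, rfl⟩
  · rintro ⟨k, e, he⟩ ⟨l, e', he'⟩ hkl
    have hkl : ∀ s, Pi.mulSingle k (e s) = (Pi.mulSingle l (e' s) : ∀ k, (A k).N) := fun s =>
      h.inj (DFunLike.congr_fun (congrArg Subtype.val hkl) s)
    have hkl' : k = l := by
      by_contra hne
      have := hS.1
      obtain ⟨a, ha⟩ := exists_ne (1 : S.N)
      have h1 := congrFun (hkl a) k
      rw [Pi.mulSingle_eq_same, Pi.mulSingle_eq_of_ne hne] at h1
      exact ha (e.injective (h1.trans (map_one e).symm))
    subst hkl'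
    congr 1
    apply Subtype.ext
    ext s
    exact Pi.mulSingle_injective k (hkl s)
  · rintro ⟨j, hj, hle⟩
    have hm := componentHom_isMorphism h hj hπ hle
    have hd := fun k => (hm k).1.eq_one_or_bijective hS (hA k) (hm k).2
    obtain ⟨k, hk⟩ : ∃ k, componentHom h j hle k ≠ 1 := by
      by_contra! hall
      apply hj.range_ne_bot hS
      rw [eq_bot_iff]
      rintro _ ⟨s, rfl⟩
      rw [← apply_componentHom h j hle]
      simp only [hall]
      exact map_one J
    have hkb := (hd k).resolve_left hk
    -- Conjugation by the element `a` of the `k`-th slot does not change the `l`-th component. If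
    -- that component were injective, then `σ b = b`, and the `k`-th component would read `a * b *
    -- a⁻¹ = b`.
    have hone : ∀ l, l ≠ k → componentHom h j hle l = 1 := by
      intro l hl
      refine (hd l).resolve_right fun hb => ?_
      obtain ⟨a, b, hab⟩ := hSn
      apply hab
      obtain ⟨σ, -, hc⟩ := hj.equivariant (J (Pi.mulSingle k (componentHom h j hle k a)))
      have hb' := hc b
      rw [← apply_componentHom h j hle b, ← map_mul, ← map_inv, ← map_mul, eq_comm,
        componentHom_eq_iff h j hle] at hb'
      have h1 := hb' l
      simp only [Pi.mul_apply, Pi.inv_apply, Pi.mulSingle_eq_of_ne hl, one_mul, inv_one, mul_one] at h1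
      have h2 := hb' k
      rw [hb.1 h1] at h2
      simp only [Pi.mul_apply, Pi.inv_apply, Pi.mulSingle_eq_same] at h2
      rw [← map_mul, ← map_inv, ← map_mul] at h2
      have := hkb.1 h2
      rw [eq_comm, mul_inv_eq_iff_eq_mul] at this
      exact this
    refine ⟨⟨k, equivOfBijective _ (hm k).1 hkb⟩, ?_⟩
    apply Subtype.ext
    ext s
    change J (Pi.mulSingle k (componentHom h j hle k s)) = j s
    rw [eq_comm, componentHom_eq_iff h j hle]
    intro l
    rcases eq_or_ne l k with rfl | hl
    · simp
    · rw [hone l hl, Pi.mulSingle_eq_of_ne hl]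
      rfl

/-- For commutative `S` diagonals are allowed: any choice of components, each trivial or bijective,
is an embedding unless all are trivial. The summand `1` accounts for the trivial family. -/
theorem card_emb_abelian [Fintype κ] (h : IsFraming π A J) (hπ : Function.Surjective π)
    (hA : ∀ k, (A k).IsSimple) {S : OuterGroup F} (hS : S.IsSimple) (hSa : ¬ S.IsNonabelian) :
    Nat.card {j : S.N →* G // IsEmb π S j ∧ j.range ≤ J.range} + 1 =
      ∏ k, Nat.card (S.NormalMorphism (A k)) := by
  classical
  rw [← Nat.card_pi]
  have hcomm : ∀ a b : S.N, a * b = b * a := by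
    intro a b
    by_contra hab
    exact hSa ⟨a, b, hab⟩
  have hdi : ∀ k, ∀ f : S.NormalMorphism (A k), f.1 = 1 ∨ Function.Bijective f.1 := fun k f =>
    f.2.1.eq_one_or_bijective hS (hA k) f.2.2
  let one : ∀ k, S.NormalMorphism (A k) := fun k => ⟨1, one_isMorphism _ _, normal_range_one _ _⟩
  have hcard : Nat.card {f : ∀ k, S.NormalMorphism (A k) // f ≠ one} + 1 =
      Nat.card (∀ k, S.NormalMorphism (A k)) := by
    rw [← Nat.card_congr (Equiv.optionSubtypeNe one), Finite.card_option]
  rw [← hcard]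
  congr 1
  refine Nat.card_congr (Equiv.ofBijective (fun j => ⟨fun k => ⟨componentHom h j.1 j.2.2 k,
    componentHom_isMorphism h j.2.1 hπ j.2.2 k⟩, ?_⟩) ⟨?_, ?_⟩)
  · intro h1
    apply j.2.1.range_ne_bot hS
    rw [eq_bot_iff]
    rintro _ ⟨s, rfl⟩
    rw [← apply_componentHom h j.1 j.2.2]
    have : ∀ k, componentHom h j.1 j.2.2 k s = 1 := fun k => by
      have := congrArg Subtype.val (congrFun h1 k)
      exact DFunLike.congr_fun this s
    simp only [this]
    exact map_one J
  · intro j j' hjj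
    apply Subtype.ext
    ext s
    rw [← apply_componentHom h j.1 j.2.2, ← apply_componentHom h j'.1 j'.2.2]
    congr 1
    ext k
    have := congrArg Subtype.val (congrFun (congrArg Subtype.val hjj) k)
    exact DFunLike.congr_fun this s
  · rintro ⟨f, hf⟩
    obtain ⟨l, hl⟩ : ∃ l, (f l).1 ≠ 1 := by
      by_contra! hall
      apply hf
      funext k
      exact Subtype.ext (hall k)
    have hlb := (hdi l (f l)).resolve_left hl
    let j : S.N →* G := J.comp (MonoidHom.pi fun k => (f k).1)
    have hjapp : ∀ s, j s = J fun k => (f k).1 s := fun s => rfl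
    have hj : IsEmb π S j := by
      refine ⟨?_, ?_, fun x => ?_⟩
      · intro s t hst
        exact hlb.1 (congrFun (h.inj hst) l)
      · rintro _ ⟨s, rfl⟩
        exact h.le_ker ⟨_, rfl⟩
      · obtain ⟨σ', hσ', hc⟩ := h.equivariant x
        obtain ⟨σ, hσ⟩ := S.exists_lift (π x)
        refine ⟨σ, hσ, fun s => ?_⟩
        rw [hjapp, hjapp, hc]
        congr 1
        funext k
        rcases hdi k (f k) with h1 | hb
        · simp [h1]
        -- A bijective component makes the `k`-th factor commutative, so two lifts of the same outer
        -- class act on it in the same way.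
        · obtain ⟨σ'', hσ'', hc''⟩ := (f k).2.1 _ σ hσ
          rw [← hc'']
          obtain ⟨n, rfl⟩ := exists_conj_of_toOuter_eq ((hσ' k).trans hσ''.symm)
          rw [MulAut.mul_apply, MulAut.conj_apply]
          congr 1
          obtain ⟨n, rfl⟩ := hb.2 n
          rw [← map_mul, hcomm n s, ← map_inv, ← map_mul, mul_inv_cancel_right]
    have hle : j.range ≤ J.range := by
      rintro _ ⟨s, rfl⟩
      exact ⟨_, rfl⟩
    refine ⟨⟨j, hj, hle⟩, ?_⟩
    apply Subtype.ext
    funext k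
    apply Subtype.ext
    ext s
    exact (componentHom_eq_iff h j hle s fun k => (f k).1 s).1 rfl k

end Embedding

/-! ### Adding a factor to a framing -/

section Cons

variable {F : Type} [Group F] {G : Type} [Group G] {π : G →* F}

/-- The family without its first member. -/
def framingTail {r : ℕ} {A : Fin (r + 1) → OuterGroup F} (J : (∀ k, (A k).N) →* G) :
    (∀ k : Fin r, (A k.succ).N) →* G :=
  J.comp
    { toFun := fun s => (Fin.cons (1 : (A 0).N) s : ∀ k, (A k).N)
      map_one' := by
        funext k
        refine Fin.cases ?_ (fun k => ?_) k <;> simp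
      map_mul' := fun s t => by
        funext k
        refine Fin.cases ?_ (fun k => ?_) k <;> simp }

theorem framingTail_apply {r : ℕ} {A : Fin (r + 1) → OuterGroup F} (J : (∀ k, (A k).N) →* G)
    (s : ∀ k : Fin r, (A k.succ).N) :
    framingTail J s = J (Fin.cons (1 : (A 0).N) s : ∀ k, (A k).N) := rfl

theorem framingComponent_mul_framingTail {r : ℕ} {A : Fin (r + 1) → OuterGroup F}
    (J : (∀ k, (A k).N) →* G) (s : ∀ k, (A k).N) :
    framingComponent J 0 (s 0) * framingTail J (fun k => s k.succ) = J s := by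
  rw [framingComponent_apply, framingTail_apply, ← map_mul]
  congr 1
  funext k
  refine Fin.cases ?_ (fun k => ?_) k
  · simp
  · simp

/-- The framing with a first factor added. -/
def framingCons {r : ℕ} {A : Fin (r + 1) → OuterGroup F} (j : (A 0).N →* G)
    (J : (∀ k : Fin r, (A k.succ).N) →* G) (h : ∀ a b, Commute (j a) (J b)) :
    (∀ k, (A k).N) →* G where
  toFun s := j (s 0) * J fun k => s k.succ
  map_one' := by
    change j 1 * J 1 = 1
    simp
  map_mul' s t := by
    change j (s 0 * t 0) * J ((fun k : Fin r => s k.succ) * fun k : Fin r => t k.succ) = _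
    rw [map_mul, map_mul, mul_assoc, mul_assoc, ← mul_assoc (j (t 0)), (h _ _).eq, mul_assoc]

theorem framingCons_apply {r : ℕ} {A : Fin (r + 1) → OuterGroup F} (j : (A 0).N →* G)
    (J : (∀ k : Fin r, (A k.succ).N) →* G) (h : ∀ a b, Commute (j a) (J b)) (s : ∀ k, (A k).N) :
    framingCons j J h s = j (s 0) * J fun k => s k.succ := rfl

theorem framingComponent_framingCons {r : ℕ} {A : Fin (r + 1) → OuterGroup F} (j : (A 0).N →* G)
    (J : (∀ k : Fin r, (A k.succ).N) →* G) (h : ∀ a b, Commute (j a) (J b)) :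
    framingComponent (framingCons j J h) 0 = j := by
  ext s
  rw [framingComponent_apply, framingCons_apply, Pi.mulSingle_eq_same]
  have : (fun k : Fin r => (Pi.mulSingle (0 : Fin (r + 1)) s : ∀ k, (A k).N) k.succ) = 1 := by
    funext k
    exact Pi.mulSingle_eq_of_ne (Fin.succ_ne_zero k) s
  rw [this, map_one, mul_one]

theorem framingTail_framingCons {r : ℕ} {A : Fin (r + 1) → OuterGroup F} (j : (A 0).N →* G)
    (J : (∀ k : Fin r, (A k.succ).N) →* G) (h : ∀ a b, Commute (j a) (J b)) :
    framingTail (framingCons j J h) = J := by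
  ext s
  rw [framingTail_apply, framingCons_apply]
  simp

theorem IsFraming.tail {r : ℕ} {A : Fin (r + 1) → OuterGroup F} {J : (∀ k, (A k).N) →* G}
    (h : IsFraming π A J) : IsFraming π (fun k : Fin r => A k.succ) (framingTail J) where
  inj s t hst := Fin.cons_right_injective (α := fun k => (A k).N) 1 (h.inj hst)
  le_ker := by
    rintro _ ⟨s, rfl⟩
    exact h.le_ker ⟨_, rfl⟩
  equivariant x := by
    obtain ⟨σ, hσ, hc⟩ := h.equivariant x
    refine ⟨fun k => σ k.succ, fun k => hσ k.succ, fun s => ?_⟩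
    rw [framingTail_apply, framingTail_apply, hc]
    congr 1
    funext k
    refine Fin.cases ?_ (fun k => ?_) k <;> simp

theorem commute_of_inf_eq_bot {M B : Subgroup G} [hM : M.Normal] [hB : B.Normal] (h : M ⊓ B = ⊥)
    {a b : G} (ha : a ∈ M) (hb : b ∈ B) : Commute a b :=
  Subgroup.commute_of_normal_of_disjoint M B hM hB (disjoint_iff.2 h) a b ha hb

theorem IsFraming.head_inf_tail {r : ℕ} {A : Fin (r + 1) → OuterGroup F} {J : (∀ k, (A k).N) →* G}
    (h : IsFraming π A J) : (framingComponent J 0).range ⊓ (framingTail J).range = ⊥ := by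
  rw [eq_bot_iff]
  rintro _ ⟨⟨s, rfl⟩, ⟨t, ht⟩⟩
  rw [framingTail_apply, framingComponent_apply] at ht
  have := congrFun (h.inj ht) 0
  rw [Pi.mulSingle_eq_same, Fin.cons_zero] at this
  rw [← this, map_one]
  exact one_mem _

theorem isFraming_cons {r : ℕ} {A : Fin (r + 1) → OuterGroup F} {j : (A 0).N →* G}
    {J : (∀ k : Fin r, (A k.succ).N) →* G} (hj : IsEmb π (A 0) j)
    (hJ : IsFraming π (fun k : Fin r => A k.succ) J) (h : j.range ⊓ J.range = ⊥)
    (hcomm : ∀ a b, Commute (j a) (J b)) : IsFraming π A (framingCons j J hcomm) where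
  inj := by
    rw [injective_iff_map_eq_one]
    intro s hs
    rw [framingCons_apply] at hs
    have h1 : j (s 0) ∈ j.range ⊓ J.range := by
      refine ⟨⟨_, rfl⟩, ?_⟩
      rw [eq_inv_of_mul_eq_one_left hs]
      exact J.range.inv_mem ⟨_, rfl⟩
    rw [h, Subgroup.mem_bot] at h1
    rw [h1, one_mul] at hs
    have h0 : s 0 = 1 := hj.inj (h1.trans (map_one j).symm)
    have hsu := hJ.inj (hs.trans (map_one J).symm)
    funext k
    refine Fin.cases ?_ (fun k => ?_) k
    · exact h0
    · exact congrFun hsu k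
  le_ker := by
    rintro _ ⟨s, rfl⟩
    rw [framingCons_apply]
    exact mul_mem (hj.le_ker ⟨_, rfl⟩) (hJ.le_ker ⟨_, rfl⟩)
  equivariant x := by
    obtain ⟨σ, hσ, hc⟩ := hj.equivariant x
    obtain ⟨σ', hσ', hc'⟩ := hJ.equivariant x
    refine ⟨fun k => Fin.cases (motive := fun k => MulAut (A k).N) σ σ' k, fun k => ?_, fun s => ?_⟩
    · refine Fin.cases ?_ (fun k => ?_) k
      · exact hσ
      · exact hσ' k
    · rw [framingCons_apply, framingCons_apply]
      have e1 := hc (s 0)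
      have e2 := hc' fun k => s k.succ
      calc x * (j (s 0) * J fun k => s k.succ) * x⁻¹
          = (x * j (s 0) * x⁻¹) * (x * (J fun k => s k.succ) * x⁻¹) := by group
        _ = _ := by rw [e1, e2]; rfl

theorem range_eq_sup {r : ℕ} {A : Fin (r + 1) → OuterGroup F} (J : (∀ k, (A k).N) →* G) :
    J.range = (framingComponent J 0).range ⊔ (framingTail J).range := by
  apply le_antisymm
  · rintro _ ⟨s, rfl⟩
    rw [← framingComponent_mul_framingTail]
    exact mul_mem ((le_sup_left : (framingComponent J 0).range ≤ _) ⟨_, rfl⟩)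
      ((le_sup_right : (framingTail J).range ≤ _) ⟨_, rfl⟩)
  · refine sup_le ?_ ?_
    · rintro _ ⟨s, rfl⟩
      exact ⟨_, rfl⟩
    · rintro _ ⟨s, rfl⟩
      exact ⟨_, rfl⟩

theorem not_range_le_iff {r : ℕ} {A : Fin (r + 1) → OuterGroup F} (hA : (A 0).IsSimple)
    (hπ : Function.Surjective π) {j : (A 0).N →* G} {J : (∀ k : Fin r, (A k.succ).N) →* G}
    (hj : IsEmb π (A 0) j) (hJ : IsFraming π (fun k : Fin r => A k.succ) J) :
    ¬ j.range ≤ J.range ↔ j.range ⊓ J.range = ⊥ := by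
  have := hJ.normal
  constructor
  · exact fun h => (hj.disjoint_or_le hA hπ J.range).resolve_right h
  · intro h hle
    rw [inf_eq_left.2 hle] at h
    exact hj.range_ne_bot hA h

theorem commute_of_not_range_le {r : ℕ} {A : Fin (r + 1) → OuterGroup F} (hA : (A 0).IsSimple)
    (hπ : Function.Surjective π) {j : (A 0).N →* G} {J : (∀ k : Fin r, (A k.succ).N) →* G}
    (hj : IsEmb π (A 0) j) (hJ : IsFraming π (fun k : Fin r => A k.succ) J)
    (h : ¬ j.range ≤ J.range) (a) (b) : Commute (j a) (J b) :=
  have := hj.normal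
  have := hJ.normal
  commute_of_inf_eq_bot ((not_range_le_iff hA hπ hj hJ).1 h) ⟨a, rfl⟩ ⟨b, rfl⟩

/-- A framing consists of a framing without the first factor and an embedding of the first factor
outside its image. -/
noncomputable def framingConsEquiv {r : ℕ} {A : Fin (r + 1) → OuterGroup F} (hA : (A 0).IsSimple)
    (hπ : Function.Surjective π) :
    {J : (∀ k, (A k).N) →* G // IsFraming π A J} ≃
      Σ J : {J : (∀ k : Fin r, (A k.succ).N) →* G // IsFraming π (fun k : Fin r => A k.succ) J},
        {j : (A 0).N →* G // IsEmb π (A 0) j ∧ ¬ j.range ≤ J.1.range} where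
  toFun J := ⟨⟨framingTail J.1, J.2.tail⟩, framingComponent J.1 0, J.2.isEmb_component 0,
    (not_range_le_iff hA hπ (J.2.isEmb_component 0) J.2.tail).2 J.2.head_inf_tail⟩
  invFun x := ⟨framingCons x.2.1 x.1.1 (commute_of_not_range_le hA hπ x.2.2.1 x.1.2 x.2.2.2),
    isFraming_cons x.2.2.1 x.1.2 ((not_range_le_iff hA hπ x.2.2.1 x.1.2).1 x.2.2.2) _⟩
  left_inv J := by
    apply Subtype.ext
    exact MonoidHom.ext fun s => framingComponent_mul_framingTail J.1 s
  right_inv x := by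
    obtain ⟨⟨J, hJ⟩, j, hj⟩ := x
    refine Sigma.subtype_ext ?_ ?_
    · exact Subtype.ext (framingTail_framingCons j J (commute_of_not_range_le hA hπ hj.1 hJ hj.2))
    · exact framingComponent_framingCons j J (commute_of_not_range_le hA hπ hj.1 hJ hj.2)

/-- A framing with one factor; with it the general count gives the number of embeddings into one
minimal normal subgroup. -/
theorem IsEmb.isFraming {S : OuterGroup F} {j : S.N →* G} (h : IsEmb π S j) :
    IsFraming π (fun _ : Fin 1 => S) (j.comp (Pi.evalMonoidHom (fun _ : Fin 1 => S.N) 0)) where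
  inj s t hst := by
    funext k
    rw [Subsingleton.elim k 0]
    exact h.inj hst
  le_ker := by
    rintro _ ⟨s, rfl⟩
    exact h.le_ker ⟨_, rfl⟩
  equivariant x := by
    obtain ⟨σ, hσ, hc⟩ := h.equivariant x
    exact ⟨fun _ => σ, fun _ => hσ, fun s => hc _⟩

theorem range_comp_eval {S : OuterGroup F} (j : S.N →* G) :
    (j.comp (Pi.evalMonoidHom (fun _ : Fin 1 => S.N) 0)).range = j.range := by
  ext x
  constructor
  · rintro ⟨s, rfl⟩
    exact ⟨_, rfl⟩
  · rintro ⟨s, rfl⟩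
    exact ⟨fun _ => s, rfl⟩

end Cons

/-! ### Multiplicities -/

section Multiplicity

variable {ι : Type} [DecidableEq ι]

/-- The number of occurrences of `i` in the word `τ`. -/
def wordCount {r : ℕ} (τ : Fin r → ι) (i : ι) : ℕ := (Finset.univ.filter fun k => τ k = i).card

theorem wordCount_succ {r : ℕ} (τ : Fin (r + 1) → ι) (i : ι) :
    wordCount τ i = wordCount (fun k : Fin r => τ k.succ) i + if τ 0 = i then 1 else 0 := by
  unfold wordCount
  rw [Fin.card_filter_univ_succ]
  split_ifs <;> rfl

/-- Removing the first letter deletes exactly the last factor of the block belonging to that letter.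
All inductions on the length of a word use this. -/
theorem prod_wordCount_succ [Fintype ι] {M : Type*} [CommMonoid M] (f : ι → ℕ → M) {r : ℕ}
    (τ : Fin (r + 1) → ι) :
    ∏ i, ∏ s ∈ Finset.range (wordCount τ i), f i s =
      (∏ i, ∏ s ∈ Finset.range (wordCount (fun k : Fin r => τ k.succ) i), f i s) *
        f (τ 0) (wordCount (fun k : Fin r => τ k.succ) (τ 0)) := by
  rw [← Finset.mul_prod_erase _ _ (Finset.mem_univ (τ 0)),
    ← Finset.mul_prod_erase _ (fun i => ∏ s ∈ Finset.range (wordCount (fun k : Fin r => τ k.succ) i),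
      f i s) (Finset.mem_univ (τ 0)), wordCount_succ, if_pos rfl, Finset.prod_range_succ]
  rw [Finset.prod_congr rfl (g := fun i =>
    ∏ s ∈ Finset.range (wordCount (fun k : Fin r => τ k.succ) i), f i s)]
  · rw [mul_assoc, mul_comm (f _ _), mul_assoc]
  · intro i hi
    rw [wordCount_succ, if_neg (Finset.ne_of_mem_erase hi).symm, add_zero]

theorem wordCount_zero (τ : Fin 0 → ι) (i : ι) : wordCount τ i = 0 := by
  simp [wordCount]

end Multiplicity

/-! ### Systems of simple `[F]`-groups -/

/-- A family of simple `[F]`-groups together with the number `E i c` of embeddings of the `i`-th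
one into a product with `c` factors of type `i`. -/
structure SimpleSystem (F : Type) [Group F] (ι : Type) [DecidableEq ι] where
  S : ι → OuterGroup F
  simple : ∀ i, (S i).IsSimple
  E : ι → ℕ → ℕ
  strictMono : ∀ i, StrictMono (E i)
  card_emb : ∀ {G : Type} [Group G] [Finite G] {π : G →* F}, Function.Surjective π →
    ∀ {r : ℕ} (τ : Fin r → ι) (J : (∀ k, (S (τ k)).N) →* G), IsFraming π (fun k => S (τ k)) J →
    ∀ i, Nat.card {j : (S i).N →* G // IsEmb π (S i) j ∧ j.range ≤ J.range} = E i (wordCount τ i)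

namespace SimpleSystem

variable {F : Type} [Group F] {ι : Type} [DecidableEq ι] (D : SimpleSystem F ι)
  {G : Type} [Group G] {π : G →* F}

theorem E_one_pos (i : ι) : 0 < D.E i 1 :=
  (Nat.zero_le _).trans_lt (D.strictMono i Nat.zero_lt_one)

/-- The framings of `π` whose factors have the types given by the word `τ`. -/
abbrev Framing (π : G →* F) {r : ℕ} (τ : Fin r → ι) : Type :=
  {J : (∀ k, (D.S (τ k)).N) →* G // IsFraming π (fun k => D.S (τ k)) J}

theorem card_emb_ker [Finite G] (hπ : Function.Surjective π) {r : ℕ} {τ : Fin r → ι}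
    (J : D.Framing π τ) (hJ : J.1.range = π.ker) (i : ι) :
    Nat.card {j : (D.S i).N →* G // IsEmb π (D.S i) j} = D.E i (wordCount τ i) := by
  rw [← D.card_emb hπ τ J.1 J.2 i]
  refine Nat.card_congr (Equiv.subtypeEquivRight fun j => ⟨fun h => ⟨h, ?_⟩, fun h => h.1⟩)
  rw [hJ]
  exact h.le_ker

theorem card_emb_not_le [Finite G] (hπ : Function.Surjective π) {r : ℕ} {τ : Fin r → ι}
    (J : D.Framing π τ) (hJ : J.1.range = π.ker) {r' : ℕ} {τ' : Fin r' → ι}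
    (J' : D.Framing π τ') (i : ι) :
    Nat.card {j : (D.S i).N →* G // IsEmb π (D.S i) j ∧ ¬ j.range ≤ J'.1.range} =
      D.E i (wordCount τ i) - D.E i (wordCount τ' i) := by
  classical
  rw [← D.card_emb_ker hπ J hJ, ← D.card_emb hπ τ' J'.1 J'.2]
  have h := Nat.card_congr (Equiv.sumCompl
    fun j : {j : (D.S i).N →* G // IsEmb π (D.S i) j} => j.1.range ≤ J'.1.range)
  rw [Nat.card_sum] at h
  rw [Nat.card_congr (Equiv.subtypeSubtypeEquivSubtypeInter (fun j => IsEmb π (D.S i) j)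
    fun j => j.range ≤ J'.1.range), Nat.card_congr (Equiv.subtypeSubtypeEquivSubtypeInter
    (fun j => IsEmb π (D.S i) j) fun j => ¬ j.range ≤ J'.1.range)] at h
  omega

/-- The number of framings of the word with multiplicities `c` if the kernel has type `t`. -/
def framingNumber [Fintype ι] (t c : ι → ℕ) : ℕ :=
  ∏ i, ∏ s ∈ Finset.range (c i), (D.E i (t i) - D.E i s)

/-- As in counting linearly independent tuples: when the remaining factors use `s` copies of type
`i`, the next copy is any of the `E i (t i)` embeddings into the kernel except the `E i s` that land
in the product already built. -/
theorem card_framing [Fintype ι] [Finite G] (hπ : Function.Surjective π) {r₀ : ℕ} {τ₀ : Fin r₀ → ι}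
    (J₀ : D.Framing π τ₀) (hJ₀ : J₀.1.range = π.ker) {r : ℕ} (τ : Fin r → ι) :
    Nat.card (D.Framing π τ) = D.framingNumber (wordCount τ₀) (wordCount τ) := by
  induction r with
  | zero =>
    have : D.framingNumber (wordCount τ₀) (wordCount τ) = 1 := by
      simp [framingNumber, wordCount_zero]
    rw [this]
    have hone : IsFraming π (fun k => D.S (τ k)) (1 : (∀ k, (D.S (τ k)).N) →* G) := by
      refine ⟨fun _ _ _ => Subsingleton.elim _ _, ?_, fun x => ?_⟩
      · rw [MonoidHom.range_one]
        exact bot_le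
      · exact ⟨fun k => k.elim0, fun k => k.elim0, fun s => by simp⟩
    have : Unique (D.Framing π τ) := ⟨⟨⟨1, hone⟩⟩, fun J => by
      apply Subtype.ext
      ext s
      rw [Subsingleton.elim s 1, map_one, map_one]⟩
    exact Nat.card_unique
  | succ r ih =>
    have e := framingConsEquiv (π := π) (A := fun k => D.S (τ k)) (D.simple _) hπ
    let : Fintype (D.Framing π fun k : Fin r => τ k.succ) := Fintype.ofFinite _
    let : Fintype {J : (∀ k : Fin r, (D.S (τ k.succ)).N) →* G //
      IsFraming π (fun k : Fin r => D.S (τ k.succ)) J} := this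
    rw [Nat.card_congr e, Nat.card_sigma]
    have hc : ∀ J : D.Framing π (fun k : Fin r => τ k.succ),
        Nat.card {j : (D.S (τ 0)).N →* G // IsEmb π (D.S (τ 0)) j ∧ ¬ j.range ≤ J.1.range} =
        D.E (τ 0) (wordCount τ₀ (τ 0)) - D.E (τ 0) (wordCount (fun k : Fin r => τ k.succ) (τ 0)) :=
      fun J => D.card_emb_not_le hπ J₀ hJ₀ J (τ 0)
    rw [Finset.sum_congr rfl fun J _ => hc J, Finset.sum_const, Finset.card_univ, smul_eq_mul,
      ← Nat.card_eq_fintype_card]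
    have := ih fun k : Fin r => τ k.succ
    unfold framingNumber at this ⊢
    rw [prod_wordCount_succ, ← this]

theorem framingNumber_pos [Fintype ι] {t c : ι → ℕ} (h : ∀ i, c i ≤ t i) :
    0 < D.framingNumber t c := by
  refine Finset.prod_pos fun i _ => Finset.prod_pos fun s hs => ?_
  have := D.strictMono i ((Finset.mem_range.1 hs).trans_le (h i))
  omega

/-- The multiplicities of a full framing are unique. -/
theorem wordCount_eq [Finite G] (hπ : Function.Surjective π) {r : ℕ} {τ : Fin r → ι}
    (J : D.Framing π τ) (hJ : J.1.range = π.ker) {r' : ℕ} {τ' : Fin r' → ι}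
    (J' : D.Framing π τ') (hJ' : J'.1.range = π.ker) : wordCount τ = wordCount τ' := by
  funext i
  apply (D.strictMono i).injective
  rw [← D.card_emb_ker hπ J hJ, ← D.card_emb_ker hπ J' hJ']

theorem card_range {r : ℕ} {τ : Fin r → ι} (J : D.Framing π τ) [Fintype ι] :
    Nat.card J.1.range = ∏ i, Nat.card (D.S i).N ^ wordCount τ i := by
  rw [← Nat.card_congr (MonoidHom.ofInjective J.2.inj).toEquiv, Nat.card_pi,
    ← Finset.prod_fiberwise (g := τ)]
  refine Finset.prod_congr rfl fun i _ => ?_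
  rw [Finset.prod_congr rfl (g := fun _ => Nat.card (D.S i).N) fun k hk => by
    rw [(Finset.mem_filter.1 hk).2], Finset.prod_const]
  rfl

/-- The multiplicities determine the order of the image, and a subgroup of the kernel with the order
of the kernel is the kernel. -/
theorem range_eq_ker [Fintype ι] [Finite G] {r : ℕ} {τ : Fin r → ι}
    (J : D.Framing π τ) (hJ : J.1.range = π.ker) {r' : ℕ} {τ' : Fin r' → ι}
    (J' : D.Framing π τ') (h : wordCount τ = wordCount τ') : J'.1.range = π.ker := by
  refine Subgroup.eq_of_le_of_card_ge J'.2.le_ker ?_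
  rw [← hJ, D.card_range, D.card_range, h]

/-- The Möbius function of an epimorphism whose kernel has type `t`. -/
noncomputable def muType [Fintype ι] (t : ι → ℕ) : ℝ :=
  ∏ i, ∏ s ∈ Finset.range (t i), (-(((D.E i (s + 1) : ℝ) - D.E i s) / D.E i 1))

/-! ### Complements of a partial product in the kernel. -/

section Complement

variable {S : OuterGroup F} {j : S.N →* G} {a B : Subgroup G}

/-- If `a` and `j(S)` are complements of `B` in the same subgroup, then `S` also embeds onto `a`. -/
theorem exists_emb_range_eq [ha : a.Normal] [hB : B.Normal] (hj : IsEmb π S j) (haK : a ≤ π.ker)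
    (hjB : j.range ⊓ B = ⊥) (haB : a ⊓ B = ⊥) (h : j.range ⊔ B = a ⊔ B) :
    ∃ j' : S.N →* G, IsEmb π S j' ∧ j'.range = a := by
  -- Both `a` and `j(S)` embed in `G ⧸ B` with the same image, and the comparison is made there.
  let f : a →* G ⧸ B := (QuotientGroup.mk' B).comp a.subtype
  have hf : Function.Injective f := by
    rw [injective_iff_map_eq_one]
    rintro ⟨x, hx⟩ h1
    have : x ∈ a ⊓ B := ⟨hx, (QuotientGroup.eq_one_iff x).1 h1⟩
    rw [haB, Subgroup.mem_bot] at this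
    exact Subtype.ext this
  let g : S.N →* G ⧸ B := (QuotientGroup.mk' B).comp j
  have hgf : g.range = f.range := by
    have h1 := congrArg (Subgroup.map (QuotientGroup.mk' B)) h
    rw [Subgroup.map_sup, Subgroup.map_sup, (Subgroup.map_eq_bot_iff B).2 (by simp), sup_bot_eq,
      sup_bot_eq] at h1
    rw [MonoidHom.range_comp, MonoidHom.range_comp, h1, Subgroup.range_subtype]
  have hg : Function.Injective g := by
    rw [injective_iff_map_eq_one]
    intro s h1
    have : j s ∈ j.range ⊓ B := ⟨⟨s, rfl⟩, (QuotientGroup.eq_one_iff (j s)).1 h1⟩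
    rw [hjB, Subgroup.mem_bot] at this
    exact hj.inj (this.trans (map_one j).symm)
  let j₀ : S.N →* a := (MonoidHom.ofInjective hf).symm.toMonoidHom.comp
    (g.codRestrict f.range fun s => by rw [← hgf]; exact ⟨s, rfl⟩)
  have hj₀ : ∀ s, f (j₀ s) = g s := fun s =>
    congrArg Subtype.val ((MonoidHom.ofInjective hf).apply_symm_apply
      (g.codRestrict f.range (fun s => by rw [← hgf]; exact ⟨s, rfl⟩) s))
  have hinj : Function.Injective j₀ := fun s t hst => hg (by rw [← hj₀, ← hj₀, hst])
  have hsurj : Function.Surjective j₀ := fun x => by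
    have : f x ∈ g.range := by rw [hgf]; exact ⟨x, rfl⟩
    obtain ⟨s, hs⟩ := this
    exact ⟨s, hf ((hj₀ s).trans hs)⟩
  have hrange : (a.subtype.comp j₀).range = a := by
    rw [MonoidHom.range_comp, MonoidHom.range_eq_top.2 hsurj, ← MonoidHom.range_eq_map,
      Subgroup.range_subtype]
  refine ⟨a.subtype.comp j₀, ⟨?_, ?_, fun x => ?_⟩, hrange⟩
  · exact a.subtype_injective.comp hinj
  · rw [hrange]
    exact haK
  · obtain ⟨σ, hσ, hc⟩ := hj.equivariant x
    refine ⟨σ, hσ, fun s => ?_⟩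
    have h1 : (⟨x * j₀ s * x⁻¹, ha.conj_mem _ (j₀ s).2 x⟩ : a) = j₀ (σ s) := by
      apply hf
      rw [hj₀]
      change (QuotientGroup.mk' B) (x * j₀ s * x⁻¹) = QuotientGroup.mk' B (j (σ s))
      rw [← hc, map_mul, map_mul, map_mul, map_mul]
      congr 2
      exact hj₀ s
    exact congrArg Subtype.val h1

/-- By minimality `a ⊔ B` contains `j(S)` or meets it trivially. In the second case, writing an
element of `a` as `m * b` gives `m ∈ j(S) ⊓ (a ⊔ B)`, so `m = 1` and `a ≤ B`, against `a ⊓ B = ⊥`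
and `a ≠ ⊥`. -/
theorem sup_eq_of_inf_eq_bot [ha : a.Normal] [hB : B.Normal] (hπ : Function.Surjective π)
    (hS : S.IsSimple) (hj : IsEmb π S j) (haK : a ≤ j.range ⊔ B) (haB : a ⊓ B = ⊥) (hne : a ≠ ⊥) :
    j.range ⊔ B = a ⊔ B := by
  have := hj.normal
  rcases hj.disjoint_or_le hS hπ (a ⊔ B) with h | h
  · exfalso
    apply hne
    rw [eq_bot_iff, ← haB]
    refine le_inf le_rfl fun x hx => ?_
    obtain ⟨m, hm, b, hb, rfl⟩ := Subgroup.mem_sup_of_normal_right.1 (haK hx)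
    have : m ∈ j.range ⊓ (a ⊔ B) := by
      refine ⟨hm, ?_⟩
      have := mul_mem ((le_sup_left : a ≤ a ⊔ B) hx) (inv_mem ((le_sup_right : B ≤ a ⊔ B) hb))
      rwa [mul_inv_cancel_right] at this
    rw [h, Subgroup.mem_bot] at this
    rwa [this, one_mul]
  · exact le_antisymm (sup_le h le_sup_right) (sup_le haK le_sup_right)

end Complement

/-- The framing of a quotient of `G`. -/
theorem isFraming_quotMap {κ : Type} {A : κ → OuterGroup F} {J : (∀ k, (A k).N) →* G}
    (hJ : IsFraming π A J) (a : Subgroup G) [a.Normal] (ha : a ≤ π.ker) (h : a ⊓ J.range = ⊥) :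
    IsFraming (quotMap π a ha) A ((QuotientGroup.mk' a).comp J) where
  inj := by
    rw [injective_iff_map_eq_one]
    intro s h1
    have : J s ∈ a ⊓ J.range := ⟨(QuotientGroup.eq_one_iff (J s)).1 h1, ⟨s, rfl⟩⟩
    rw [h, Subgroup.mem_bot] at this
    exact hJ.inj (this.trans (map_one J).symm)
  le_ker := by
    rintro _ ⟨s, rfl⟩
    exact hJ.le_ker ⟨s, rfl⟩
  equivariant x := by
    obtain ⟨x, rfl⟩ := QuotientGroup.mk_surjective x
    obtain ⟨σ, hσ, hc⟩ := hJ.equivariant x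
    refine ⟨σ, hσ, fun s => ?_⟩
    change (QuotientGroup.mk' a) x * QuotientGroup.mk' a (J s) * ((QuotientGroup.mk' a) x)⁻¹ =
      QuotientGroup.mk' a (J _)
    rw [← hc, map_mul, map_mul, map_inv]

/-- Weisner's theorem for `B`, the product of all factors but the first. The subgroups `A` in the
sum are the normal complements of `B` in the kernel, all quotients `G ⧸ A` have the type of `B` and
hence one common Möbius value by induction, and what remains is to count complements. -/
theorem muHom_eq_muType [Fintype ι] [Finite G] (hπ : Function.Surjective π) {r : ℕ} (τ : Fin r → ι)
    (J : D.Framing π τ) (hJ : J.1.range = π.ker) :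
    (muHom π : ℝ) = D.muType (wordCount τ) := by
  classical
  induction r generalizing G with
  | zero =>
    have hk : π.ker = ⊥ := by
      rw [← hJ, eq_bot_iff]
      rintro _ ⟨s, rfl⟩
      rw [Subsingleton.elim s 1, map_one]
      exact one_mem _
    rw [muHom_eq_one_of_ker_eq_bot π hk]
    simp [muType, wordCount_zero]
  | succ r ih =>
    let τ' : Fin r → ι := fun k => τ k.succ
    let j : (D.S (τ 0)).N →* G := framingComponent J.1 0
    have hj : IsEmb π (D.S (τ 0)) j := J.2.isEmb_component 0
    let J' : D.Framing π τ' := ⟨framingTail J.1, J.2.tail⟩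
    have := J'.2.normal
    have := hj.normal
    have hjJ : j.range ⊓ J'.1.range = ⊥ := J.2.head_inf_tail
    have hsup : j.range ⊔ J'.1.range = π.ker := by rw [← hJ, range_eq_sup]
    have hlt : J'.1.range < π.ker := by
      refine lt_of_le_of_ne J'.2.le_ker fun h => hj.range_ne_bot (D.simple _) ?_
      rw [← hjJ, h]
      exact (inf_eq_left.2 hj.le_ker).symm
    let s : Finset {A : normalSublattice G // (A : Subgroup G) ≤ π.ker} :=
      (Set.toFinite {A | (A.1 : Subgroup G) ≠ ⊥ ∧ (A.1 : Subgroup G) ⊓ J'.1.range = ⊥}).toFinset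
    have hs : ∀ A, A ∈ s ↔ (A.1 : Subgroup G) ≠ ⊥ ∧ (A.1 : Subgroup G) ⊓ J'.1.range = ⊥ := by
      intro A
      simp [s]
    have hsup' : ∀ A ∈ s, j.range ⊔ J'.1.range = (A.1 : Subgroup G) ⊔ J'.1.range := by
      intro A hA
      rw [hs] at hA
      exact sup_eq_of_inf_eq_bot hπ (D.simple _) hj (A.2.trans hsup.symm.le) hA.2 hA.1
    -- The kernel is `A ⊔ B` with `A ⊓ B = ⊥`, so the framing of `B` is a full framing for `G ⧸ A`.
    have hmu : ∀ A ∈ s, (muHom (quotMap π A.1 A.2) : ℝ) = D.muType (wordCount τ') := by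
      intro A hA
      have hA' := (hs A).1 hA
      refine ih (quotMap_surjective hπ _ _) τ' ⟨_, isFraming_quotMap J'.2 A.1 A.2 hA'.2⟩ ?_
      rw [ker_quotMap, MonoidHom.range_comp,
        congrArg (Subgroup.map (QuotientGroup.mk' (A.1 : Subgroup G)))
          (hsup.symm.trans (hsup' A hA)), Subgroup.map_sup,
        (Subgroup.map_eq_bot_iff (A.1 : Subgroup G)).2 (by simp), bot_sup_eq]
    -- There are `E (c + 1) - E c` embeddings of the first factor outside `B`, where `c` is its
    -- multiplicity in `B`. Their images are the complements, and each complement is the image of `E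
    -- 1` of them.
    have hcount : s.card * D.E (τ 0) 1 =
        D.E (τ 0) (wordCount τ' (τ 0) + 1) - D.E (τ 0) (wordCount τ' (τ 0)) := by
      have h1 := D.card_emb_not_le hπ J hJ J' (τ 0)
      rw [wordCount_succ, if_pos rfl] at h1
      rw [← h1]
      let φ : {j' : (D.S (τ 0)).N →* G // IsEmb π (D.S (τ 0)) j' ∧ ¬ j'.range ≤ J'.1.range} →
          {A // A ∈ s} := fun j' => ⟨⟨⟨j'.1.range, j'.2.1.normal⟩, j'.2.1.le_ker⟩, (hs _).2
            ⟨j'.2.1.range_ne_bot (D.simple _),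
              (j'.2.1.disjoint_or_le (D.simple _) hπ _).resolve_right j'.2.2⟩⟩
      rw [Nat.card_congr (Equiv.sigmaFiberEquiv φ).symm, Nat.card_sigma]
      -- `A` is itself the image of a simple group, so an embedding into `A` is onto `A`, and the
      -- count for a word with one letter applies.
      have hfib : ∀ A : {A // A ∈ s}, Nat.card {j' // φ j' = A} = D.E (τ 0) 1 := by
        intro A
        have hA := (hs A.1).1 A.2
        obtain ⟨j₀, hj₀, hr₀⟩ := exists_emb_range_eq hj A.1.2 hjJ hA.2 (hsup' A.1 A.2)
        have h2 := D.card_emb hπ (fun _ : Fin 1 => τ 0) _ hj₀.isFraming (τ 0)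
        have h3 : wordCount (fun _ : Fin 1 => τ 0) (τ 0) = 1 := by simp [wordCount]
        rw [h3, range_comp_eval, hr₀] at h2
        rw [← h2]
        refine Nat.card_congr ⟨fun j' => ⟨j'.1.1, j'.1.2.1, ?_⟩, fun j' => ⟨⟨j'.1, j'.2.1, ?_⟩, ?_⟩,
          fun _ => rfl, fun _ => rfl⟩
        · exact (congrArg (fun A : {A // A ∈ s} => (A.1.1 : Subgroup G)) j'.2).le
        · intro hle
          apply j'.2.1.range_ne_bot (D.simple _)
          rw [eq_bot_iff, ← hA.2]
          exact le_inf j'.2.2 hle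
        · apply Subtype.ext
          apply Subtype.ext
          apply Subtype.ext
          change j'.1.range = A.1.1
          have := j'.2.1.normal
          exact ((hj₀.eq_bot_or_eq (D.simple _) hπ _ (j'.2.2.trans hr₀.ge)).resolve_left
            (j'.2.1.range_ne_bot (D.simple _))).trans hr₀
      rw [Finset.sum_congr rfl fun A _ => hfib A, Finset.sum_const, Finset.card_univ, smul_eq_mul,
        Fintype.card_coe]
    rw [muHom_eq_neg_sum π J'.1.range hlt s hs, Int.cast_neg, Int.cast_sum,
      Finset.sum_congr rfl hmu, Finset.sum_const, nsmul_eq_mul]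
    have hE : (D.E (τ 0) 1 : ℝ) ≠ 0 := by exact_mod_cast (D.E_one_pos (τ 0)).ne'
    have hcount' : (s.card : ℝ) =
        ((D.E (τ 0) (wordCount τ' (τ 0) + 1) : ℝ) - D.E (τ 0) (wordCount τ' (τ 0))) /
          D.E (τ 0) 1 := by
      rw [eq_div_iff hE, ← Nat.cast_sub ((D.strictMono _).monotone (Nat.le_succ _)), ← hcount]
      push_cast
      rfl
    unfold muType
    rw [prod_wordCount_succ, hcount']
    ring

end SimpleSystem

/-! ### Distributive quotients -/

section Distributive

variable {F : Type} [Group F] {G : Type} [Group G] {π : G →* F}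

/-- Distributivity splits the intersection of the kernel of `H` with the product of the factors `M
k` into the intersections with each `M k`, which are trivial or all of `M k`. So a distributive
quotient is determined by the set of factors it kills. -/
theorem distribCount_le [Finite G] (hπ : Function.Surjective π) {r : ℕ} {A : Fin r → OuterGroup F}
    (hA : ∀ k, (A k).IsSimple) {J : (∀ k, (A k).N) →* G} (hJ : IsFraming π A J)
    (hker : J.range = π.ker) : distribCount π ≤ 2 ^ r := by
  let M : Fin r → Subgroup G := fun k => (framingComponent J k).range
  have hM : ∀ k, (M k).Normal := fun k => (hJ.isEmb_component k).normal
  have hMle : ∀ k, M k ≤ π.ker := fun k => (hJ.isEmb_component k).le_ker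
  have hsup : ∀ s : Finset (Fin r), (s.sup M).Normal ∧ s.sup M ≤ π.ker := by
    intro s
    refine Finset.sup_induction (p := fun B : Subgroup G => B.Normal ∧ B ≤ π.ker) ?_ ?_ ?_
    · exact ⟨inferInstance, bot_le⟩
    · rintro B ⟨h1, h1'⟩ C ⟨h2, h2'⟩
      exact ⟨Subgroup.sup_normal _ _, sup_le h1' h2'⟩
    · exact fun k _ => ⟨hM k, hMle k⟩
  have htop : π.ker ≤ Finset.univ.sup M := by
    rw [← hker]
    rintro _ ⟨s, rfl⟩
    have : s ∈ (Finset.univ.sup M).comap J := by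
      refine Subgroup.pi_mem_of_mulSingle_mem s fun k => ?_
      exact (Finset.le_sup (f := M) (Finset.mem_univ k)) ⟨s k, rfl⟩
    exact this
  have hself : ∀ H : QuotientLattice G, H ≤ quotientSelf G := fun H => by
    change (MonoidHom.id G).ker ≤ (OrderDual.ofDual H).1
    rw [MonoidHom.ker_id]
    exact bot_le
  unfold distribCount
  have hcard : Nat.card (Set (Fin r)) = 2 ^ r := by
    rw [Nat.card_eq_fintype_card, Fintype.card_set, Fintype.card_fin]
  rw [← hcard]
  have key : ∀ H H' : QuotientLattice G, quotientOf π ≤ H →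
      (∀ K₁ ∈ Set.Icc (quotientOf π) (quotientSelf G),
        ∀ K₂ ∈ Set.Icc (quotientOf π) (quotientSelf G), H ⊔ (K₁ ⊓ K₂) = (H ⊔ K₁) ⊓ (H ⊔ K₂)) →
      (∀ k, M k ≤ (OrderDual.ofDual H).1 → M k ≤ (OrderDual.ofDual H').1) → H' ≤ H := by
    intro H H' hle hd hk
    have hd' : ∀ B C : Subgroup G, B.Normal → C.Normal → B ≤ π.ker → C ≤ π.ker →
        (OrderDual.ofDual H).1 ⊓ (B ⊔ C) = (OrderDual.ofDual H).1 ⊓ B ⊔ (OrderDual.ofDual H).1 ⊓ C := by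
      intro B C hB hC hBk hCk
      have := hd (OrderDual.toDual ⟨B, hB⟩) ⟨hBk, hself _⟩ (OrderDual.toDual ⟨C, hC⟩) ⟨hCk, hself _⟩
      exact congrArg (fun x => (OrderDual.ofDual x).1) this
    have hind : ∀ s : Finset (Fin r),
        (OrderDual.ofDual H).1 ⊓ s.sup M ≤ (OrderDual.ofDual H').1 := by
      intro s
      induction s using Finset.induction_on with
      | empty =>
        rw [Finset.sup_empty, inf_bot_eq]
        exact bot_le
      | insert k s _ ih =>
        rw [Finset.sup_insert, hd' _ _ (hM k) (hsup s).1 (hMle k) (hsup s).2]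
        refine sup_le ?_ ih
        have : ((OrderDual.ofDual H).1 : Subgroup G).Normal := (OrderDual.ofDual H).2
        rcases (hJ.isEmb_component k).disjoint_or_le (hA k) hπ (OrderDual.ofDual H).1 with h | h
        · rw [inf_comm]
          exact h.le.trans bot_le
        · exact inf_le_right.trans (hk k h)
    change (OrderDual.ofDual H).1 ≤ (OrderDual.ofDual H').1
    refine le_trans (le_inf le_rfl ?_) (hind Finset.univ)
    exact le_trans hle htop
  refine Nat.card_le_card_of_injective (fun H => {k | M k ≤ (OrderDual.ofDual H.1).1}) ?_
  rintro ⟨H, hH, hd⟩ ⟨H', hH', hd'⟩ h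
  have h : ∀ k, M k ≤ (OrderDual.ofDual H).1 ↔ M k ≤ (OrderDual.ofDual H').1 := fun k =>
    Set.ext_iff.1 h k
  exact Subtype.ext (le_antisymm (key H' H hH'.1 hd' fun k => (h k).2) (key H H' hH.1 hd fun k => (h k).1))

end Distributive

/-! ### Epimorphisms with non-zero Möbius function -/

section Atoms

variable {F : Type} [Group F] {G : Type} [Group G] {π : G →* F}

/-- `M` is a minimal normal subgroup of `G`. -/
structure IsMinimalNormal (M : Subgroup G) : Prop where
  normal : M.Normal
  ne_bot : M ≠ ⊥
  minimal : ∀ C : Subgroup G, C.Normal → C ≤ M → C = ⊥ ∨ C = M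

theorem exists_isMinimalNormal_le [Finite G] (A : Subgroup G) (hA : A.Normal) (h : A ≠ ⊥) :
    ∃ M ≤ A, IsMinimalNormal M := by
  induction A using WellFoundedLT.induction with
  | _ A ih =>
    by_cases hmin : ∀ C : Subgroup G, C.Normal → C ≤ A → C = ⊥ ∨ C = A
    · exact ⟨A, le_rfl, hA, h, hmin⟩
    · push Not at hmin
      obtain ⟨C, hC, hle, hne, hne'⟩ := hmin
      obtain ⟨M, hM, hM'⟩ := ih C (lt_of_le_of_ne hle hne') hC hne
      exact ⟨M, hM.trans hle, hM'⟩

/-- If `B` contained all minimal normal subgroups below the kernel, no nontrivial `A` would meet it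
trivially, and Weisner's sum would be empty. The hypothesis `μ(π) ≠ 0` is always exploited through
this lemma, for various `B`. -/
theorem exists_isMinimalNormal_not_le [Finite G] (hμ : muHom π ≠ 0) (B : Subgroup G)
    (hB : B.Normal) (hlt : B < π.ker) : ∃ M ≤ π.ker, IsMinimalNormal M ∧ ¬ M ≤ B := by
  by_contra! hall
  apply hμ
  rw [muHom_eq_neg_sum π B hlt ∅]
  · simp
  · intro A
    simp only [Finset.notMem_empty, false_iff, not_and]
    intro hne h
    obtain ⟨M, hM, hM'⟩ := exists_isMinimalNormal_le A.1.1 A.1.2 hne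
    apply hM'.ne_bot
    rw [eq_bot_iff, ← h]
    exact le_inf hM (hall M (hM.trans A.2) hM')

/-- If `μ(π) ≠ 0`, the kernel of `π` acts on every minimal normal subgroup by inner automorphisms. -/
theorem ker_le_sup_centralizer [Finite G] (hμ : muHom π ≠ 0) {M : Subgroup G}
    (hM : IsMinimalNormal M) : π.ker ≤ M ⊔ Subgroup.centralizer M := by
  have := hM.normal
  by_contra hle
  obtain ⟨M', hM'k, hM', hnot⟩ := exists_isMinimalNormal_not_le hμ
    (π.ker ⊓ (M ⊔ Subgroup.centralizer M)) inferInstance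
    (lt_of_le_of_ne inf_le_left fun h => hle (inf_eq_left.1 h))
  have := hM'.normal
  apply hnot
  refine le_inf hM'k ?_
  -- Either `M'` meets `M` trivially and therefore centralizes it, or `M' ≤ M`. Both put `M'` inside
  -- `M ⊔ C(M)`, the excluded case.
  rcases hM'.minimal (M' ⊓ M) inferInstance inf_le_left with h | h
  · refine le_trans (fun x hx => ?_) le_sup_right
    rw [Subgroup.mem_centralizer_iff]
    intro m hm
    exact (commute_of_inf_eq_bot h hx hm).symm.eq
  · exact (inf_eq_left.1 h).trans le_sup_left

/-- A minimal normal subgroup on which the kernel acts by inner automorphisms is a simple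
`[F]`-group. -/
theorem exists_isEmb_of_isMinimalNormal [Finite G] (hπ : Function.Surjective π) {M : Subgroup G}
    (hM : IsMinimalNormal M) (hle : M ≤ π.ker) (hK : π.ker ≤ M ⊔ Subgroup.centralizer M) :
    ∃ (S : OuterGroup F) (j : S.N →* G), S.IsSimple ∧ IsEmb π S j ∧ j.range = M := by
  have hn := hM.normal
  -- Conjugation on `M` is inner for elements of `M ⊔ C(M)`, so modulo inner automorphisms it
  -- factors through `F`. This is the outer action on `M`.
  let φ : G →* OuterAut M := (toOuter M).comp MulAut.conjNormal
  have hφ : π.ker ≤ φ.ker := by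
    intro x hx
    obtain ⟨m, hm, c, hc, rfl⟩ := Subgroup.mem_sup_of_normal_left.1 (hK hx)
    refine (QuotientGroup.eq_one_iff _).2 ⟨⟨m, hm⟩, ?_⟩
    ext y
    have := Subgroup.mem_centralizer_iff.1 hc y y.2
    simp only [MulAut.conj_apply, MulAut.conjNormal_apply, Subgroup.coe_mul, Subgroup.coe_inv]
    calc m * y * m⁻¹ = m * (y * c) * c⁻¹ * m⁻¹ := by group
      _ = _ := by rw [this]; group
  let act : F →* OuterAut M := π.liftOfSurjective hπ ⟨φ, hφ⟩
  have hact : ∀ x, act (π x) = φ x := fun x =>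
    π.liftOfRightInverse_comp_apply _ (Function.rightInverse_surjInv hπ) ⟨φ, hφ⟩ x
  refine ⟨⟨M, act⟩, M.subtype, ⟨?_, fun C hC h => ?_⟩, ⟨M.subtype_injective, ?_, fun x => ?_⟩, ?_⟩
  · exact (Subgroup.nontrivial_iff_ne_bot M).2 hM.ne_bot
  · have hCn : (C.map M.subtype).Normal := by
      refine ⟨?_⟩
      rintro _ ⟨c, hc, rfl⟩ x
      have := h (π x) (MulAut.conjNormal x) (hact x).symm
      refine ⟨MulAut.conjNormal x c, ?_, by simp⟩
      change (MulAut.conjNormal x) c ∈ C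
      rw [← this]
      exact ⟨c, hc, rfl⟩
    rcases hM.minimal _ hCn (Subgroup.map_subtype_le C) with h' | h'
    · left
      exact (Subgroup.map_eq_bot_iff_of_injective C M.subtype_injective).1 h'
    · right
      rw [eq_top_iff]
      intro y _
      have hy : (y : G) ∈ C.map M.subtype := by rw [h']; exact y.2
      obtain ⟨c, hc, hcy⟩ := hy
      have : c = y := Subtype.ext hcy
      rw [← this]
      exact hc
  · rw [Subgroup.range_subtype]
    exact hle
  · exact ⟨MulAut.conjNormal x, (hact x).symm, fun s => by simp⟩
  · exact Subgroup.range_subtype M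

theorem IsEmb.comp_equiv {S S' : OuterGroup F} {j : S.N →* G} (hj : IsEmb π S j) (e : S'.Equiv S) :
    IsEmb π S' (j.comp e.1.toMonoidHom) ∧ (j.comp e.1.toMonoidHom).range = j.range := by
  have hr : (j.comp e.1.toMonoidHom).range = j.range := by
    rw [MonoidHom.range_comp, MonoidHom.range_eq_top.2 e.1.surjective, ← MonoidHom.range_eq_map]
  refine ⟨⟨hj.inj.comp e.1.injective, hr.trans_le hj.le_ker, fun x => ?_⟩, hr⟩
  obtain ⟨σ, hσ, hc⟩ := hj.equivariant x
  obtain ⟨σ', hσ', hc'⟩ := e.2.2 _ σ hσ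
  refine ⟨σ', hσ', fun s => ?_⟩
  have := hc' (e.1 s)
  simp only [MulEquiv.toMonoidHom_eq_coe, MonoidHom.coe_coe, MulEquiv.symm_apply_apply] at this
  simp [hc, this]

/-- A framing that is not full can be lengthened by a minimal normal subgroup outside its image.
Were none full, there would be framings of every length, while a framing of length `n` needs `2 ^ n
≤ |G|`. -/
theorem SimpleSystem.exists_framing [Finite G] {ι : Type} [DecidableEq ι] (D : SimpleSystem F ι)
    (hπ : Function.Surjective π) (hμ : muHom π ≠ 0)
    (hatom : ∀ M : Subgroup G, IsMinimalNormal M → M ≤ π.ker →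
      ∃ (i : ι) (j : (D.S i).N →* G), IsEmb π (D.S i) j ∧ j.range = M) :
    ∃ (r : ℕ) (τ : Fin r → ι) (J : D.Framing π τ), J.1.range = π.ker := by
  by_contra! hall
  have hex : ∀ n : ℕ, ∃ τ : Fin n → ι, Nonempty (D.Framing π τ) := by
    intro n
    induction n with
    | zero =>
      refine ⟨Fin.elim0, ⟨1, fun _ _ _ => Subsingleton.elim _ _, ?_, fun x => ?_⟩⟩
      · rw [MonoidHom.range_one]
        exact bot_le
      · exact ⟨fun k => k.elim0, fun k => k.elim0, fun s => by simp⟩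
    | succ n ih =>
      obtain ⟨τ, ⟨J⟩⟩ := ih
      obtain ⟨M, hMk, hM, hnot⟩ := exists_isMinimalNormal_not_le hμ J.1.range J.2.normal
        (lt_of_le_of_ne J.2.le_ker (hall n τ J))
      obtain ⟨i, j, hj, rfl⟩ := hatom M hM hMk
      let τ' : Fin (n + 1) → ι := Fin.cons i τ
      exact ⟨τ', ⟨(framingConsEquiv (π := π) (A := fun k => D.S (τ' k)) (D.simple i) hπ).symm
        ⟨J, j, hj, hnot⟩⟩⟩
  obtain ⟨τ, ⟨J⟩⟩ := hex (Nat.card G)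
  have h1 : Nat.card (∀ k, (D.S (τ k)).N) ≤ Nat.card G := Nat.card_le_card_of_injective J.1 J.2.inj
  have h2 : 2 ^ Nat.card G ≤ Nat.card (∀ k, (D.S (τ k)).N) := by
    rw [Nat.card_pi]
    have : ∏ _k : Fin (Nat.card G), 2 ≤ ∏ k : Fin (Nat.card G), Nat.card (D.S (τ k)).N := by
      refine Finset.prod_le_prod' fun k _ => ?_
      have := (D.simple (τ k)).1
      exact Finite.one_lt_card
    simpa using this
  exact absurd (h2.trans h1) (not_le.2 Nat.lt_two_pow_self)

end Atoms

/-! ### Isomorphism classes and levels -/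

theorem grpClass_eq_iff {G H : Type} [Group G] [Finite G] [Group H] [Finite H] :
    grpClass G = grpClass H ↔ Nonempty (G ≃* H) :=
  Quotient.eq (r := finGrpSetoid)

theorem grpClass_rep (c : FinGrpClass) : grpClass c.rep = c := by
  refine Eq.trans ?_ (Quotient.out_eq c)
  exact Quotient.sound (s := finGrpSetoid) ⟨MulEquiv.refl _⟩

theorem DownwardClosed.mem_of_equiv {L : Set FinGrpClass} (hD : DownwardClosed L) {G H : Type}
    [Group G] [Finite G] [Group H] [Finite H] (e : G ≃* H) (h : grpClass G ∈ L) : grpClass H ∈ L :=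
  hD G H e.toMonoidHom e.surjective h

theorem mem_of_ker_inf_le {L : Set FinGrpClass} (hD : DownwardClosed L) (hJ : JoinClosed L)
    {G H H' K : Type} [Group G] [Finite G] [Group H] [Finite H] [Group H'] [Finite H'] [Group K]
    [Finite K] {π : G →* H} {ρ : G →* H'} {θ : G →* K} (hπ : Function.Surjective π)
    (hρ : Function.Surjective ρ) (hθ : Function.Surjective θ) (hH : grpClass H ∈ L)
    (hH' : grpClass H' ∈ L) (h : π.ker ⊓ ρ.ker ≤ θ.ker) : grpClass K ∈ L :=
  hD _ K (quotMap θ _ h) (quotMap_surjective hθ _ h) (hJ G H H' π ρ hπ hρ hH hH')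

theorem mem_of_ker_finset_inf_le {L : Set FinGrpClass} (hD : DownwardClosed L) (hJ : JoinClosed L)
    {G H : Type} [Group G] [Finite G] [Group H] [Finite H] {π : G →* H} (hπ : Function.Surjective π)
    (hH : grpClass H ∈ L) {κ : Type} [DecidableEq κ] {E : κ → Type} [∀ k, Group (E k)]
    [∀ k, Finite (E k)] (ρ : ∀ k, G →* E k) (hρ : ∀ k, Function.Surjective (ρ k))
    (hE : ∀ k, grpClass (E k) ∈ L) (s : Finset κ) {K : Type} [Group K] [Finite K] {θ : G →* K}
    (hθ : Function.Surjective θ) (h : π.ker ⊓ s.inf (fun k => (ρ k).ker) ≤ θ.ker) :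
    grpClass K ∈ L := by
  induction s using Finset.induction_on generalizing K with
  | empty =>
    rw [Finset.inf_empty, inf_top_eq] at h
    exact mem_of_ker_inf_le hD hJ hπ hπ hθ hH hH (by rwa [inf_idem])
  | insert k s _ ih =>
    have hn : (s.inf fun k => (ρ k).ker).Normal := by
      refine Finset.inf_induction (p := fun B : Subgroup G => B.Normal) inferInstance ?_ ?_
      · exact fun B _ C _ => Subgroup.normal_inf_normal _ _
      · exact fun k _ => inferInstance
    have h1 := ih (K := G ⧸ (π.ker ⊓ s.inf fun k => (ρ k).ker)) (θ := QuotientGroup.mk' _)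
      (QuotientGroup.mk'_surjective _) (by rw [QuotientGroup.ker_mk'])
    refine mem_of_ker_inf_le hD hJ (QuotientGroup.mk'_surjective _) (hρ k) hθ h1 (hE k) ?_
    rw [QuotientGroup.ker_mk']
    refine le_trans ?_ h
    rw [Finset.inf_insert]
    exact le_inf (inf_le_left.trans inf_le_left) (le_inf inf_le_right (inf_le_left.trans inf_le_right))

/-! ### Models for the extensions of `F` by a simple `[F]`-group -/

/-- A finite family of extensions of `F` by the `[F]`-group `S` in which every extension of `F` by
`S` occurs, with `y` parametrized isomorphisms. -/
structure ExtensionModel {F : Type} [Group F] (S : OuterGroup F) where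
  X : Type
  [finiteX : Finite X]
  E : X → Type
  [group : ∀ c, Group (E c)]
  [finite : ∀ c, Finite (E c)]
  p : ∀ c, E c →* F
  surjective : ∀ c, Function.Surjective (p c)
  can : ∀ c, S.N →* E c
  isEmb : ∀ c, IsEmb (p c) S (can c)
  range_can : ∀ c, (can c).range = (p c).ker
  y : ℕ
  y_pos : 0 < y
  -- `B` stands for the product of the other factors, so that `G ⧸ B` is an extension of `F` by `S`.
  -- Counted are its identifications with members of the family, compatible with the maps from `S`
  -- and to `F`.
  card_hom : ∀ {G : Type} [Group G] [Finite G] {π : G →* F}, Function.Surjective π →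
    ∀ j : S.N →* G, IsEmb π S j → ∀ B : Subgroup G, B.Normal → j.range ⊓ B = ⊥ →
    j.range ⊔ B = π.ker →
    Nat.card {x : Σ c, G →* E c // (p x.1).comp x.2 = π ∧ x.2.comp j = can x.1 ∧ B ≤ x.2.ker} = y

namespace ExtensionModel

attribute [instance] finiteX group finite

variable {F : Type} [Group F] {r : ℕ} {A : Fin r → OuterGroup F} (M : ∀ k, ExtensionModel (A k))

/-- The fiber product over `F` of a family of extensions. -/
def fiberProd (c : ∀ k, (M k).X) : Subgroup (F × ∀ k, (M k).E (c k)) where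
  carrier := {x | ∀ k, (M k).p (c k) (x.2 k) = x.1}
  one_mem' k := by simp
  mul_mem' h h' k := by simp [h k, h' k]
  inv_mem' h k := by simp [h k]

variable {M}

/-- The projection of the fiber product to `F`. -/
def toBase (c : ∀ k, (M k).X) : fiberProd M c →* F := (MonoidHom.fst _ _).comp (Subgroup.subtype _)

/-- The projection of the fiber product to a factor. -/
def toFactor (c : ∀ k, (M k).X) (k : Fin r) : fiberProd M c →* (M k).E (c k) :=
  (Pi.evalMonoidHom (fun k => (M k).E (c k)) k).comp ((MonoidHom.snd _ _).comp (Subgroup.subtype _))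

/-- The product of the kernels in the fiber product. -/
def canPi (c : ∀ k, (M k).X) : (∀ k, (A k).N) →* fiberProd M c :=
  ((MonoidHom.inr F _).comp (MonoidHom.piMap fun k => (M k).can (c k))).codRestrict _ fun s k =>
    ((M k).isEmb (c k)).le_ker ⟨s k, rfl⟩

theorem p_toFactor (c : ∀ k, (M k).X) (k : Fin r) (x : fiberProd M c) :
    (M k).p (c k) (toFactor c k x) = toBase c x := x.2 k

theorem fiberProd_ext {c : ∀ k, (M k).X} {x y : fiberProd M c} (h : toBase c x = toBase c y)
    (h' : ∀ k, toFactor c k x = toFactor c k y) : x = y :=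
  Subtype.ext (Prod.ext h (funext h'))

theorem toBase_surjective (c : ∀ k, (M k).X) : Function.Surjective (toBase c) := fun f => by
  choose e he using fun k => (M k).surjective (c k) f
  exact ⟨⟨(f, e), he⟩, rfl⟩

theorem toFactor_surjective (c : ∀ k, (M k).X) (k : Fin r) : Function.Surjective (toFactor c k) := by
  intro a
  choose e he using fun l => (M l).surjective (c l) ((M k).p (c k) a)
  refine ⟨⟨((M k).p (c k) a, Function.update e k a), fun l => ?_⟩, ?_⟩
  · rcases eq_or_ne l k with rfl | hl
    · simp
    · simp [Function.update_of_ne hl, he]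
  · exact Function.update_self (β := fun k => (M k).E (c k)) k a e

@[simp]
theorem toBase_canPi (c : ∀ k, (M k).X) (s : ∀ k, (A k).N) : toBase c (canPi c s) = 1 := rfl

@[simp]
theorem toFactor_canPi (c : ∀ k, (M k).X) (s : ∀ k, (A k).N) (k : Fin r) :
    toFactor c k (canPi c s) = (M k).can (c k) (s k) := rfl

theorem isFraming_canPi (c : ∀ k, (M k).X) : IsFraming (toBase c) A (canPi c) where
  inj s t h := by
    funext k
    apply ((M k).isEmb (c k)).inj
    rw [← toFactor_canPi, ← toFactor_canPi, h]
  le_ker := by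
    rintro _ ⟨s, rfl⟩
    exact toBase_canPi c s
  equivariant x := by
    choose σ hσ hc using fun k => ((M k).isEmb (c k)).equivariant (toFactor c k x)
    refine ⟨σ, fun k => ?_, fun s => ?_⟩
    · rw [hσ, p_toFactor]
    · apply fiberProd_ext
      · simp
      · intro k
        simp [hc]

theorem range_canPi (c : ∀ k, (M k).X) : (canPi c).range = (toBase c).ker := by
  refine le_antisymm (isFraming_canPi c).le_ker fun x hx => ?_
  have h : ∀ k, ∃ s, (M k).can (c k) s = toFactor c k x := fun k => by
    have : toFactor c k x ∈ ((M k).p (c k)).ker := by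
      rw [MonoidHom.mem_ker, p_toFactor]
      exact hx
    rw [← (M k).range_can] at this
    exact this
  choose s hs using h
  refine ⟨s, fiberProd_ext ?_ fun k => ?_⟩
  · rw [toBase_canPi]
    exact hx.symm
  · rw [toFactor_canPi, hs]

/-- The factors and `F` are quotients of the fibre product whose kernels have trivial intersection,
so it is their join. Including `F` covers the empty family. -/
theorem grpClass_fiberProd_mem_iff [Finite F] {L : Set FinGrpClass} (hD : DownwardClosed L)
    (hJ : JoinClosed L) (hF : grpClass F ∈ L) (c : ∀ k, (M k).X) :
    grpClass (fiberProd M c) ∈ L ↔ ∀ k, grpClass ((M k).E (c k)) ∈ L := by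
  constructor
  · exact fun h k => hD _ _ (toFactor c k) (toFactor_surjective c k) h
  · intro h
    refine mem_of_ker_finset_inf_le hD hJ (toBase_surjective c) hF (toFactor c)
      (toFactor_surjective c) h Finset.univ (θ := MonoidHom.id _) Function.surjective_id ?_
    rintro x ⟨hx, hx'⟩
    refine fiberProd_ext (y := 1) (hx.trans (map_one _).symm) fun k => ?_
    have : Finset.univ.inf (fun k => (toFactor c k).ker) ≤ (toFactor c k).ker :=
      Finset.inf_le (Finset.mem_univ k)
    exact (this hx').trans (map_one _).symm

end ExtensionModel

/-! ### Full framings -/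

section FullFraming

variable {F : Type} [Group F] {G : Type} [Group G] {r : ℕ} (A : Fin r → OuterGroup F)

/-- Framings whose image is the kernel. -/
abbrev FullFraming (π : G →* F) : Type :=
  {J : (∀ k, (A k).N) →* G // IsFraming π A J ∧ J.range = π.ker}

variable {A}

/-- The product of the factors other than the `k`-th. -/
def coFactor (J : (∀ k, (A k).N) →* G) (k : Fin r) : Subgroup G :=
  (Pi.evalMonoidHom (fun k => (A k).N) k).ker.map J

theorem mem_coFactor {J : (∀ k, (A k).N) →* G} {k : Fin r} {s : ∀ k, (A k).N} (h : s k = 1) :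
    J s ∈ coFactor J k := ⟨s, h, rfl⟩

theorem coFactor_normal {π : G →* F} {J : (∀ k, (A k).N) →* G} (hJ : IsFraming π A J) (k : Fin r) :
    (coFactor J k).Normal := by
  refine ⟨?_⟩
  rintro _ ⟨s, hs, rfl⟩ x
  obtain ⟨σ, -, hc⟩ := hJ.equivariant x
  rw [hc]
  apply mem_coFactor
  have hs : s k = 1 := hs
  rw [hs, map_one]

theorem component_inf_coFactor {π : G →* F} {J : (∀ k, (A k).N) →* G} (hJ : IsFraming π A J)
    (k : Fin r) : (framingComponent J k).range ⊓ coFactor J k = ⊥ := by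
  rw [eq_bot_iff]
  rintro _ ⟨⟨s, rfl⟩, ⟨t, ht, hst⟩⟩
  rw [framingComponent_apply] at hst
  have h1 := congrFun (hJ.inj hst) k
  have ht : t k = 1 := ht
  rw [ht, Pi.mulSingle_eq_same] at h1
  rw [← h1, map_one]
  exact one_mem _

theorem component_sup_coFactor (J : (∀ k, (A k).N) →* G) (k : Fin r) :
    (framingComponent J k).range ⊔ coFactor J k = J.range := by
  apply le_antisymm
  · refine sup_le ?_ ?_
    · rintro _ ⟨s, rfl⟩
      exact ⟨_, rfl⟩
    · rintro _ ⟨s, _, rfl⟩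
      exact ⟨s, rfl⟩
  · rintro _ ⟨s, rfl⟩
    have : s = Pi.mulSingle k (s k) * ((Pi.mulSingle k (s k))⁻¹ * s) := by group
    rw [this, map_mul]
    refine mul_mem ((le_sup_left : (framingComponent J k).range ≤ _) ⟨s k, rfl⟩)
      ((le_sup_right : coFactor J k ≤ _) (mem_coFactor ?_))
    simp

variable (M : ∀ k, ExtensionModel (A k))

/-- An epimorphism to `F`, a full framing of it, and homomorphisms to models of the factors. -/
abbrev FramedData (G : Type) [Group G] : Type :=
  {x : (Σ π : Sur G F, FullFraming A π.1) × (∀ k, Σ c, G →* (M k).E c) //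
    ∀ k, ((M k).p (x.2 k).1).comp (x.2 k).2 = x.1.1.1 ∧
      (x.2 k).2.comp (framingComponent x.1.2.1 k) = (M k).can (x.2 k).1 ∧
      coFactor x.1.2.1 k ≤ (x.2 k).2.ker}

/-- For a fixed framing the homomorphisms to the different factors are chosen independently, with
`y` choices in each case: `card_hom` applies with the product of the other factors as `B`. -/
theorem card_framedData [Finite G] [Finite F] :
    Nat.card (FramedData M G) = Nat.card (Σ π : Sur G F, FullFraming A π.1) * ∏ k, (M k).y := by
  have : Finite (Sur G F) := Finite.of_injective (fun π : Sur G F => (π.1 : G → F))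
    fun _ _ h => Subtype.ext (DFunLike.coe_injective h)
  let : Fintype (Σ π : Sur G F, FullFraming A π.1) := Fintype.ofFinite _
  rw [Nat.card_congr (Equiv.subtypeProdEquivSigmaSubtype
    fun (x : Σ π : Sur G F, FullFraming A π.1) (z : ∀ k, Σ c, G →* (M k).E c) =>
    ∀ k, ((M k).p (z k).1).comp (z k).2 = x.1.1 ∧
      (z k).2.comp (framingComponent x.2.1 k) = (M k).can (z k).1 ∧
      coFactor x.2.1 k ≤ (z k).2.ker)]
  have hfin : ∀ k, Finite (Σ c, G →* (M k).E c) := fun k => by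
    have : ∀ c, Finite (G →* (M k).E c) := fun c =>
      Finite.of_injective (fun f : G →* (M k).E c => (f : G → (M k).E c)) DFunLike.coe_injective
    infer_instance
  rw [Nat.card_sigma]
  rw [Finset.sum_congr rfl (g := fun _ => ∏ k, (M k).y), Finset.sum_const, smul_eq_mul,
    Finset.card_univ, Nat.card_eq_fintype_card]
  intro x _
  rw [Nat.card_congr (Equiv.subtypePiEquivPi (p := fun k (z : Σ c, G →* (M k).E c) =>
    ((M k).p z.1).comp z.2 = x.1.1 ∧ z.2.comp (framingComponent x.2.1 k) = (M k).can z.1 ∧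
      coFactor x.2.1 k ≤ z.2.ker)), Nat.card_pi]
  refine Finset.prod_congr rfl fun k _ => ?_
  refine (M k).card_hom x.1.2 _ (x.2.2.1.isEmb_component k) _ (coFactor_normal x.2.2.1 k)
    (component_inf_coFactor x.2.2.1 k) ?_
  rw [component_sup_coFactor, x.2.2.2]

open ExtensionModel

/-- The data given by an isomorphism with a fiber product. -/
def framedDataOfEquiv (x : Σ c : ∀ k, (M k).X, G ≃* fiberProd M c) : FramedData M G :=
  ⟨⟨⟨⟨(toBase x.1).comp x.2.toMonoidHom, (toBase_surjective x.1).comp x.2.surjective⟩,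
    x.2.symm.toMonoidHom.comp (canPi x.1), by
      refine ⟨x.2.symm.injective.comp (isFraming_canPi x.1).inj, ?_, fun g => ?_⟩
      · rintro _ ⟨s, rfl⟩
        simp [MonoidHom.mem_ker]
      · obtain ⟨σ, hσ, hc⟩ := (isFraming_canPi x.1).equivariant (x.2 g)
        refine ⟨σ, hσ, fun s => x.2.injective ?_⟩
        simp [hc], by
      ext g
      have := SetLike.ext_iff.1 (range_canPi x.1) (x.2 g)
      refine Iff.trans ⟨?_, ?_⟩ this
      · rintro ⟨s, hs⟩
        exact ⟨s, by rw [← hs]; simp⟩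
      · rintro ⟨s, hs⟩
        exact ⟨s, by simp [hs]⟩⟩,
    fun k => ⟨x.1 k, (toFactor x.1 k).comp x.2.toMonoidHom⟩⟩, fun k => by
      refine ⟨?_, ?_, ?_⟩
      · ext g
        exact p_toFactor x.1 k (x.2 g)
      · ext s
        simp [framingComponent_apply]
      · rintro _ ⟨s, hs, rfl⟩
        have hs : s k = 1 := hs
        simp [MonoidHom.mem_ker, hs]⟩

/-- The map `π` and the homomorphisms to the factors assemble to one homomorphism into the fibre
product. It is the identity over `F` and carries the framing of the kernel to the standard one,
hence is an isomorphism. -/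
theorem framedDataOfEquiv_bijective [Finite G] [Finite F] :
    Function.Bijective (framedDataOfEquiv (G := G) M) := by
  constructor
  · rintro ⟨c, φ⟩ ⟨c', φ'⟩ h
    have h1 := congrArg (fun z : FramedData M G => z.1.1.1.1) h
    have h2 := congrArg (fun z : FramedData M G => z.1.2) h
    have hc : c = c' := by
      funext k
      exact congrArg Sigma.fst (congrFun h2 k)
    subst hc
    congr 1
    apply MulEquiv.ext
    intro g
    refine fiberProd_ext (DFunLike.congr_fun h1 g) fun k => ?_
    have h3 := congrFun h2 k
    have h4 := eq_of_heq (Sigma.ext_iff.1 h3).2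
    exact DFunLike.congr_fun h4 g
  · rintro ⟨⟨⟨⟨π, hπ⟩, J, hJ, hk⟩, z⟩, hz⟩
    let c : ∀ k, (M k).X := fun k => (z k).1
    have hz1 : ∀ k g, (M k).p (c k) ((z k).2 g) = π g := fun k g => DFunLike.congr_fun (hz k).1 g
    let f : G →* fiberProd M c :=
      (π.prod (MonoidHom.pi fun k => (z k).2)).codRestrict _ fun g k => hz1 k g
    have hfb : ∀ g, toBase c (f g) = π g := fun g => rfl
    have hff : ∀ k g, toFactor c k (f g) = (z k).2 g := fun k g => rfl
    have hfJ : ∀ s, f (J s) = canPi c s := by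
      intro s
      refine fiberProd_ext (hJ.le_ker ⟨s, rfl⟩) fun k => ?_
      rw [hff, toFactor_canPi]
      have hs : s = Pi.mulSingle k (s k) * ((Pi.mulSingle k (s k))⁻¹ * s) := by group
      have h1 : (z k).2 (J (Pi.mulSingle k (s k))) = (M k).can (c k) (s k) :=
        DFunLike.congr_fun (hz k).2.1 (s k)
      have h2 : (z k).2 (J ((Pi.mulSingle k (s k))⁻¹ * s)) = 1 :=
        (hz k).2.2 (mem_coFactor (by simp))
      conv_lhs => rw [hs]
      rw [map_mul, map_mul, h1, h2, mul_one]
    have hinj : Function.Injective f := by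
      rw [injective_iff_map_eq_one]
      intro g hg
      have : g ∈ π.ker := by
        have := congrArg (toBase c) hg
        rw [hfb, map_one] at this
        exact this
      rw [← hk] at this
      obtain ⟨s, rfl⟩ := this
      rw [hfJ] at hg
      rw [(isFraming_canPi c).inj (hg.trans (map_one _).symm), map_one]
    have hsurj : Function.Surjective f := by
      intro x
      obtain ⟨g, hg⟩ := hπ (toBase c x)
      have : (f g)⁻¹ * x ∈ (toBase c).ker := by
        rw [MonoidHom.mem_ker, map_mul, map_inv, hfb, hg, inv_mul_cancel]
      rw [← range_canPi] at this
      obtain ⟨s, hs⟩ := this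
      refine ⟨g * J s, ?_⟩
      rw [map_mul, hfJ, hs, mul_inv_cancel_left]
    refine ⟨⟨c, MulEquiv.ofBijective f ⟨hinj, hsurj⟩⟩, ?_⟩
    apply Subtype.ext
    refine Prod.ext ?_ ?_
    · refine Sigma.subtype_ext ?_ ?_
      · rfl
      · ext s
        apply hinj
        rw [hfJ]
        exact (MulEquiv.ofBijective f ⟨hinj, hsurj⟩).apply_symm_apply _
    · rfl

theorem card_sigma_fullFraming [Finite G] [Finite F] :
    Nat.card (Σ π : Sur G F, FullFraming A π.1) * ∏ k, (M k).y =
      Nat.card (Σ c : ∀ k, (M k).X, G ≃* fiberProd M c) := by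
  rw [← card_framedData, Nat.card_congr (Equiv.ofBijective _ (framedDataOfEquiv_bijective M))]

end FullFraming

/-! ### The mass of framed extensions -/

open Classical in
theorem card_mulEquiv {G H : Type} [Group G] [Finite G] [Group H] [Finite H] :
    Nat.card (G ≃* H) = if Nonempty (G ≃* H) then Nat.card (MulAut G) else 0 := by
  split_ifs with h
  · obtain ⟨e⟩ := h
    exact Nat.card_congr ⟨fun f => f.trans e.symm, fun f => MulEquiv.trans f e, fun f => by ext; simp,
      fun f => by ext; simp⟩
  · rw [not_nonempty_iff] at h
    exact Nat.card_of_isEmpty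

instance {G F : Type*} [Group G] [Group F] [Finite G] [Finite F] : Finite (Sur G F) :=
  Finite.of_injective (fun π : Sur G F => (π.1 : G → F))
    fun _ _ h => Subtype.ext (DFunLike.coe_injective h)

instance {G : Type*} [Group G] [Finite G] : Finite (MulAut G) :=
  Finite.of_injective (fun σ : MulAut G => (σ : G → G)) DFunLike.coe_injective

open Classical in
theorem hasSum_grpClass_eq (L : Set FinGrpClass) {X : Type} [Finite X] (E : X → FinGrpClass) :
    HasSum (fun G : L => (Nat.card {c // E c = G.1} : ℝ)) (Nat.card {c // E c ∈ L}) := by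
  let : Fintype X := Fintype.ofFinite X
  have h : HasSum (fun G : L => ∑ c, if E c = G.1 then (1 : ℝ) else 0)
      (∑ c, if E c ∈ L then (1 : ℝ) else 0) := by
    refine hasSum_sum fun c _ => ?_
    by_cases hc : E c ∈ L
    · rw [if_pos hc]
      convert hasSum_ite_eq (⟨E c, hc⟩ : L) (1 : ℝ) using 2 with G
      simp only [Subtype.ext_iff, eq_comm]
    · rw [if_neg hc]
      convert hasSum_zero using 2 with G
      rw [if_neg]
      rintro h
      exact hc (h ▸ G.2)
  convert h using 1
  · funext G
    rw [Nat.card_eq_fintype_card, Fintype.card_subtype, Finset.sum_boole]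
  · rw [Nat.card_eq_fintype_card, Fintype.card_subtype, Finset.sum_boole]

section Mass

variable {F : Type} [Group F] [Finite F] {L : Set FinGrpClass} {r : ℕ} {A : Fin r → OuterGroup F}

/-- After division by `|Aut G|`, the double count gives for each `G` the number of families of
extensions whose fibre product is isomorphic to `G`. Summing over `G ∈ L` counts the families with
fibre product in `L`, a condition on each member separately. -/
theorem hasSum_fullFraming (hD : DownwardClosed L) (hJ : JoinClosed L) (hF : grpClass F ∈ L)
    (M : ∀ k, ExtensionModel (A k)) :
    HasSum (fun x : Σ G : L, Sur G.1.rep F =>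
      (Nat.card (FullFraming A x.2.1) : ℝ) * (1 / (Nat.card (MulAut x.1.1.rep) : ℝ)))
      (∏ k, (Nat.card {c : (M k).X // grpClass ((M k).E c) ∈ L} : ℝ) / (M k).y) := by
  classical
  have hy : (∏ k, ((M k).y : ℝ)) ≠ 0 :=
    Finset.prod_ne_zero_iff.2 fun k _ => by exact_mod_cast (M k).y_pos.ne'
  let : ∀ G : L, Fintype (Sur G.1.rep F) := fun G => Fintype.ofFinite _
  have hfib : ∀ G : L, HasSum (fun π : Sur G.1.rep F =>
      (Nat.card (FullFraming A π.1) : ℝ) * (1 / (Nat.card (MulAut G.1.rep) : ℝ)))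
      ((Nat.card {c : ∀ k, (M k).X // grpClass (ExtensionModel.fiberProd M c) = G.1} : ℝ) /
        ∏ k, ((M k).y : ℝ)) := by
    intro G
    convert hasSum_fintype _ using 1
    rw [← Finset.sum_mul]
    have hA : (Nat.card (MulAut G.1.rep) : ℝ) ≠ 0 := by
      exact_mod_cast (Nat.card_pos (α := MulAut G.1.rep)).ne'
    rw [mul_one_div, div_eq_div_iff hy hA]
    have h1 := card_sigma_fullFraming (G := G.1.rep) M
    let : Fintype (∀ k, (M k).X) := Fintype.ofFinite _
    rw [Nat.card_sigma, Nat.card_sigma] at h1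
    -- The isomorphisms between two isomorphic groups form a torsor under `Aut G`, which is what the
    -- weight `1 / |Aut G|` compensates.
    have h2 : ∀ c : ∀ k, (M k).X, Nat.card (G.1.rep ≃* ExtensionModel.fiberProd M c) =
        if grpClass (ExtensionModel.fiberProd M c) = G.1 then Nat.card (MulAut G.1.rep) else 0 := by
      intro c
      rw [card_mulEquiv, ← grpClass_eq_iff, grpClass_rep]
      simp only [eq_comm]
    rw [Finset.sum_congr rfl fun c _ => h2 c, Finset.sum_ite, Finset.sum_const, Finset.sum_const_zero,
      add_zero, smul_eq_mul] at h1
    rw [Nat.card_eq_fintype_card (α := {c : ∀ k, (M k).X //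
      grpClass (ExtensionModel.fiberProd M c) = G.1}), Fintype.card_subtype]
    exact_mod_cast h1.symm
  have hsum : HasSum (fun G : L => ((Nat.card {c : ∀ k, (M k).X //
      grpClass (ExtensionModel.fiberProd M c) = G.1} : ℝ) / ∏ k, ((M k).y : ℝ)))
      (∏ k, (Nat.card {c : (M k).X // grpClass ((M k).E c) ∈ L} : ℝ) / (M k).y) := by
    rw [Finset.prod_div_distrib]
    have := (hasSum_grpClass_eq L fun c : ∀ k, (M k).X => grpClass (ExtensionModel.fiberProd M c))
    suffices h : Nat.card {c : ∀ k, (M k).X // grpClass (ExtensionModel.fiberProd M c) ∈ L} =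
        ∏ k, Nat.card {c : (M k).X // grpClass ((M k).E c) ∈ L} by
      rw [h, Nat.cast_prod] at this
      exact this.div_const _
    rw [← Nat.card_pi]
    refine Nat.card_congr ((Equiv.subtypeEquivRight fun c => ?_).trans Equiv.subtypePiEquivPi)
    exact ExtensionModel.grpClass_fiberProd_mem_iff hD hJ hF c
  refine HasSum.sigma_of_hasSum hsum hfib ?_
  refine (summable_sigma_of_nonneg fun x => by positivity).2 ⟨fun G => (hfib G).summable, ?_⟩
  refine hsum.summable.congr fun G => ?_
  exact (hfib G).tsum_eq.symm

end Mass

namespace SimpleSystem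

variable {F : Type} [Group F] {ι : Type} [DecidableEq ι] (D : SimpleSystem F ι)

/-- The kernel of `π` is a product with `t i` factors of type `i`. -/
def HasType {G : Type} [Group G] (π : G →* F) (t : ι → ℕ) : Prop :=
  ∃ (r : ℕ) (τ : Fin r → ι) (J : D.Framing π τ), J.1.range = π.ker ∧ wordCount τ = t

theorem HasType.unique {G : Type} [Group G] [Finite G] {π : G →* F} (hπ : Function.Surjective π)
    {t t' : ι → ℕ} (h : D.HasType π t) (h' : D.HasType π t') : t = t' := by
  obtain ⟨r, τ, J, hJ, rfl⟩ := h
  obtain ⟨r', τ', J', hJ', rfl⟩ := h'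
  exact D.wordCount_eq hπ J hJ J' hJ'

theorem exists_word [Fintype ι] (t : ι → ℕ) : ∃ (r : ℕ) (τ : Fin r → ι), wordCount τ = t := by
  let e := (Fintype.equivFin (Σ i, Fin (t i))).symm
  refine ⟨_, fun k => (e k).1, funext fun i => ?_⟩
  unfold wordCount
  rw [← Fintype.card_subtype, Fintype.card_congr (e.subtypeEquiv (q := fun x => x.1 = i) fun _ => Iff.rfl),
    Fintype.card_congr (Equiv.sigmaSubtype i), Fintype.card_fin]

open Classical in
-- A framing whose multiplicities are those of the kernel is automatically full, so all framings of
-- this word are counted.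
theorem card_fullFraming [Fintype ι] {G : Type} [Group G] [Finite G] {π : G →* F}
    (hπ : Function.Surjective π) {r : ℕ} (τ : Fin r → ι) :
    Nat.card (FullFraming (fun k => D.S (τ k)) π) =
      if D.HasType π (wordCount τ) then D.framingNumber (wordCount τ) (wordCount τ) else 0 := by
  split_ifs with h
  · obtain ⟨r₀, τ₀, J₀, hJ₀, hτ⟩ := h
    have h1 := D.card_framing hπ J₀ hJ₀ τ
    rw [hτ] at h1
    rw [← h1]
    refine Nat.card_congr (Equiv.subtypeEquivRight fun J => ⟨fun h => h.1, fun h => ⟨h, ?_⟩⟩)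
    exact D.range_eq_ker J₀ hJ₀ ⟨J, h⟩ hτ
  · have : IsEmpty (FullFraming (fun k => D.S (τ k)) π) :=
      ⟨fun J => h ⟨r, τ, ⟨J.1, J.2.1⟩, J.2.2, rfl⟩⟩
    exact Nat.card_of_isEmpty

/-- The mass of the extensions in `L` of `F` by a simple `[F]`-group. -/
noncomputable def mass {S : OuterGroup F} (M : ExtensionModel S) (L : Set FinGrpClass) : ℝ :=
  (Nat.card {c : M.X // grpClass (M.E c) ∈ L} : ℝ) / M.y

open Classical in
-- An epimorphism of type `t` has the same number of full framings for a fixed word of that type, so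
-- its mass is the framed mass divided by this number.
theorem hasSum_hasType [Fintype ι] [Finite F] {L : Set FinGrpClass} (hD : DownwardClosed L)
    (hJ : JoinClosed L) (hF : grpClass F ∈ L) (M : ∀ i, ExtensionModel (D.S i)) (t : ι → ℕ) :
    HasSum (fun x : Σ G : L, Sur G.1.rep F =>
      if D.HasType x.2.1 t then 1 / (Nat.card (MulAut x.1.1.rep) : ℝ) else 0)
      ((∏ i, mass (M i) L ^ t i) / D.framingNumber t t) := by
  obtain ⟨r, τ, rfl⟩ := exists_word t
  have h := hasSum_fullFraming (A := fun k => D.S (τ k)) hD hJ hF fun k => M (τ k)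
  have hpos : (D.framingNumber (wordCount τ) (wordCount τ) : ℝ) ≠ 0 := by
    exact_mod_cast (D.framingNumber_pos fun _ => le_rfl).ne'
  have h' := h.div_const (D.framingNumber (wordCount τ) (wordCount τ) : ℝ)
  have e1 : (∏ k, (Nat.card {c : (M (τ k)).X // grpClass ((M (τ k)).E c) ∈ L} : ℝ) / (M (τ k)).y) =
      ∏ i, mass (M i) L ^ wordCount τ i := by
    rw [← Finset.prod_fiberwise (g := τ)]
    refine Finset.prod_congr rfl fun i _ => ?_
    rw [Finset.prod_congr rfl (g := fun _ => mass (M i) L) fun k hk => by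
      rw [← (Finset.mem_filter.1 hk).2]; rfl, Finset.prod_const]
    rfl
  rw [e1] at h'
  refine Eq.mp (congrArg (fun f => HasSum f _) (funext fun x => ?_)) h'
  rw [D.card_fullFraming x.2.2]
  split_ifs with hx
  · rw [mul_div_right_comm, div_self hpos, one_mul]
  · simp

end SimpleSystem

/-! ### Sums over types -/

open Classical in
-- Fubini on the pairs `(t, x)` with `x` of type `t`. An `x` has at most one type, so summing over
-- `t` first returns `f x`; summing over `x` first gives `g t * m t`.
theorem hasSum_of_types {X T : Type*} (ty : X → T → Prop)
    (huniq : ∀ x t t', ty x t → ty x t' → t = t') {w : X → ℝ} (hw : ∀ x, 0 ≤ w x) {m : T → ℝ}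
    (hm : ∀ t, HasSum (fun x => if ty x t then w x else 0) (m t)) {g : T → ℝ}
    (hg : Summable fun t => |g t| * m t) {f : X → ℝ} (hf : ∀ x t, ty x t → f x = g t * w x)
    (hf0 : ∀ x, (∀ t, ¬ ty x t) → f x = 0) : HasSum f (∑' t, g t * m t) := by
  let Φ : T × X → ℝ := fun z => g z.1 * if ty z.2 z.1 then w z.2 else 0
  have hw' : ∀ x t, 0 ≤ if ty x t then w x else 0 := fun x t => by
    split_ifs
    · exact hw x
    · exact le_rfl
  have hΦ : Summable Φ := by
    refine Summable.of_abs ?_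
    refine (summable_prod_of_nonneg fun _ => abs_nonneg _).2 ⟨fun t => ?_, ?_⟩
    · refine ((hm t).mul_left (|g t|)).summable.congr fun x => ?_
      simp only [Φ, abs_mul]
      congr 1
      exact (abs_of_nonneg (hw' _ _)).symm
    · refine hg.congr fun t => ?_
      rw [← ((hm t).mul_left (|g t|)).tsum_eq]
      congr 1
      funext x
      simp only [Φ, abs_mul]
      congr 1
      exact (abs_of_nonneg (hw' _ _)).symm
  have h1 : HasSum (fun t => g t * m t) (∑' z, Φ z) :=
    hΦ.hasSum.prod_fiberwise fun t => (hm t).mul_left (g t)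
  rw [h1.tsum_eq]
  have h2 : HasSum (Φ ∘ Prod.swap) (∑' z, Φ z) := (Equiv.prodComm X T).hasSum_iff.2 hΦ.hasSum
  refine h2.prod_fiberwise fun x => ?_
  by_cases hx : ∃ t, ty x t
  · obtain ⟨t, ht⟩ := hx
    have : f x = (fun t' => (Φ ∘ Prod.swap) (x, t')) t := by
      simp [Φ, ht, hf x t ht]
    rw [this]
    refine hasSum_single t fun t' ht' => ?_
    simp only [Φ, Function.comp, Prod.swap]
    rw [if_neg fun h => ht' (huniq x t' t h ht), mul_zero]
  · push Not at hx
    rw [hf0 x hx]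
    convert hasSum_zero using 2 with t
    simp [Φ, hx t]

theorem hasSum_prod_pi {ι : Type*} [Fintype ι] (a : ι → ℕ → ℝ)
    (ha : ∀ i, Summable fun k => |a i k|) :
    HasSum (fun t : ι → ℕ => ∏ i, a i (t i)) (∏ i, ∑' k, a i k) := by
  -- The induction runs over `Finite` types, so the `Fintype` instance has to be arbitrary at each
  -- stage.
  have key : ∀ (_ : Fintype ι) (a : ι → ℕ → ℝ), (∀ i, Summable fun k => |a i k|) →
      HasSum (fun t : ι → ℕ => ∏ i, a i (t i)) (∏ i, ∑' k, a i k) := by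
    clear ha a
    induction ι using Finite.induction_empty_option with
    | of_equiv e ih =>
      rename_i α β
      intro _ a ha
      let : Fintype α := Fintype.ofEquiv β e.symm
      have h := ih this (fun i => a (e i)) fun i => ha (e i)
      rw [e.prod_comp fun i => ∑' k, a i k] at h
      refine (Equiv.hasSum_iff (e.arrowCongr (Equiv.refl ℕ))
        (f := fun t : β → ℕ => ∏ i, a i (t i))).1 ?_
      refine Eq.mp (congrArg (fun f => HasSum f _) (funext fun t => ?_)) h
      rw [Function.comp, ← e.prod_comp]
      simp
    | h_empty =>
      intro _ a _
      simp
    | h_option ih =>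
      rename_i α _
      intro _ a ha
      have h1 := ih inferInstance (fun i => a (some i)) fun i => ha (some i)
      have h2 := ih inferInstance (fun i k => |a (some i) k|) fun i => by simpa using ha (some i)
      have h0 : HasSum (a none) (∑' k, a none k) := (Summable.of_abs (ha none)).hasSum
      have h3 : Summable fun t : α → ℕ => ‖∏ i, a (some i) (t i)‖ := by
        refine h2.summable.congr fun t => ?_
        rw [Real.norm_eq_abs, Finset.abs_prod]
      have h4 : Summable fun k => ‖a none k‖ := ha none
      have h := h0.mul h1 (summable_mul_of_summable_norm (f := a none)
        (g := fun t : α → ℕ => ∏ i, a (some i) (t i)) h4 h3)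
      let e : ℕ × (α → ℕ) ≃ (Option α → ℕ) := (Equiv.piOptionEquivProd (β := fun _ => ℕ)).symm
      have hp : ∀ f : Option α → ℝ, ∏ i, f i = f none * ∏ i, f (some i) := fun f => by
        convert Fintype.prod_option f
      rw [hp]
      refine (Equiv.hasSum_iff e).1 ?_
      refine Eq.mp (congrArg (fun f => HasSum f _) (funext fun t => ?_)) h
      rw [Function.comp, hp]
      rfl
  exact key _ a ha

/-! ### The model for a non-abelian simple `[F]`-group -/

section Nonabelian

variable {F : Type} [Group F] {S : OuterGroup F}

/-- The centre is invariant under all automorphisms, hence trivial or everything, and the latter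
would make the group commutative. -/
theorem OuterGroup.IsSimple.conj_injective (hS : S.IsSimple) (hn : S.IsNonabelian) :
    Function.Injective (MulAut.conj : S.N →* MulAut S.N) := by
  rw [injective_iff_map_eq_one]
  intro a ha
  have hcent : ∀ z : S.N, z ∈ Subgroup.center S.N ↔ ∀ b, b * z = z * b :=
    fun z => Subgroup.mem_center_iff
  have hac : a ∈ Subgroup.center S.N := by
    rw [hcent]
    intro b
    have := DFunLike.congr_fun ha b
    rw [MulAut.conj_apply, MulAut.one_apply, mul_inv_eq_iff_eq_mul] at this
    exact this.symm
  rcases hS.eq_bot_or_top (Subgroup.center S.N) (fun g => by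
    obtain ⟨σ, hσ⟩ := S.exists_lift g
    refine ⟨σ, hσ, fun x hx => ?_⟩
    rw [hcent] at hx ⊢
    intro b
    obtain ⟨b, rfl⟩ := σ.surjective b
    rw [← map_mul, hx, map_mul]) with h | h
  · rw [h] at hac
    exact hac
  · obtain ⟨b, c, hbc⟩ := hn
    have : c ∈ Subgroup.center S.N := by rw [h]; trivial
    exact absurd ((hcent c).1 this b) hbc

/-- The inclusion of `N` in `F ×_{Out(N)} Aut(N)`. -/
def OuterGroup.toFiberProduct (S : OuterGroup F) : S.N →* S.fiberProduct :=
  ((MonoidHom.inr F _).comp MulAut.conj).codRestrict _ fun s => by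
    change S.act 1 = toOuter S.N (MulAut.conj s)
    rw [map_one]
    have h : MulAut.conj s ∈ (MulAut.conj : S.N →* MulAut S.N).range := ⟨s, rfl⟩
    exact ((QuotientGroup.eq_one_iff _).2 h).symm

/-- The projection `F ×_{Out(N)} Aut(N) → F`. -/
def OuterGroup.fiberProductFst (S : OuterGroup F) : S.fiberProduct →* F :=
  (MonoidHom.fst _ _).comp (Subgroup.subtype _)

/-- The projection `F ×_{Out(N)} Aut(N) → Aut(N)`. -/
def OuterGroup.fiberProductSnd (S : OuterGroup F) : S.fiberProduct →* MulAut S.N :=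
  (MonoidHom.snd _ _).comp (Subgroup.subtype _)

theorem OuterGroup.toOuter_fiberProductSnd (x : S.fiberProduct) :
    toOuter S.N (S.fiberProductSnd x) = S.act (S.fiberProductFst x) := x.2.symm

theorem mul_conj_mul_inv {N : Type*} [Group N] (α : MulAut N) (n : N) :
    α * MulAut.conj n * α⁻¹ = MulAut.conj (α n) := by
  ext x
  simp [MulAut.conj_apply]

theorem OuterGroup.toFiberProduct_conj (x : S.fiberProduct) (s : S.N) :
    x * S.toFiberProduct s * x⁻¹ = S.toFiberProduct (S.fiberProductSnd x s) := by
  apply Subtype.ext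
  refine Prod.ext ?_ ?_
  · change S.fiberProductFst x * 1 * (S.fiberProductFst x)⁻¹ = 1
    simp
  · exact mul_conj_mul_inv _ _

theorem OuterGroup.fiberProduct_ext {x y : S.fiberProduct}
    (h : S.fiberProductFst x = S.fiberProductFst y) (h' : S.fiberProductSnd x = S.fiberProductSnd y) :
    x = y := Subtype.ext (Prod.ext h h')

/-- An extension of `F` by `S` maps to `F ×_{Out(N)} Aut(N)`. -/
theorem IsEmb.exists_toFiberProduct {G : Type} [Group G] {π : G →* F} {j : S.N →* G}
    (hj : IsEmb π S j) : ∃ ψ : G →* S.fiberProduct, S.fiberProductFst.comp ψ = π ∧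
      ∀ x s, x * j s * x⁻¹ = j (S.fiberProductSnd (ψ x) s) := by
  choose σ hσ hc using hj.equivariant
  refine ⟨⟨⟨fun x => ⟨(π x, σ x), (hσ x).symm⟩, ?_⟩, fun x y => ?_⟩, rfl, fun x s => hc x s⟩
  · apply Subtype.ext
    refine Prod.ext (map_one π) ?_
    ext s
    apply hj.inj
    change j (σ 1 s) = j s
    rw [← hc]
    group
  · apply Subtype.ext
    refine Prod.ext (map_mul π x y) ?_
    ext s
    apply hj.inj
    change j (σ (x * y) s) = j (σ x (σ y s))
    rw [← hc, ← hc, ← hc]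
    group

/-- The model for a non-abelian simple `[F]`-group. -/
noncomputable def nonabelianModel [Finite F] (hS : S.IsSimple) (hn : S.IsNonabelian) :
    ExtensionModel S where
  X := Unit
  E _ := S.fiberProduct
  p _ := S.fiberProductFst
  surjective _ f := by
    obtain ⟨σ, hσ⟩ := S.exists_lift f
    exact ⟨⟨(f, σ), hσ.symm⟩, rfl⟩
  can _ := S.toFiberProduct
  isEmb _ := by
    refine ⟨fun s t h => hS.conj_injective hn (congrArg S.fiberProductSnd h), ?_, fun x => ?_⟩
    · rintro _ ⟨s, rfl⟩
      rfl
    · exact ⟨S.fiberProductSnd x, toOuter_fiberProductSnd x, fun s => toFiberProduct_conj x s⟩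
  range_can _ := by
    refine le_antisymm ?_ ?_
    · rintro _ ⟨s, rfl⟩
      rfl
    · intro x hx
      have h1 := toOuter_fiberProductSnd x
      have hx : S.fiberProductFst x = 1 := hx
      rw [hx, map_one] at h1
      obtain ⟨s, hs⟩ := (QuotientGroup.eq_one_iff _).1 h1
      exact ⟨s, fiberProduct_ext hx.symm hs⟩
  y := 1
  y_pos := Nat.one_pos
  card_hom := by
    intro G _ _ π hπ j hj B hB hjB hjBK
    obtain ⟨ψ, hψ, hc⟩ := hj.exists_toFiberProduct
    have := hj.normal
    rw [Nat.card_eq_one_iff_unique]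
    constructor
    · constructor
      rintro ⟨⟨⟨⟩, ψ₁⟩, h₁, h₁', -⟩ ⟨⟨⟨⟩, ψ₂⟩, h₂, h₂', -⟩
      suffices h : ψ₁ = ψ₂ by subst h; rfl
      -- Uniqueness: `ψ' x` acts on the image of `S` as conjugation by `x` does on `j(S)`, and inner
      -- automorphisms determine elements.
      have key : ∀ ψ' : G →* S.fiberProduct, ψ'.comp j = S.toFiberProduct → ∀ x s,
          S.fiberProductSnd (ψ' x) s = S.fiberProductSnd (ψ x) s := by
        intro ψ' h x s
        apply hS.conj_injective hn
        have e1 : ψ' (x * j s * x⁻¹) = ψ' (j (S.fiberProductSnd (ψ x) s)) := by rw [hc]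
        have e2 : ∀ s, ψ' (j s) = S.toFiberProduct s := DFunLike.congr_fun h
        rw [map_mul, map_mul, map_inv, e2, e2, toFiberProduct_conj] at e1
        exact congrArg S.fiberProductSnd e1
      ext1 x
      refine fiberProduct_ext ?_ ?_
      · exact DFunLike.congr_fun (h₁.trans h₂.symm) x
      · ext s
        exact (key ψ₁ h₁' x s).trans (key ψ₂ h₂' x s).symm
    · refine ⟨⟨⟨(), ψ⟩, hψ, ?_, ?_⟩⟩
      · ext1 s
        refine fiberProduct_ext ?_ ?_
        · exact (DFunLike.congr_fun hψ (j s)).trans (hj.le_ker ⟨s, rfl⟩)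
        · ext t
          apply hj.inj
          have := hc (j s) t
          rw [← map_mul, ← map_inv, ← map_mul] at this
          exact this.symm
      · intro b hb
        refine fiberProduct_ext (y := 1) ?_ ?_
        · rw [map_one]
          refine (DFunLike.congr_fun hψ b).trans ?_
          have : b ∈ π.ker := by rw [← hjBK]; exact (le_sup_right : B ≤ _) hb
          exact this
        · ext t
          apply hj.inj
          refine (hc b t).symm.trans ?_
          have h1 : Commute (j t) b := commute_of_inf_eq_bot hjB ⟨t, rfl⟩ hb
          rw [← h1.eq, mul_inv_cancel_right, map_one]
          rfl

end Nonabelian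

/-! ### Irreducible representations as simple `[F]`-groups -/

namespace PrimeIrrep

variable {F : Type} [Group F] (A : PrimeIrrep F)

/-- An irreducible representation as an `[F]`-group. -/
def outer : OuterGroup F where
  N := Multiplicative A.V
  act := (toOuter _).comp A.action

variable {A}

/-- Inner automorphisms of a commutative group are trivial, so outer classes have only one lift. -/
theorem eq_action {g : F} {σ : MulAut (Multiplicative A.V)} (h : toOuter A.outer.N σ = A.outer.act g) :
    σ = A.action g := by
  obtain ⟨n, hn⟩ := exists_conj_of_toOuter_eq (show toOuter A.outer.N σ = toOuter _ (A.action g) from h)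
  have : MulAut.conj n = 1 := by
    ext x
    exact mul_inv_cancel_comm (G := Multiplicative A.V) n x
  rw [hn, this]
  exact (mul_one σ).symm

variable (A)

theorem not_isNonabelian_outer : ¬ A.outer.IsNonabelian := by
  rintro ⟨a, b, h⟩
  exact h (mul_comm (G := Multiplicative A.V) a b)

/-- Over a prime field every additive subgroup is a subspace, so invariant subgroups are
subrepresentations. -/
theorem isSimple_outer : A.outer.IsSimple := by
  have hirr := A.irreducible
  constructor
  · have : Nontrivial A.V := by
      by_contra h
      rw [not_nontrivial_iff_subsingleton] at h
      obtain ⟨U, W, hUW⟩ := exists_pair_ne (Subrepresentation A.V.ρ)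
      apply hUW
      ext v
      rw [Subsingleton.elim v 0]
      exact ⟨fun _ => zero_mem _, fun _ => zero_mem _⟩
    exact inferInstanceAs (Nontrivial (Multiplicative A.V))
  · intro K hK h
    let W : Subrepresentation A.V.ρ :=
      { toSubmodule := AddSubgroup.toZModSubmodule A.p (Subgroup.toAddSubgroup' K)
        apply_mem_toSubmodule := fun g v hv => by
          have := h g (A.action g) rfl
          change Multiplicative.ofAdd (A.V.ρ g v) ∈ K
          rw [← this]
          exact ⟨Multiplicative.ofAdd v, hv, rfl⟩ }
    have hW : ∀ v : A.V, v ∈ W ↔ Multiplicative.ofAdd v ∈ K := fun v => Iff.rfl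
    rcases eq_bot_or_eq_top W with h' | h'
    · left
      ext v
      have := hW v
      rw [h'] at this
      exact this.symm
    · right
      ext v
      have := hW v
      rw [h'] at this
      exact this.symm

theorem isMorphism_outer_iff {B : PrimeIrrep F} (f : Multiplicative A.V →* Multiplicative B.V) :
    A.outer.IsMorphism B.outer f ↔ ∀ g v, f (A.action g v) = B.action g (f v) := by
  constructor
  · intro h g v
    obtain ⟨σ, hσ, hc⟩ := h g (A.action g) rfl
    rw [← eq_action hσ]
    exact (hc v).symm
  · intro h
    refine isMorphism_of_exists fun g => ⟨A.action g, B.action g, rfl, rfl, fun x => (h g x).symm⟩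

theorem iso_of_equiv_outer {B : PrimeIrrep F} (h : Nonempty (A.outer.Equiv B.outer)) : A.Iso B := by
  obtain ⟨e, he, -⟩ := h
  exact ⟨MulEquiv.toAdditive e, fun g v => (isMorphism_outer_iff A (B := B) _).1 he g v⟩

theorem card_normalMorphism_outer : Nat.card (A.outer.NormalMorphism A.outer) = A.q := by
  unfold q
  symm
  refine Nat.card_congr (Equiv.ofBijective (fun φ => ⟨(AddMonoidHom.toMultiplicative
    φ.toLinearMap.toAddMonoidHom : Multiplicative A.V →* Multiplicative A.V), ?_, ?_⟩) ⟨?_, ?_⟩)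
  · exact (isMorphism_outer_iff A _).2 fun g v => φ.isIntertwining _ _ g v
  · exact ⟨fun x hx g => by
      have : g * x * g⁻¹ = x := mul_inv_cancel_comm (G := Multiplicative A.V) g x
      rwa [this]⟩
  · intro φ ψ h
    ext v
    exact DFunLike.congr_fun (congrArg Subtype.val h) (Multiplicative.ofAdd v)
  · rintro ⟨f, hf, hn⟩
    let f' : A.V →+ A.V := MonoidHom.toAdditive (α := Multiplicative A.V) (β := Multiplicative A.V) f
    refine ⟨⟨f'.toZModLinearMap A.p, fun g => ?_⟩, ?_⟩
    · ext v
      exact (isMorphism_outer_iff A f).1 hf g v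
    · rfl

end PrimeIrrep

/-! ### The model for an irreducible representation -/

namespace PrimeIrrep

variable {F : Type} [Group F] (A : PrimeIrrep F)

/-! ### The extension given by a 2-cocycle. -/

section Cocycle

variable {A} (c : groupCohomology.cocycles₂ A.V)

theorem _root_.CocycleExtension.mul_fst (x y : CocycleExtension c) :
    (x * y).fst = x.fst + A.V.ρ x.snd y.fst + c (x.snd, y.snd) := rfl

theorem _root_.CocycleExtension.mul_snd (x y : CocycleExtension c) : (x * y).snd = x.snd * y.snd := rfl

theorem _root_.CocycleExtension.one_fst : (1 : CocycleExtension c).fst = -c (1, 1) := rfl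

/-- The projection of an extension to `F`. -/
def extensionSnd : CocycleExtension c →* F where
  toFun x := x.snd
  map_one' := rfl
  map_mul' _ _ := rfl

/-- The inclusion of `V` in an extension. -/
def extensionInl : Multiplicative A.V →* CocycleExtension c where
  -- Cocycles are not normalized: the identity has first coordinate `-c (1, 1)`, which explains the
  -- shift.
  toFun v := ⟨v.toAdd - c (1, 1), 1⟩
  map_one' := by
    apply CocycleExtension.ext
    · exact zero_sub _
    · rfl
  map_mul' v w := by
    apply CocycleExtension.ext
    · rw [CocycleExtension.mul_fst]
      simp only [toAdd_mul, map_one, Module.End.one_apply]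
      abel
    · exact (one_mul (1 : F)).symm

theorem extensionInl_fst (v : Multiplicative A.V) : (extensionInl c v).fst = v.toAdd - c (1, 1) := rfl

theorem extensionInl_snd (v : Multiplicative A.V) : (extensionInl c v).snd = 1 := rfl

theorem extensionInl_mul_fst (v : Multiplicative A.V) (x : CocycleExtension c) :
    (extensionInl c v * x).fst = v.toAdd + x.fst := by
  rw [CocycleExtension.mul_fst, extensionInl_fst, extensionInl_snd,
    groupCohomology.cocycles₂_map_one_fst c x.snd, map_one, Module.End.one_apply]
  abel

theorem mul_extensionInl (x : CocycleExtension c) (v : Multiplicative A.V) :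
    x * extensionInl c v = extensionInl c (A.action x.snd v) * x := by
  apply CocycleExtension.ext
  · rw [extensionInl_mul_fst, CocycleExtension.mul_fst, extensionInl_fst, extensionInl_snd,
      groupCohomology.cocycles₂_map_one_snd c x.snd, map_sub]
    change _ = A.V.ρ x.snd v.toAdd + x.fst
    abel
  · rw [CocycleExtension.mul_snd, CocycleExtension.mul_snd, extensionInl_snd, extensionInl_snd, mul_one,
      one_mul]

theorem isEmb_extensionInl : IsEmb (extensionSnd c) A.outer (extensionInl c) where
  inj := fun (v w : Multiplicative A.V) h => by
    have h : v.toAdd - c (1, 1) = w.toAdd - c (1, 1) := congrArg CocycleExtension.fst h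
    have h2 : (Multiplicative.toAdd v : A.V) = Multiplicative.toAdd w := sub_left_injective h
    exact h2
  le_ker := by
    rintro _ ⟨v, rfl⟩
    rfl
  equivariant x := ⟨A.action x.snd, rfl, fun s => by
    rw [mul_inv_eq_iff_eq_mul]
    exact mul_extensionInl c x s⟩

theorem range_extensionInl : (extensionInl c).range = (extensionSnd c).ker := by
  refine le_antisymm (isEmb_extensionInl c).le_ker fun x hx => ?_
  refine ⟨Multiplicative.ofAdd (x.fst + c (1, 1)), ?_⟩
  apply CocycleExtension.ext
  · exact add_sub_cancel_right _ _
  · exact Eq.symm hx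

end Cocycle

/-! ### Homomorphisms to cocycle extensions, counted by their first coordinates. -/

section Count

variable {A} {G : Type} [Group G] {π : G →* F} {j : Multiplicative A.V →* G} {B : Subgroup G}

/-- The functions on an extension of `F` that restrict to the projection to `V` on the kernel, up to
translation. -/
def IsTranslationFunction (j : Multiplicative A.V →* G) (B : Subgroup G) (h : G → A.V) : Prop :=
  ∀ s, ∀ b ∈ B, ∀ x, h (j s * b * x) = s.toAdd + h x

/-- The difference of a function from being a crossed homomorphism. -/
def crossedDefect (A : PrimeIrrep F) (π : G →* F) (h : G → A.V) (x y : G) : A.V :=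
  h (x * y) - h x - A.V.ρ (π x) (h y)

theorem exists_mul_of_map_eq (hπK : j.range ⊔ B = π.ker) (hB : B.Normal) {x y : G}
    (hxy : π x = π y) : ∃ s, ∃ b ∈ B, x = j s * b * y := by
  have : x * y⁻¹ ∈ π.ker := by rw [MonoidHom.mem_ker, map_mul, map_inv, hxy, mul_inv_cancel]
  rw [← hπK] at this
  obtain ⟨_, ⟨s, rfl⟩, b, hb, h⟩ := Subgroup.mem_sup_of_normal_right.1 this
  exact ⟨s, b, hb, by rw [h, inv_mul_cancel_right]⟩

/-- Moving `x` or `y` by an element of the kernel translates the terms of the defect by amounts that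
cancel, because `j` is equivariant and `B` is normal. So the defect lives on `F × F`. -/
theorem crossedDefect_eq (hj : IsEmb π A.outer j) (hB : B.Normal) (hK : j.range ⊔ B = π.ker)
    {h : G → A.V} (hh : IsTranslationFunction j B h) {x x' y y' : G} (hx : π x = π x')
    (hy : π y = π y') : crossedDefect A π h x y = crossedDefect A π h x' y' := by
  have h1 : crossedDefect A π h x y = crossedDefect A π h x' y := by
    obtain ⟨s, b, hb, rfl⟩ := exists_mul_of_map_eq hK hB hx
    unfold crossedDefect
    rw [hx, mul_assoc, hh s b hb, hh s b hb]
    abel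
  rw [h1]
  obtain ⟨s, b, hb, rfl⟩ := exists_mul_of_map_eq hK hB hy
  unfold crossedDefect
  obtain ⟨σ, hσ, hc⟩ := hj.equivariant x'
  obtain rfl := eq_action hσ
  have hc' : x' * j s * x'⁻¹ = j (A.action (π x') s) := hc s
  have h2 : x' * (j s * b * y') = j (A.action (π x') s) * (x' * b * x'⁻¹) * (x' * y') := by
    rw [← hc']
    group
  rw [h2, hh _ _ (hB.conj_mem b hb x'), hh s b hb, map_add]
  change A.V.ρ (π x') s.toAdd + _ - _ - _ = _
  abel

theorem crossedDefect_cocycle (h : G → A.V) (x y z : G) :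
    crossedDefect A π h (x * y) z + crossedDefect A π h x y =
      A.V.ρ (π x) (crossedDefect A π h y z) + crossedDefect A π h x (y * z) := by
  unfold crossedDefect
  rw [map_sub, map_sub, map_mul, map_mul, Module.End.mul_apply, mul_assoc]
  abel

theorem exists_cocycle (hπ : Function.Surjective π) (hj : IsEmb π A.outer j) (hB : B.Normal)
    (hK : j.range ⊔ B = π.ker) {h : G → A.V} (hh : IsTranslationFunction j B h) :
    ∃ c : groupCohomology.cocycles₂ A.V, ∀ x y, c (π x, π y) = crossedDefect A π h x y := by
  let c : F × F → A.V := fun z =>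
    crossedDefect A π h (Function.surjInv hπ z.1) (Function.surjInv hπ z.2)
  have hc : ∀ x y, c (π x, π y) = crossedDefect A π h x y := fun x y =>
    crossedDefect_eq hj hB hK hh (Function.surjInv_eq hπ _) (Function.surjInv_eq hπ _)
  refine ⟨⟨c, (groupCohomology.mem_cocycles₂_iff c).2 fun f g k => ?_⟩, hc⟩
  obtain ⟨x, rfl⟩ := hπ f
  obtain ⟨y, rfl⟩ := hπ g
  obtain ⟨z, rfl⟩ := hπ k
  rw [← map_mul, ← map_mul, hc, hc, hc, hc]
  exact crossedDefect_cocycle h x y z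

/-- Such a function is determined by its values on a section of `π`, and these are arbitrary. -/
theorem card_translationFunction [Finite G] [Finite F] (hπ : Function.Surjective π)
    (hj : IsEmb π A.outer j) (hB : B.Normal) (hjB : j.range ⊓ B = ⊥) (hK : j.range ⊔ B = π.ker) :
    Nat.card {h : G → A.V // IsTranslationFunction j B h} = Nat.card A.V ^ Nat.card F := by
  rw [← Nat.card_fun]
  have hn : j.range.Normal := hj.normal
  let sec : F → G := Function.surjInv hπ
  have hsec : ∀ f, π (sec f) = f := Function.surjInv_eq hπ
  -- Each `x` is written as `j (pr x) * b x * sec (π x)`; the coordinate `pr x` is unique because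
  -- `j(S)` and `B` meet trivially.
  choose pr b hb hpr using fun x : G => exists_mul_of_map_eq hK hB (hsec (π x)).symm
  have huniq : ∀ s t, ∀ b ∈ B, ∀ b' ∈ B, j s * b = j t * b' → s = t := by
    intro s t b hb b' hb' h
    have : j (t⁻¹ * s) ∈ j.range ⊓ B := by
      refine ⟨⟨_, rfl⟩, ?_⟩
      have e : j (t⁻¹ * s) = b' * b⁻¹ := by
        rw [map_mul, map_inv, inv_mul_eq_iff_eq_mul, ← mul_assoc, eq_mul_inv_iff_mul_eq, h]
      rw [e]
      exact B.mul_mem hb' (B.inv_mem hb)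
    rw [hjB, Subgroup.mem_bot] at this
    exact (inv_mul_eq_one.1 (hj.inj (this.trans (map_one j).symm))).symm
  have hprmul : ∀ s, ∀ b ∈ B, ∀ x, pr (j s * b * x) = s * pr x := by
    intro s b₀ hb₀ x
    have hπx : π (j s * b₀ * x) = π x := by
      have : j s * b₀ ∈ π.ker := by
        rw [← hK]
        exact mul_mem ((le_sup_left : j.range ≤ _) ⟨s, rfl⟩) ((le_sup_right : B ≤ _) hb₀)
      rw [map_mul, MonoidHom.mem_ker.1 this, one_mul]
    have e1 := hpr (j s * b₀ * x)
    have e2 := hpr x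
    rw [hπx] at e1
    refine huniq _ _ (b (j s * b₀ * x)) (hb _) (b₀ * b x) (mul_mem hb₀ (hb _)) ?_
    apply mul_right_cancel (b := sec (π x))
    rw [← e1]
    conv_lhs => rw [e2]
    have hcomm : Commute (j (pr x)) b₀ := commute_of_inf_eq_bot hjB ⟨_, rfl⟩ hb₀
    rw [map_mul]
    simp only [mul_assoc]
    rw [← mul_assoc b₀, ← hcomm.eq]
    simp only [mul_assoc]
  have hprsec : ∀ f, pr (sec f) = 1 := by
    intro f
    have e := hpr (sec f)
    rw [hsec] at e
    refine huniq _ _ _ (hb (sec f)) 1 (one_mem _) ?_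
    rw [map_one, mul_one]
    exact (mul_eq_right.1 e.symm)
  refine Nat.card_congr ⟨fun h f => h.1 (sec f), fun g => ⟨fun x => (pr x).toAdd + g (π x), ?_⟩,
    ?_, ?_⟩
  · intro s b₀ hb₀ x
    have : π (j s * b₀ * x) = π x := by
      have : j s * b₀ ∈ π.ker := by
        rw [← hK]
        exact mul_mem ((le_sup_left : j.range ≤ _) ⟨s, rfl⟩) ((le_sup_right : B ≤ _) hb₀)
      rw [map_mul, MonoidHom.mem_ker.1 this, one_mul]
    simp only [this, hprmul s b₀ hb₀ x, toAdd_mul, add_assoc]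
  · rintro ⟨h, hh⟩
    apply Subtype.ext
    funext x
    change (pr x).toAdd + h (sec (π x)) = h x
    conv_rhs => rw [hpr x]
    rw [hh _ _ (hb x)]
  · intro g
    funext f
    change (pr (sec f)).toAdd + g (π (sec f)) = g f
    rw [hprsec, hsec]
    exact zero_add _

/-- A homomorphism over `F` is known from its first coordinate, a translation function, and the
cocycle is recovered as the defect of that function. Conversely every translation function defines
its own cocycle and a homomorphism to that extension. -/
theorem card_hom_extension [Finite G] [Finite F] (hπ : Function.Surjective π)
    (hj : IsEmb π A.outer j) (hB : B.Normal) (hjB : j.range ⊓ B = ⊥) (hK : j.range ⊔ B = π.ker) :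
    Nat.card {x : Σ c : groupCohomology.cocycles₂ A.V, G →* CocycleExtension c //
      (extensionSnd x.1).comp x.2 = π ∧ x.2.comp j = extensionInl x.1 ∧ B ≤ x.2.ker} =
      Nat.card A.V ^ Nat.card F := by
  rw [← card_translationFunction hπ hj hB hjB hK]
  refine Nat.card_congr (Equiv.ofBijective (fun x => ⟨fun g => (x.1.2 g).fst, ?_⟩) ⟨?_, ?_⟩)
  · obtain ⟨⟨c, ψ⟩, h1, h2, h3⟩ := x
    intro s b hb x
    have e1 : ψ (j s) = extensionInl c s := DFunLike.congr_fun h2 s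
    have e2 : ψ b = 1 := h3 hb
    change (ψ (j s * b * x)).fst = _ + (ψ x).fst
    rw [map_mul, map_mul, e1, e2, mul_one, extensionInl_mul_fst]
  · rintro ⟨⟨c, ψ⟩, h1, h2, h3⟩ ⟨⟨c', ψ'⟩, h1', h2', h3'⟩ h
    have hf : ∀ g, (ψ g).fst = (ψ' g).fst := fun g => congrFun (congrArg Subtype.val h) g
    have hs : ∀ g, (ψ g).snd = π g := fun g => DFunLike.congr_fun h1 g
    have hs' : ∀ g, (ψ' g).snd = π g := fun g => DFunLike.congr_fun h1' g
    have hc : c = c' := by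
      refine groupCohomology.cocycles₂_ext fun f g => ?_
      obtain ⟨x, rfl⟩ := hπ f
      obtain ⟨y, rfl⟩ := hπ g
      have e := congrArg CocycleExtension.fst (map_mul ψ x y)
      have e' := congrArg CocycleExtension.fst (map_mul ψ' x y)
      rw [CocycleExtension.mul_fst, hs, hs] at e
      rw [CocycleExtension.mul_fst, hs', hs', ← hf, ← hf, ← hf, e] at e'
      exact add_left_cancel e'
    subst hc
    have : ψ = ψ' := by
      ext1 g
      exact CocycleExtension.ext (hf g) ((hs g).trans (hs' g).symm)
    subst this
    rfl
  · rintro ⟨h, hh⟩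
    obtain ⟨c, hc⟩ := exists_cocycle hπ hj hB hK hh
    have hc1 : c (1, 1) = -h 1 := by
      have := hc 1 1
      rw [map_one] at this
      rw [this]
      unfold crossedDefect
      rw [map_one, map_one, Module.End.one_apply, mul_one]
      abel
    let ψ : G →* CocycleExtension c :=
      { toFun := fun x => ⟨h x, π x⟩
        map_one' := by
          apply CocycleExtension.ext
          · rw [CocycleExtension.one_fst, hc1, neg_neg]
          · exact map_one π
        map_mul' := fun x y => by
          apply CocycleExtension.ext
          · rw [CocycleExtension.mul_fst, hc]
            unfold crossedDefect
            abel
          · exact map_mul π x y }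
    refine ⟨⟨⟨c, ψ⟩, rfl, ?_, ?_⟩, rfl⟩
    · refine MonoidHom.ext fun s => ?_
      apply CocycleExtension.ext
      · have := hh s 1 (one_mem _) 1
        rw [mul_one, mul_one] at this
        change h (j s) = s.toAdd - c (1, 1)
        rw [this, hc1, sub_neg_eq_add]
      · exact hj.le_ker ⟨s, rfl⟩
    · intro b hb
      apply CocycleExtension.ext
      · have := hh 1 b hb 1
        rw [mul_one, map_one, one_mul] at this
        change h b = -c (1, 1)
        rw [this, hc1, neg_neg]
        exact zero_add _
      · change π b = 1
        have : b ∈ π.ker := by rw [← hK]; exact (le_sup_right : B ≤ _) hb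
        exact this

end Count

instance [Finite F] : Finite (groupCohomology.cocycles₂ A.V) :=
  Finite.of_injective (fun c : groupCohomology.cocycles₂ A.V => (c.1 : F × F → A.V))
    Subtype.val_injective

/-- The model for an irreducible representation. -/
noncomputable def model [Finite F] : ExtensionModel A.outer where
  X := groupCohomology.cocycles₂ A.V
  E c := CocycleExtension c
  p c := extensionSnd c
  surjective _ f := ⟨⟨0, f⟩, rfl⟩
  can c := extensionInl c
  isEmb c := isEmb_extensionInl c
  range_can c := range_extensionInl c
  y := Nat.card A.V ^ Nat.card F
  y_pos := pow_pos Nat.card_pos _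
  card_hom hπ _ hj _ hB hjB hK := card_hom_extension hπ hj hB hjB hK

end PrimeIrrep

/-! ### The system attached to representations and non-abelian simple `[F]`-groups -/

section Words

variable {ι : Type} [DecidableEq ι]

theorem prod_ite_eq_pow_wordCount {M : Type*} [CommMonoid M] {r : ℕ} (τ : Fin r → ι) (i : ι) (a : M) :
    (∏ k, if τ k = i then a else 1) = a ^ wordCount τ i := by
  rw [← Finset.prod_filter, Finset.prod_const]
  rfl

theorem sum_ite_eq_wordCount_mul {r : ℕ} (τ : Fin r → ι) (i : ι) (a : ℕ) :
    (∑ k, if τ k = i then a else 0) = wordCount τ i * a := by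
  rw [← Finset.sum_filter, Finset.sum_const]
  rfl

end Words

namespace OuterGroup

variable {F : Type} [Group F] {A B : OuterGroup F}

theorem card_normalMorphism_of_isEmpty (hA : A.IsSimple) (hB : B.IsSimple) (h : IsEmpty (A.Equiv B)) :
    Nat.card (A.NormalMorphism B) = 1 := by
  have : Unique (A.NormalMorphism B) :=
    ⟨⟨⟨1, one_isMorphism _ _, normal_range_one _ _⟩⟩, fun f => by
      rcases f.2.1.eq_one_or_bijective hA hB f.2.2 with h' | h'
      · exact Subtype.ext h'
      · exact h.elim (equivOfBijective f.1 f.2.1 h')⟩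
  exact Nat.card_unique

theorem IsNonabelian.of_equiv (h : A.IsNonabelian) (e : A.Equiv B) : B.IsNonabelian := by
  obtain ⟨a, b, hab⟩ := h
  refine ⟨e.1 a, e.1 b, fun h => hab (e.1.injective ?_)⟩
  rw [map_mul, map_mul, h]

def Equiv.symm (e : A.Equiv B) : B.Equiv A := ⟨e.1.symm, e.2.2, e.2.1⟩

def Equiv.refl (A : OuterGroup F) : A.Equiv A := ⟨MulEquiv.refl _, isMorphism_id A, isMorphism_id A⟩

end OuterGroup

namespace PrimeIrrep

variable {F : Type} [Group F]

theorem one_lt_q (A : PrimeIrrep F) : 1 < A.q := by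
  rw [← card_normalMorphism_outer]
  have : Nontrivial (A.outer.NormalMorphism A.outer) := by
    refine ⟨⟨⟨1, one_isMorphism _ _, normal_range_one _ _⟩, ⟨MonoidHom.id _, isMorphism_id _, ?_⟩,
      fun h => ?_⟩⟩
    · rw [MonoidHom.range_eq_top.2 Function.surjective_id]
      infer_instance
    · obtain ⟨a, ha⟩ := @exists_ne _ A.isSimple_outer.1 1
      exact ha (DFunLike.congr_fun (congrArg Subtype.val h) a).symm
  exact Finite.one_lt_card

end PrimeIrrep

variable {F : Type} [Group F] {n m : ℕ}

/-- The simple `[F]`-groups attached to irreducible representations `V` and to `N`. -/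
def systemGroup (V : Fin n → PrimeIrrep F) (N : Fin m → OuterGroup F) : Fin n ⊕ Fin m → OuterGroup F :=
  Sum.elim (fun i => (V i).outer) N

/-- The numbers of embeddings into products. -/
noncomputable def systemCount (V : Fin n → PrimeIrrep F) (N : Fin m → OuterGroup F) :
    Fin n ⊕ Fin m → ℕ → ℕ :=
  Sum.elim (fun i c => (V i).q ^ c - 1) fun j c => c * Nat.card ((N j).Equiv (N j))

theorem isSimple_systemGroup {V : Fin n → PrimeIrrep F} {N : Fin m → OuterGroup F}
    (hN : ∀ j, (N j).IsSimple) (i : Fin n ⊕ Fin m) : (systemGroup V N i).IsSimple := by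
  rcases i with i | j
  · exact (V i).isSimple_outer
  · exact hN j

theorem isEmpty_equiv_systemGroup {V : Fin n → PrimeIrrep F} {N : Fin m → OuterGroup F}
    (hV : ∀ i j, (V i).Iso (V j) → i = j) (hNa : ∀ j, (N j).IsNonabelian)
    (hN : ∀ i j, Nonempty ((N i).Equiv (N j)) → i = j) {i j : Fin n ⊕ Fin m} (h : i ≠ j) :
    IsEmpty ((systemGroup V N i).Equiv (systemGroup V N j)) := by
  refine ⟨fun e => ?_⟩
  rcases i with i | i <;> rcases j with j | j
  · exact h (congrArg _ (hV i j ((V i).iso_of_equiv_outer ⟨e⟩)))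
  · exact (V i).not_isNonabelian_outer ((hNa j).of_equiv (OuterGroup.Equiv.symm e))
  · exact (V j).not_isNonabelian_outer ((hNa i).of_equiv e)
  · exact h (congrArg _ (hN i j ⟨e⟩))

/-- The system of simple `[F]`-groups given by pairwise non-isomorphic irreducible representations
and non-abelian simple `[F]`-groups. -/
noncomputable def simpleSystem (V : Fin n → PrimeIrrep F) (N : Fin m → OuterGroup F)
    (hV : ∀ i j, (V i).Iso (V j) → i = j) (hNs : ∀ j, (N j).IsSimple)
    (hNa : ∀ j, (N j).IsNonabelian) (hN : ∀ i j, Nonempty ((N i).Equiv (N j)) → i = j) :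
    SimpleSystem F (Fin n ⊕ Fin m) where
  S := systemGroup V N
  simple := isSimple_systemGroup hNs
  E := systemCount V N
  strictMono i := by
    rcases i with i | j
    · intro a b hab
      have h1 := Nat.pow_lt_pow_right (V i).one_lt_q hab
      have h2 : 0 < (V i).q ^ a := pow_pos (zero_lt_one.trans (V i).one_lt_q) _
      change (V i).q ^ a - 1 < (V i).q ^ b - 1
      omega
    · intro a b hab
      have : Nonempty ((N j).Equiv (N j)) := ⟨OuterGroup.Equiv.refl _⟩
      exact Nat.mul_lt_mul_of_pos_right hab Nat.card_pos
  card_emb := by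
    intro G _ _ π hπ r τ J hJ i
    have he : ∀ {i j}, i ≠ j → IsEmpty ((systemGroup V N i).Equiv (systemGroup V N j)) :=
      fun h => isEmpty_equiv_systemGroup hV hNa hN h
    have hs := isSimple_systemGroup (V := V) hNs
    rcases i with i | j
    · have h := card_emb_abelian hJ hπ (fun k => hs (τ k)) (hs (Sum.inl i))
        (V i).not_isNonabelian_outer
      -- A factor isomorphic to the given representation contributes its `q` endomorphisms, any
      -- other only the trivial morphism.
      rw [Finset.prod_congr rfl (g := fun k => if τ k = Sum.inl i then (V i).q else 1) fun k _ => by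
        split_ifs with hk
        · rw [hk]
          exact (V i).card_normalMorphism_outer
        · exact card_normalMorphism_of_isEmpty (hs _) (hs _) (he (Ne.symm hk)),
        prod_ite_eq_pow_wordCount] at h
      exact Nat.eq_sub_of_add_eq h
    · rw [card_emb_nonabelian hJ hπ (fun k => hs (τ k)) (hs (Sum.inr j)) (hNa j),
        Finset.sum_congr rfl (g := fun k => if τ k = Sum.inr j then Nat.card ((N j).Equiv (N j)) else 0)
        fun k _ => by
          split_ifs with hk
          · rw [hk]
            rfl
          · have := he (Ne.symm hk)
            exact Nat.card_of_isEmpty,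
        sum_ite_eq_wordCount_mul]
      rfl

/-- The models of the extensions by the members of a system. -/
noncomputable def systemModel [Finite F] (V : Fin n → PrimeIrrep F) (N : Fin m → OuterGroup F)
    (hNs : ∀ j, (N j).IsSimple) (hNa : ∀ j, (N j).IsNonabelian) :
    ∀ i, ExtensionModel (systemGroup V N i)
  | Sum.inl i => (V i).model
  | Sum.inr j => nonabelianModel (hNs j) (hNa j)

/-! ### Levels have bounded chief factors -/

/-- The chief factors of `G` have order at most `m`. -/
def ChiefBounded (m : ℕ) (G : Type*) [Group G] : Prop :=
  ∀ A B : Subgroup G, A.Normal → B.Normal → A < B →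
    (∀ C : Subgroup G, C.Normal → A ≤ C → C ≤ B → C = A ∨ C = B) → A.relIndex B ≤ m

section Chief

variable {m : ℕ} {G H K : Type*} [Group G] [Group H] [Group K]

theorem ChiefBounded.of_surjective (h : ChiefBounded m G) {π : G →* H} (hπ : Function.Surjective π) :
    ChiefBounded m H := by
  intro A B hA hB hAB hmin
  have e : A.relIndex B = (A.comap π).relIndex (B.comap π) := by
    rw [Subgroup.relIndex_comap, Subgroup.map_comap_eq_self_of_surjective hπ]
  rw [e]
  refine h _ _ inferInstance inferInstance
    ((Subgroup.comap_lt_comap_of_surjective hπ).2 hAB) fun C hC hAC hCB => ?_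
  have hk : π.ker ≤ C := (Subgroup.ker_le_comap π A).trans hAC
  have hC' : (C.map π).comap π = C := Subgroup.comap_map_eq_self hk
  rcases hmin (C.map π) (hC.map π hπ) ((Subgroup.comap_le_comap_of_surjective hπ).1 (hAC.trans_eq hC'.symm))
    (Subgroup.map_le_iff_le_comap.2 hCB) with h' | h'
  · left
    rw [← hC', h']
  · right
    rw [← hC', h']

/-- The relative index of a covering pair is preserved by a quotient that separates it. -/
theorem ChiefBounded.relIndex_le (h : ChiefBounded m H) {π : G →* H} (hπ : Function.Surjective π)
    {A B : Subgroup G} (hA : A.Normal) (hB : B.Normal) (hAB : A < B)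
    (hmin : ∀ C : Subgroup G, C.Normal → A ≤ C → C ≤ B → C = A ∨ C = B)
    (hsep : ¬ B ≤ A ⊔ π.ker) : A.relIndex B ≤ m := by
  have hinf : (A ⊔ π.ker) ⊓ B = A := by
    rcases hmin ((A ⊔ π.ker) ⊓ B) inferInstance (le_inf le_sup_left hAB.le) inf_le_right with h' | h'
    · exact h'
    · exact absurd (inf_eq_right.1 h') hsep
  have e : A.relIndex B = (A.map π).relIndex (B.map π) := by
    rw [Subgroup.relIndex_map_map]
    have : B ⊔ π.ker = (A ⊔ π.ker) ⊔ B := by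
      rw [sup_right_comm, sup_eq_right.2 hAB.le]
    rw [this, Subgroup.relIndex_sup_left, ← Subgroup.inf_relIndex_right (A ⊔ π.ker) B, hinf]
  rw [e]
  refine h _ _ (hA.map π hπ) (hB.map π hπ) (lt_of_le_of_ne (Subgroup.map_mono hAB.le) fun h' => ?_)
    fun C hC hAC hCB => ?_
  · apply hsep
    rw [← Subgroup.comap_map_eq, h']
    exact Subgroup.le_comap_map π B
  · have hmap : (C.comap π ⊓ B).map π = C := by
      refine le_antisymm ((Subgroup.map_mono inf_le_left).trans (Subgroup.map_comap_le π C)) ?_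
      intro c hc
      obtain ⟨b, hb, rfl⟩ := hCB hc
      exact ⟨b, ⟨hc, hb⟩, rfl⟩
    rcases hmin (C.comap π ⊓ B) inferInstance (le_inf (Subgroup.map_le_iff_le_comap.1 hAC) hAB.le)
      inf_le_right with h' | h'
    · left
      rw [← hmap, h']
    · right
      rw [← hmap, h']

/-- A chief factor `B / A` not visible in `H` satisfies `B ≤ A ⊔ ker π`, hence is isomorphic to
`(ker π ⊓ B) / (ker π ⊓ A)`. This is again a chief factor, and `ρ` separates it since `ker π` and
`ker ρ` meet trivially. -/
theorem ChiefBounded.of_ker_inf (hH : ChiefBounded m H) (hK : ChiefBounded m K) {π : G →* H}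
    {ρ : G →* K} (hπ : Function.Surjective π) (hρ : Function.Surjective ρ)
    (hker : π.ker ⊓ ρ.ker = ⊥) : ChiefBounded m G := by
  intro A B hA hB hAB hmin
  by_cases hsep : B ≤ A ⊔ π.ker
  swap
  · exact hH.relIndex_le hπ hA hB hAB hmin hsep
  have hsup : A ⊔ (π.ker ⊓ B) = B := by
    refine le_antisymm (sup_le hAB.le inf_le_right) fun b hb => ?_
    obtain ⟨a, ha, k, hk, rfl⟩ := Subgroup.mem_sup_of_normal_right.1 (hsep hb)
    refine Subgroup.mul_mem_sup ha ⟨hk, ?_⟩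
    have := mul_mem (inv_mem (hAB.le ha)) hb
    rwa [inv_mul_cancel_left] at this
  have hAinf : A ⊓ (π.ker ⊓ B) = π.ker ⊓ A := by
    rw [inf_left_comm, inf_eq_left.2 hAB.le]
  have e : A.relIndex B = (π.ker ⊓ A).relIndex (π.ker ⊓ B) := by
    conv_lhs => rw [← hsup]
    rw [Subgroup.relIndex_sup_left, ← Subgroup.inf_relIndex_right, hAinf]
  rw [e]
  have hle : π.ker ⊓ A ≤ π.ker ⊓ B := inf_le_inf_left _ hAB.le
  have hnot : ¬ π.ker ⊓ B ≤ A := fun h => hAB.ne (by rw [← hsup, sup_eq_left.2 h])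
  refine hK.relIndex_le hρ inferInstance inferInstance
    (lt_of_le_not_ge hle fun h => hnot (h.trans inf_le_right)) (fun C hC hAC hCB => ?_) ?_
  · rcases hmin (A ⊔ C) inferInstance le_sup_left (sup_le hAB.le (hCB.trans inf_le_right)) with h | h
    · left
      exact le_antisymm (le_inf (hCB.trans inf_le_left) (h ▸ le_sup_right)) hAC
    · right
      refine le_antisymm hCB fun x hx => ?_
      have hx' : x ∈ A ⊔ C := by rw [h]; exact hx.2
      obtain ⟨a, ha, c, hc, rfl⟩ := Subgroup.mem_sup_of_normal_right.1 hx'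
      have : a ∈ π.ker ⊓ A := by
        refine ⟨?_, ha⟩
        have := mul_mem (Subgroup.mem_inf.1 hx).1 (inv_mem (Subgroup.mem_inf.1 (hCB hc)).1)
        rwa [mul_inv_cancel_right] at this
      exact mul_mem (hAC this) hc
  · intro h
    apply hnot
    intro x hx
    obtain ⟨a, ha, c, hc, rfl⟩ := Subgroup.mem_sup_of_normal_right.1 (h hx)
    have h1 : c ∈ π.ker ⊓ ρ.ker := by
      refine ⟨?_, hc⟩
      have := mul_mem (inv_mem (Subgroup.mem_inf.1 ha).1) (Subgroup.mem_inf.1 hx).1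
      rwa [inv_mul_cancel_left] at this
    rw [hker, Subgroup.mem_bot] at h1
    rw [h1, mul_one]
    exact ha.2

theorem chiefBounded_of_card_le [Finite G] (h : Nat.card G ≤ m) : ChiefBounded m G :=
  fun A B _ _ _ _ => (Nat.le_of_dvd Nat.card_pos ((Subgroup.relIndex_dvd_card A B).trans
    (Subgroup.card_subgroup_dvd_card B))).trans h

end Chief

/-! ### Levels -/

theorem IsLevel.downwardClosed {L : Set FinGrpClass} (h : IsLevel L) : DownwardClosed L := by
  obtain ⟨B, -, rfl⟩ := h
  intro G H _ _ _ _ π hπ hG L' hL'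
  exact hL'.1 G H π hπ (hG L' hL')

theorem IsLevel.joinClosed {L : Set FinGrpClass} (h : IsLevel L) : JoinClosed L := by
  obtain ⟨B, -, rfl⟩ := h
  intro G H F _ _ _ _ _ _ π ρ hπ hρ hH hF L' hL'
  exact hL'.2.1 G H F π ρ hπ hρ (hH L' hL') (hF L' hL')

theorem FinGrpClass.IsMinimal.subsingleton {c : FinGrpClass} (h : c.IsMinimal) :
    Subsingleton c.rep := by
  have : Subsingleton (QuotientLattice c.rep) := h
  have h1 := this.elim (OrderDual.toDual ⟨⊥, Subgroup.normal_bot⟩)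
    (OrderDual.toDual ⟨⊤, Subgroup.normal_top⟩)
  have h2 : (⊥ : Subgroup c.rep) = ⊤ := congrArg (fun x => (OrderDual.ofDual x).1) h1
  rw [← Subgroup.subsingleton_iff]
  exact subsingleton_of_bot_eq_top h2

/-- The chief factors of the groups in a level are bounded. -/
theorem IsLevel.exists_chiefBounded {L : Set FinGrpClass} (h : IsLevel L) :
    ∃ m : ℕ, ∀ (G : Type) [Group G] [Finite G], grpClass G ∈ L → ChiefBounded m G := by
  obtain ⟨B, hB, rfl⟩ := h
  obtain ⟨m, hm⟩ := (hB.image fun c => Nat.card c.rep).bddAbove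
  have hrep : ∀ (G : Type) [Group G] [Finite G], Nonempty ((grpClass G).rep ≃* G) := by
    intro G _ _
    exact grpClass_eq_iff.1 (grpClass_rep (grpClass G))
  -- It suffices that the groups with bounded chief factors satisfy all the closure properties
  -- defining the generated set. The maximum with `1` admits the trivial group even if there are no
  -- generators.
  let L₀ : Set FinGrpClass := {c | ChiefBounded (max m 1) c.rep}
  have hL₀ : ∀ (G : Type) [Group G] [Finite G], grpClass G ∈ L₀ ↔ ChiefBounded (max m 1) G := by
    intro G _ _
    obtain ⟨e⟩ := hrep G
    exact ⟨fun h => h.of_surjective (π := e.toMonoidHom) e.surjective,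
      fun h => h.of_surjective (π := e.symm.toMonoidHom) e.symm.surjective⟩
  refine ⟨max m 1, fun G _ _ hG => (hL₀ G).1 (hG L₀ ⟨?_, ?_, ?_, ?_⟩)⟩
  · intro G H _ _ _ _ π hπ hG
    exact (hL₀ H).2 (((hL₀ G).1 hG).of_surjective hπ)
  · intro G H F _ _ _ _ _ _ π ρ hπ hρ hH hF
    rw [hL₀] at hH hF ⊢
    refine hH.of_ker_inf hF (quotMap_surjective hπ _ inf_le_left)
      (quotMap_surjective hρ _ inf_le_right) ?_
    rw [ker_quotMap, ker_quotMap, eq_bot_iff]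
    rintro _ ⟨⟨x, hx, rfl⟩, ⟨y, hy, hxy⟩⟩
    obtain ⟨z, hz, h⟩ := (QuotientGroup.mk'_eq_mk' _).1 hxy
    refine (QuotientGroup.eq_one_iff _).2 ⟨hx, ?_⟩
    rw [← h]
    exact mul_mem hy hz.2
  · intro c hc
    have := hc.subsingleton
    exact chiefBounded_of_card_le (Finite.card_le_one_iff_subsingleton.2 this |>.trans (le_max_right _ _))
  · intro c hc
    exact chiefBounded_of_card_le ((hm ⟨c, hc, rfl⟩).trans (le_max_left _ _))

/-! ### Finiteness of the systems of representatives -/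

/-- An invariant with finitely many values that separates classes bounds the number of classes. -/
theorem exists_isRepSystem {X T : Type*} [Finite T] {r : X → X → Prop} (hr : Equivalence r)
    (P : X → Prop) (f : {x // P x} → T) (hf : ∀ x y, f x = f y → r x.1 y.1) :
    ∃ (n : ℕ) (g : Fin n → X), IsRepSystem r P g := by
  let s : Setoid {x // P x} := ⟨fun x y => r x.1 y.1, fun _ => hr.refl _, hr.symm, hr.trans⟩
  have : Finite (Quotient s) := by
    refine Finite.of_injective (fun c : Quotient s => f c.out) fun a b h => ?_
    rw [← Quotient.out_eq a, ← Quotient.out_eq b]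
    exact Quotient.sound (hf _ _ h)
  let e := Finite.equivFin (Quotient s)
  refine ⟨_, fun i => (e.symm i).out.1, fun i => (e.symm i).out.2, fun i j h => ?_, fun x hx => ?_⟩
  · apply e.symm.injective
    rw [← Quotient.out_eq (e.symm i), ← Quotient.out_eq (e.symm j)]
    exact Quotient.sound (s := s) h
  · refine ⟨e (Quotient.mk s ⟨x, hx⟩), ?_⟩
    change r x (e.symm (e (Quotient.mk s ⟨x, hx⟩))).out.1
    rw [Equiv.symm_apply_apply]
    exact hr.symm (Quotient.mk_out (s := s) ⟨x, hx⟩)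

namespace OuterGroup

variable {F : Type} [Group F]

theorem Equiv.trans' {A B C : OuterGroup F} (e : A.Equiv B) (e' : B.Equiv C) : Nonempty (A.Equiv C) :=
  ⟨⟨e.1.trans e'.1, e'.2.1.comp e.2.1, e.2.2.comp e'.2.2⟩⟩

theorem equivalence_equiv : Equivalence fun A B : OuterGroup F => Nonempty (A.Equiv B) :=
  ⟨fun A => ⟨Equiv.refl A⟩, fun ⟨e⟩ => ⟨Equiv.symm e⟩, fun ⟨e⟩ ⟨e'⟩ => Equiv.trans' e e'⟩

/-- Outer automorphism groups of isomorphic groups are isomorphic. -/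
def outerCongr {N N' : Type*} [Group N] [Group N'] (e : N ≃* N') : OuterAut N →* OuterAut N' :=
  QuotientGroup.map _ _ (MulAut.congr e).toMonoidHom (by
    rintro _ ⟨n, rfl⟩
    refine ⟨e n, ?_⟩
    ext x
    simp [MulAut.congr])

/-- Transport of an `[F]`-group along an isomorphism of groups. -/
def transport (A : OuterGroup F) {N' : Type} [Group N'] [Finite N'] (e : A.N ≃* N') : OuterGroup F where
  N := N'
  act := (outerCongr e).comp A.act

theorem nonempty_equiv_transport (A : OuterGroup F) {N' : Type} [Group N'] [Finite N']
    (e : A.N ≃* N') : Nonempty (A.Equiv (A.transport e)) := by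
  have h : A.IsMorphism (A.transport e) e.toMonoidHom := by
    intro g σ hσ
    refine ⟨MulAut.congr e σ, ?_, fun x => ?_⟩
    · change _ = outerCongr e (A.act g)
      rw [← hσ]
      rfl
    · exact congrArg e (congrArg σ (e.symm_apply_apply x))
  exact ⟨⟨e, h, h.symm⟩⟩

instance {α : Type*} [Finite α] : Finite (Group α) :=
  Finite.of_injective (fun i : Group α => i.mul) fun i j h => Group.ext (by
    ext x y
    exact congrFun (congrFun h x) y)

instance [Finite F] (N : Type*) [Group N] [Finite N] : Finite (F →* OuterAut N) :=
  Finite.of_injective (fun f : F →* OuterAut N => (f : F → OuterAut N)) DFunLike.coe_injective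

/-- A set with `k` elements. -/
def Carrier (k : ℕ) : Type := Fin k

instance (k : ℕ) : Finite (Carrier k) := inferInstanceAs (Finite (Fin k))

/-- The structures of an `[F]`-group on sets with at most `m` elements. -/
abbrev SmallCode (F : Type) [Group F] (m : ℕ) : Type :=
  Σ k : Fin (m + 1), Σ _ : Group (Carrier k), F →* OuterAut (Carrier k)

/-- The `[F]`-group with a given structure. -/
def ofCode {m : ℕ} (t : SmallCode F m) : OuterGroup F :=
  let _ := t.2.1
  ⟨Carrier t.1, t.2.2⟩

theorem exists_equiv_ofCode {m : ℕ} (A : OuterGroup F) (h : Nat.card A.N ≤ m) :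
    ∃ t : SmallCode F m, Nonempty (A.Equiv (ofCode t)) := by
  have : ∃ _ : Group (Carrier (Nat.card A.N)), Nonempty (A.N ≃* Carrier (Nat.card A.N)) := by
    let e : Carrier (Nat.card A.N) ≃ A.N := (Finite.equivFin A.N).symm
    let g := e.group
    exact ⟨g, ⟨(Equiv.mulEquiv e).symm⟩⟩
  obtain ⟨g, ⟨e⟩⟩ := this
  exact ⟨⟨⟨Nat.card A.N, Nat.lt_succ_of_le h⟩, g, (A.transport e).act⟩,
    A.nonempty_equiv_transport e⟩

end OuterGroup

section Bound

variable {F : Type} [Group F] {m : ℕ}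

/-- The image of `S` is a minimal normal subgroup, hence a chief factor over `⊥`. -/
theorem ChiefBounded.card_le {G : Type} [Group G] (h : ChiefBounded m G) {π : G →* F}
    (hπ : Function.Surjective π) {S : OuterGroup F} (hS : S.IsSimple) {j : S.N →* G}
    (hj : IsEmb π S j) : Nat.card S.N ≤ m := by
  have := h ⊥ j.range inferInstance hj.normal (bot_lt_iff_ne_bot.2 (hj.range_ne_bot hS))
    fun C hC _ hle => hj.eq_bot_or_eq hS hπ C hle
  rw [Subgroup.relIndex_bot_left] at this
  rwa [Nat.card_congr (MonoidHom.ofInjective hj.inj).toEquiv]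

theorem fiberProductFst_surjective (S : OuterGroup F) : Function.Surjective S.fiberProductFst := fun f => by
  obtain ⟨σ, hσ⟩ := S.exists_lift f
  exact ⟨⟨(f, σ), hσ.symm⟩, rfl⟩

theorem PrimeIrrep.isEmb_inl (A : PrimeIrrep F) :
    IsEmb (SemidirectProduct.rightHom (φ := A.action)) A.outer
      (SemidirectProduct.inl : Multiplicative A.V →* A.Semidirect) where
  inj := SemidirectProduct.inl_injective
  le_ker := by
    rintro _ ⟨(v : Multiplicative A.V), rfl⟩
    exact SemidirectProduct.right_inl (φ := A.action) v
  equivariant x := ⟨A.action x.right, rfl, fun (s : Multiplicative A.V) => by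
    rw [mul_inv_eq_iff_eq_mul]
    apply SemidirectProduct.ext
    · change x.left * A.action x.right s = A.action x.right s * A.action 1 x.left
      rw [map_one, mul_comm]
      rfl
    · change x.right * 1 = 1 * x.right
      rw [mul_one, one_mul]⟩

/-- `V` is minimal normal in `V ⋊ F ∈ L`, so its order is bounded, and there are only finitely many
`[F]`-group structures on sets of bounded size. -/
theorem exists_isIrrepSystem [Finite F] {L : Set FinGrpClass} (hL : IsLevel L) :
    ∃ (n : ℕ) (V : Fin n → PrimeIrrep F), IsIrrepSystem L V := by
  obtain ⟨m, hm⟩ := hL.exists_chiefBounded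
  have hc : ∀ A : {A : PrimeIrrep F // grpClass A.Semidirect ∈ L},
      ∃ t : SmallCode F m, Nonempty (A.1.outer.Equiv (ofCode t)) := fun A =>
    A.1.outer.exists_equiv_ofCode ((hm _ A.2).card_le SemidirectProduct.rightHom_surjective
      A.1.isSimple_outer A.1.isEmb_inl)
  choose f hf using hc
  refine exists_isRepSystem ⟨fun A => ⟨AddEquiv.refl _, fun _ _ => rfl⟩, ?_, ?_⟩ _ f fun A B h => ?_
  · rintro A B ⟨e, he⟩
    refine ⟨e.symm, fun g v => ?_⟩
    rw [AddEquiv.symm_apply_eq, he, e.apply_symm_apply]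
  · rintro A B C ⟨e, he⟩ ⟨e', he'⟩
    exact ⟨e.trans e', fun g v => by rw [AddEquiv.trans_apply, he, he']; rfl⟩
  · have hB := hf B
    rw [← h] at hB
    exact A.1.iso_of_equiv_outer (equivalence_equiv.trans (hf A) (equivalence_equiv.symm hB))

theorem exists_isNonabelianSystem [Finite F] {L : Set FinGrpClass} (hL : IsLevel L) :
    ∃ (n : ℕ) (N : Fin n → OuterGroup F), IsNonabelianSystem L N := by
  obtain ⟨m, hm⟩ := hL.exists_chiefBounded
  have hc : ∀ A : {A : OuterGroup F // A.IsSimple ∧ A.IsNonabelian ∧ grpClass A.fiberProduct ∈ L},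
      ∃ t : SmallCode F m, Nonempty (A.1.Equiv (ofCode t)) := fun A =>
    A.1.exists_equiv_ofCode ((hm _ A.2.2.2).card_le (fiberProductFst_surjective A.1) A.2.1
      ((nonabelianModel A.2.1 A.2.2.1).isEmb ()))
  choose f hf using hc
  refine exists_isRepSystem equivalence_equiv _ f fun A B h => ?_
  have hB := hf B
  rw [← h] at hB
  exact equivalence_equiv.trans (hf A) (equivalence_equiv.symm hB)

end Bound

/-! ### Abelian simple `[F]`-groups are irreducible representations -/

section Abelian

variable {F : Type} [Group F] {S : OuterGroup F}

/-- For a prime `p` dividing the order, the elements killed by `p` form an invariant subgroup, which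
is nontrivial by Cauchy's theorem. -/
theorem OuterGroup.IsSimple.exists_prime_pow_eq_one (hS : S.IsSimple) (hc : ∀ a b : S.N, a * b = b * a) :
    ∃ p : ℕ, p.Prime ∧ ∀ a : S.N, a ^ p = 1 := by
  have := hS.1
  obtain ⟨p, hp, hdvd⟩ := Nat.exists_prime_and_dvd (Finite.one_lt_card (α := S.N)).ne'
  have : Fact p.Prime := ⟨hp⟩
  obtain ⟨x, hx⟩ := exists_prime_orderOf_dvd_card' p hdvd
  refine ⟨p, hp, ?_⟩
  let K : Subgroup S.N :=
    { carrier := {a | a ^ p = 1}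
      one_mem' := one_pow p
      mul_mem' := fun {a b} ha hb => by
        change (a * b) ^ p = 1
        rw [(show Commute a b from hc a b).mul_pow, ha, hb, one_mul]
      inv_mem' := fun {a} ha => by
        change a⁻¹ ^ p = 1
        rw [inv_pow, ha, inv_one] }
  have hK : K.Normal := ⟨fun a ha g => by rwa [hc g a, mul_inv_cancel_right]⟩
  rcases hS.eq_bot_or_top K (fun g => by
    obtain ⟨σ, hσ⟩ := S.exists_lift g
    refine ⟨σ, hσ, fun a (ha : a ^ p = 1) => ?_⟩
    change σ a ^ p = 1
    rw [← map_pow, ha, map_one]) with h | h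
  · have hxK : x ∈ K := by
      change x ^ p = 1
      rw [← hx, pow_orderOf_eq_one]
    rw [h, Subgroup.mem_bot] at hxK
    rw [hxK, orderOf_one] at hx
    exact absurd hx hp.one_lt.ne
  · intro a
    have : a ∈ K := by rw [h]; trivial
    exact this

/-- Lifts to automorphisms are unique in the commutative case, so the outer action is an honest
action, linear over the prime field that kills the group. -/
theorem OuterGroup.IsSimple.exists_primeIrrep (hS : S.IsSimple) (hSa : ¬ S.IsNonabelian) :
    ∃ A : PrimeIrrep F, Nonempty (A.outer.Equiv S) := by
  have hc : ∀ a b : S.N, a * b = b * a := fun a b => by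
    by_contra h
    exact hSa ⟨a, b, h⟩
  obtain ⟨p, hp, hpow⟩ := hS.exists_prime_pow_eq_one hc
  have hp' : Fact p.Prime := ⟨hp⟩
  let _ : CommGroup S.N := { S.group with mul_comm := hc }
  let _ : Module (ZMod p) (Additive S.N) := AddCommGroup.zmodModule (n := p) fun x => hpow x.toMul
  have huniq : ∀ σ σ' : MulAut S.N, toOuter S.N σ = toOuter S.N σ' → σ = σ' := by
    intro σ σ' h
    obtain ⟨n, rfl⟩ := exists_conj_of_toOuter_eq h
    ext x
    rw [MulAut.mul_apply, MulAut.conj_apply, hc n x, mul_inv_cancel_right]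
  choose σ hσ using S.exists_lift
  have hσ1 : σ 1 = 1 := huniq _ _ (by rw [hσ, map_one, map_one])
  have hσmul : ∀ g h, σ (g * h) = σ g * σ h := fun g h =>
    huniq _ _ (by rw [map_mul, hσ, hσ, hσ, map_mul])
  let ρ : Representation (ZMod p) F (Additive S.N) :=
    { toFun := fun g => (MonoidHom.toAdditive (σ g).toMonoidHom).toZModLinearMap p
      map_one' := by
        ext x
        change Additive.ofMul (σ 1 x.toMul) = x
        rw [hσ1]
        rfl
      map_mul' := fun g h => by
        ext x
        change Additive.ofMul (σ (g * h) x.toMul) = Additive.ofMul (σ g (σ h x.toMul))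
        rw [hσmul]
        rfl }
  have hρ : ∀ g (x : S.N), ρ g (Additive.ofMul x) = Additive.ofMul (σ g x) := fun _ _ => rfl
  have hirr : ρ.IsIrreducible := by
    refine { exists_pair_ne := ⟨⊥, ⊤, fun h => ?_⟩, eq_bot_or_eq_top := fun W => ?_ }
    · obtain ⟨a, ha⟩ := @exists_ne _ hS.1 1
      have : Additive.ofMul a ∈ (⊥ : Subrepresentation ρ) := by rw [h]; trivial
      exact ha this
    · let K : Subgroup S.N := AddSubgroup.toSubgroup' W.toSubmodule.toAddSubgroup
      have hmem : ∀ x : S.N, x ∈ K ↔ Additive.ofMul x ∈ W := fun _ => Iff.rfl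
      have hK : K.Normal := ⟨fun a ha g => by rwa [hc g a, mul_inv_cancel_right]⟩
      rcases hS.eq_bot_or_top K (fun g => ⟨σ g, hσ g, fun x hx =>
        W.apply_mem_toSubmodule g hx⟩) with h | h
      · left
        ext x
        have := hmem x.toMul
        rw [h] at this
        exact this.symm
      · right
        ext x
        have := hmem x.toMul
        rw [h] at this
        exact this.symm
  let A : PrimeIrrep F :=
    { p := p
      V := Rep.of ρ
      finite := inferInstanceAs (Finite S.N)
      irreducible := hirr }
  let e : Multiplicative (Additive S.N) ≃* S.N := MulEquiv.mk' Multiplicative.toAdd fun _ _ => rfl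
  have hA : A.outer.IsMorphism S e.toMonoidHom :=
    isMorphism_of_exists fun g => ⟨A.action g, σ g, rfl, hσ g, fun x => rfl⟩
  exact ⟨A, ⟨⟨e, hA, hA.symm⟩⟩⟩

end Abelian

/-! ### Cocycles with extension in a level -/

section FiberCount

/-- The fibers of a surjective homomorphism of additive groups have the same size. -/
theorem card_preimage_addMonoidHom {M N : Type*} [AddGroup M] [AddGroup N] (f : M →+ N)
    (hf : Function.Surjective f) (W : Set N) :
    Nat.card {x // f x ∈ W} = Nat.card W * Nat.card f.ker := by
  rw [← Nat.card_prod]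
  choose s hs using hf
  refine Nat.card_congr ⟨fun x => (⟨f x, x.2⟩, ⟨x - s (f x), ?_⟩), fun y => ⟨y.2 + s y.1, ?_⟩, ?_, ?_⟩
  · rw [AddMonoidHom.mem_ker, map_sub, hs, sub_self]
  · rw [map_add, y.2.2, zero_add, hs]
    exact y.1.2
  · intro x
    exact Subtype.ext (sub_add_cancel _ _)
  · rintro ⟨⟨w, hw⟩, ⟨k, hk⟩⟩
    have hk' : f k = 0 := hk
    have e : f (k + s w) = w := by rw [map_add, hk', zero_add, hs]
    refine Prod.ext (Subtype.ext e) (Subtype.ext ?_)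
    change k + s w - s (f (k + s w)) = k
    rw [e, add_sub_cancel_right]

theorem card_eq_card_range_mul_card_ker {M N : Type*} [AddGroup M] [AddGroup N] (f : M →+ N) :
    Nat.card M = Nat.card f.range * Nat.card f.ker := by
  rw [← AddSubgroup.index_ker, mul_comm, AddSubgroup.card_mul_index]

end FiberCount

namespace PrimeIrrep

variable {F : Type} [Group F] (A : PrimeIrrep F)

instance [Finite F] : Finite (groupCohomology.cocycles₁ A.V) :=
  Finite.of_injective (fun c : groupCohomology.cocycles₁ A.V => (c.1 : F → A.V))
    Subtype.val_injective

theorem card_cocycles₁ [Finite F] :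
    Nat.card (groupCohomology.coboundaries₂ A.V) * Nat.card (groupCohomology.cocycles₁ A.V) =
      Nat.card A.V ^ Nat.card F := by
  have h := card_eq_card_range_mul_card_ker (groupCohomology.d₁₂ A.V).hom.toAddMonoidHom
  exact (h.symm.trans (Nat.card_fun (α := F) (β := A.V)))

theorem card_coboundaries₁ :
    Nat.card (groupCohomology.coboundaries₁ A.V) * Nat.card (groupCohomology.H0 A.V) =
      Nat.card A.V := by
  have h := card_eq_card_range_mul_card_ker (groupCohomology.d₀₁ A.V).hom.toAddMonoidHom
  rw [Nat.card_congr (groupCohomology.H0Iso A.V).toLinearEquiv.toEquiv]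
  have e : Nat.card (A.V.ρ.invariants) =
      Nat.card (groupCohomology.d₀₁ A.V).hom.toAddMonoidHom.ker := by
    rw [← groupCohomology.d₀₁_ker_eq_invariants]
    rfl
  change _ * Nat.card (A.V.ρ.invariants) = _
  rw [e]
  exact h.symm

theorem card_H1_mul : Nat.card (groupCohomology.H1 A.V) * Nat.card (groupCohomology.coboundaries₁ A.V) =
    Nat.card (groupCohomology.cocycles₁ A.V) := by
  have hs : Function.Surjective (groupCohomology.H1π A.V) :=
    (ModuleCat.epi_iff_surjective _).1 inferInstance
  have h := card_preimage_addMonoidHom (groupCohomology.H1π A.V).hom.toAddMonoidHom hs Set.univ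
  rw [Nat.card_univ] at h
  have e : Nat.card (groupCohomology.H1π A.V).hom.toAddMonoidHom.ker =
      Nat.card (groupCohomology.coboundaries₁ A.V) := by
    refine Nat.card_congr ⟨fun x => ⟨x.1.1, (groupCohomology.H1π_eq_zero_iff x.1).1 x.2⟩, fun y =>
      ⟨⟨y.1, groupCohomology.coboundaries₁_le_cocycles₁ A.V y.2⟩,
        (groupCohomology.H1π_eq_zero_iff _).2 y.2⟩, fun _ => rfl, fun _ => rfl⟩
  rw [← e, ← h]
  exact Nat.card_congr (Equiv.subtypeUnivEquiv fun _ => trivial)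

variable {A}

/-- Cohomologous cocycles have isomorphic extensions. -/
theorem nonempty_mulEquiv_extension {c c' : groupCohomology.cocycles₂ A.V}
    (h : (⇑c - ⇑c' : F × F → A.V) ∈ groupCohomology.coboundaries₂ A.V) :
    Nonempty (CocycleExtension c ≃* CocycleExtension c') := by
  obtain ⟨η, hη⟩ := h
  have hη' : ∀ g k, A.V.ρ g (η k) - η (g * k) + η g = c (g, k) - c' (g, k) := fun g k =>
    congrFun hη (g, k)
  refine ⟨MulEquiv.mk' ⟨fun x => ⟨x.fst + η x.snd, x.snd⟩, fun x => ⟨x.fst - η x.snd, x.snd⟩,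
    fun x => CocycleExtension.ext (add_sub_cancel_right _ _) rfl,
    fun x => CocycleExtension.ext (sub_add_cancel _ _) rfl⟩ fun x y => ?_⟩
  apply CocycleExtension.ext
  · change x.fst + A.V.ρ x.snd y.fst + c (x.snd, y.snd) + η (x.snd * y.snd) =
      x.fst + η x.snd + A.V.ρ x.snd (y.fst + η y.snd) + c' (x.snd, y.snd)
    have := hη' x.snd y.snd
    rw [map_add]
    have e : c (x.snd, y.snd) = A.V.ρ x.snd (η y.snd) - η (x.snd * y.snd) + η x.snd +
      c' (x.snd, y.snd) := by rw [this, sub_add_cancel]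
    rw [e]
    abel
  · rfl

/-- Membership of the extension in `L` depends only on the cohomology class, so the set of cocycles
is a union of cosets of the coboundaries. -/
theorem card_admissible_cocycles {L : Set FinGrpClass} (hD : DownwardClosed L) [Finite F] :
    Nat.card {c : groupCohomology.cocycles₂ A.V // grpClass (CocycleExtension c) ∈ L} =
      Nat.card (admissibleClasses L A) * Nat.card (groupCohomology.coboundaries₂ A.V) := by
  have hs : Function.Surjective (groupCohomology.H2π A.V) :=
    (ModuleCat.epi_iff_surjective _).1 inferInstance
  have h := card_preimage_addMonoidHom (groupCohomology.H2π A.V).hom.toAddMonoidHom hs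
    (admissibleClasses L A)
  have e : Nat.card (groupCohomology.H2π A.V).hom.toAddMonoidHom.ker =
      Nat.card (groupCohomology.coboundaries₂ A.V) := by
    refine Nat.card_congr ⟨fun x => ⟨x.1.1, (groupCohomology.H2π_eq_zero_iff x.1).1 x.2⟩, fun y =>
      ⟨⟨y.1, groupCohomology.coboundaries₂_le_cocycles₂ A.V y.2⟩,
        (groupCohomology.H2π_eq_zero_iff _).2 y.2⟩, fun _ => rfl, fun _ => rfl⟩
  rw [← e, ← h]
  refine Nat.card_congr (Equiv.subtypeEquivRight fun c => ⟨fun hc => ⟨c, rfl, hc⟩, ?_⟩)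
  rintro ⟨c', hc', hL⟩
  obtain ⟨i⟩ := nonempty_mulEquiv_extension ((groupCohomology.H2π_eq_iff c' c).1 hc')
  exact hD.mem_of_equiv i hL

variable (A) in
/-- The number in the product formula is the mass of the model times `|V|^{-u}`. -/
theorem irrepRatio_eq {L : Set FinGrpClass} (hD : DownwardClosed L) [Finite F] (u : ℝ) :
    irrepRatio L u A = SimpleSystem.mass A.model L * (Nat.card A.V : ℝ) ^ (-u) := by
  have h1 := A.card_cocycles₁
  have h2 := A.card_coboundaries₁
  have h3 := A.card_H1_mul
  have h4 := card_admissible_cocycles (A := A) hD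
  have hV : 0 < Nat.card A.V := Nat.card_pos
  have hZ : 0 < Nat.card (groupCohomology.cocycles₁ A.V) := Nat.card_pos
  rw [← h2] at hV
  rw [← h3] at hZ
  have hV' := A.card_coboundaries₁ ▸ hV
  have hH0 : 0 < Nat.card (groupCohomology.H0 A.V) := Nat.pos_of_mul_pos_left hV
  have hH1 : 0 < Nat.card (groupCohomology.H1 A.V) := Nat.pos_of_mul_pos_right hZ
  unfold irrepRatio SimpleSystem.mass
  change _ = ((Nat.card {c : groupCohomology.cocycles₂ A.V // grpClass (CocycleExtension c) ∈ L} : ℝ) /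
    ((Nat.card A.V ^ Nat.card F : ℕ) : ℝ)) * _
  -- The mass is `|W| |B²| / |V|^|F|`. With `|V|^|F| = |B²| |Z¹|`, `|Z¹| = |H¹| |B¹|` and `|V| =
  -- |B¹| |H⁰|` it becomes `|W| |H⁰| / (|V| |H¹|)`.
  rw [h4, Real.rpow_add_one (by positivity), Real.rpow_neg (by positivity), ← h1, ← h3]
  have hb2 : 0 < Nat.card (groupCohomology.coboundaries₂ A.V) := by
    have : 0 < Nat.card A.V ^ Nat.card F := pow_pos hV' _
    rw [← h1] at this
    exact Nat.pos_of_mul_pos_right this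
  have hb1 : 0 < Nat.card (groupCohomology.coboundaries₁ A.V) := Nat.pos_of_mul_pos_right hV
  have hr : (0 : ℝ) < (Nat.card A.V : ℝ) ^ u := Real.rpow_pos_of_pos (by exact_mod_cast hV') u
  have h2' : (Nat.card A.V : ℝ) = Nat.card (groupCohomology.coboundaries₁ A.V) *
    Nat.card (groupCohomology.H0 A.V) := by exact_mod_cast h2.symm
  generalize (Nat.card A.V : ℝ) ^ u = r at *
  rw [h2']
  push_cast
  field_simp

/-! ### The action of the endomorphism field -/

/-- Linear combinations of extensions in a level. -/
theorem mem_extension_of_linear [Finite F] {L : Set FinGrpClass} (hD : DownwardClosed L)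
    (hJ : JoinClosed L) {c c' c'' : groupCohomology.cocycles₂ A.V}
    {a b : A.V.ρ.IntertwiningMap A.V.ρ} (ha : Function.Surjective a)
    (h : ∀ x, c'' x = a (c x) + b (c' x)) (hc : grpClass (CocycleExtension c) ∈ L)
    (hc' : grpClass (CocycleExtension c') ∈ L) : grpClass (CocycleExtension c'') ∈ L := by
  -- The fibre product of the two extensions is their join. It maps to the third extension by `(v,
  -- w) ↦ a v + b w` on the kernels, onto because `a` is onto.
  let P : Subgroup (CocycleExtension c × CocycleExtension c') :=
    ((extensionSnd c).comp (MonoidHom.fst _ _)).eqLocus ((extensionSnd c').comp (MonoidHom.snd _ _))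
  have hP : ∀ x : P, x.1.1.snd = x.1.2.snd := fun x => x.2
  let θ : P →* CocycleExtension c'' := MonoidHom.mk'
    (fun x => ⟨a x.1.1.fst + b x.1.2.fst, x.1.1.snd⟩) fun x y => by
      apply CocycleExtension.ext
      · change a (x.1.1.fst + A.V.ρ x.1.1.snd y.1.1.fst + c (x.1.1.snd, y.1.1.snd)) +
          b (x.1.2.fst + A.V.ρ x.1.2.snd y.1.2.fst + c' (x.1.2.snd, y.1.2.snd)) =
          a x.1.1.fst + b x.1.2.fst + A.V.ρ x.1.1.snd (a y.1.1.fst + b y.1.2.fst) +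
            c'' (x.1.1.snd, y.1.1.snd)
        rw [← hP x, ← hP y, h, map_add, map_add, map_add, map_add, map_add, a.isIntertwining,
          b.isIntertwining]
        abel
      · rfl
  refine mem_of_ker_inf_le hD hJ (G := P) (π := (MonoidHom.fst _ _).comp P.subtype)
    (ρ := (MonoidHom.snd _ _).comp P.subtype) (θ := θ) ?_ ?_ ?_ hc hc' ?_
  · exact fun x => ⟨⟨(x, ⟨0, x.snd⟩), rfl⟩, rfl⟩
  · exact fun y => ⟨⟨(⟨0, y.snd⟩, y), rfl⟩, rfl⟩
  · intro z
    obtain ⟨v, hv⟩ := ha z.fst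
    refine ⟨⟨(⟨v, z.snd⟩, ⟨0, z.snd⟩), rfl⟩, ?_⟩
    apply CocycleExtension.ext
    · change a v + b 0 = z.fst
      rw [map_zero, add_zero, hv]
    · rfl
  · rintro x ⟨h1, h2⟩
    have : x = 1 := Subtype.ext (Prod.ext h1 h2)
    rw [this]
    exact one_mem _

/-- The zero cocycle is `c - c`: if some extension by `V` is in `L`, so is the split one. -/
theorem mem_extension_zero [Finite F] {L : Set FinGrpClass} (hD : DownwardClosed L)
    (hJ : JoinClosed L) {c : groupCohomology.cocycles₂ A.V}
    (hc : grpClass (CocycleExtension c) ∈ L) :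
    grpClass (CocycleExtension (0 : groupCohomology.cocycles₂ A.V)) ∈ L :=
  mem_extension_of_linear hD hJ (a := 1) (b := -1) Function.surjective_id
    (fun _ => (add_neg_cancel _).symm) hc hc

theorem nonempty_semidirect_mulEquiv :
    Nonempty (A.Semidirect ≃* CocycleExtension (0 : groupCohomology.cocycles₂ A.V)) := by
  refine ⟨MulEquiv.mk' ⟨fun x => ⟨x.left.toAdd, x.right⟩, fun x => ⟨Multiplicative.ofAdd x.fst, x.snd⟩,
    fun _ => rfl, fun _ => rfl⟩ fun x y => ?_⟩
  apply CocycleExtension.ext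
  · exact (add_zero _).symm
  · rfl

variable (A)

/-- The cocycles with extension in a level, as a subspace over the endomorphism field. -/
theorem exists_card_eq_q_pow [Finite F] {L : Set FinGrpClass} (hD : DownwardClosed L)
    (hJ : JoinClosed L) (hA : grpClass A.Semidirect ∈ L) :
    (∃ k, Nat.card A.V = A.q ^ k) ∧
      ∃ k, Nat.card {c : groupCohomology.cocycles₂ A.V // grpClass (CocycleExtension c) ∈ L} =
        A.q ^ k := by
  classical
  have hirr := A.irreducible
  let D := Module.End (MonoidAlgebra (ZMod A.p) F) A.V.ρ.asModule
  let _ : DivisionRing D := inferInstance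
  let e : A.V.ρ.IntertwiningMap A.V.ρ ≃ D :=
    (Representation.IntertwiningMap.equivAlgEnd (ρ := A.V.ρ)).toEquiv
  have hq : Nat.card D = A.q := (Nat.card_congr e).symm
  have hfin : Finite A.V.ρ.asModule := inferInstanceAs (Finite A.V)
  have h0 : grpClass (CocycleExtension (0 : groupCohomology.cocycles₂ A.V)) ∈ L := by
    obtain ⟨i⟩ := A.nonempty_semidirect_mulEquiv
    exact hD.mem_of_equiv i hA
  have hmem : ∀ (a : A.V.ρ.IntertwiningMap A.V.ρ) (c : groupCohomology.cocycles₂ A.V),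
      (fun x => a (c x)) ∈ groupCohomology.cocycles₂ A.V := by
    intro a c
    refine (groupCohomology.mem_cocycles₂_iff _).2 fun g k l => ?_
    have := (groupCohomology.mem_cocycles₂_iff (c : F × F → A.V)).1 c.2 g k l
    change a (c (g * k, l)) + a (c (g, k)) = A.V.ρ g (a (c (k, l))) + a (c (g, k * l))
    rw [← a.isIntertwining]
    exact (map_add a _ _).symm.trans ((congrArg a this).trans (map_add a _ _))
  let Z : Submodule D (F × F → A.V.ρ.asModule) :=
    { carrier := {f | ∃ c : groupCohomology.cocycles₂ A.V, grpClass (CocycleExtension c) ∈ L ∧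
        ∀ x, f x = c x}
      zero_mem' := ⟨0, h0, fun _ => rfl⟩
      add_mem' := by
        rintro f f' ⟨c, hc, hf⟩ ⟨c', hc', hf'⟩
        refine ⟨c + c', mem_extension_of_linear hD hJ (a := 1) (b := 1) Function.surjective_id
          (fun _ => rfl) hc hc', fun x => ?_⟩
        rw [Pi.add_apply, hf, hf']
        rfl
      smul_mem' := by
        rintro d f ⟨c, hc, hf⟩
        obtain ⟨a, rfl⟩ := e.surjective d
        refine ⟨⟨_, hmem a c⟩, ?_, fun x => ?_⟩
        -- By Schur's lemma a nonzero endomorphism is onto, as needed for linear combinations; the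
        -- zero endomorphism leads to the split extension.
        · rcases Representation.IsIrreducible.bijective_or_eq_zero a with ha | rfl
          · exact mem_extension_of_linear hD hJ (a := a) (b := 0) ha.2
              (fun x => (add_zero _).symm) hc hc
          · exact h0
        · rw [Pi.smul_apply, hf]
          rfl }
  refine ⟨⟨Module.finrank D A.V.ρ.asModule, ?_⟩, ⟨Module.finrank D Z, ?_⟩⟩
  · rw [← hq]
    exact Module.natCard_eq_pow_finrank (K := D) (V := A.V.ρ.asModule)
  · rw [← hq, ← Module.natCard_eq_pow_finrank (K := D) (V := Z)]
    refine Nat.card_congr (Equiv.ofBijective (fun c => ⟨fun x => c.1 x, c.1, c.2, fun _ => rfl⟩)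
      ⟨fun c c' h => ?_, ?_⟩)
    · exact Subtype.ext (Subtype.ext (congrArg (fun z : Z => (z.1 : F × F → A.V)) h))
    · rintro ⟨f, c, hc, hf⟩
      exact ⟨⟨c, hc⟩, Subtype.ext (funext fun x => (hf x).symm)⟩

end PrimeIrrep

/-! ### Every relevant kernel is made of members of the system -/

section Complete

variable {F : Type} [Group F] {G : Type} [Group G] {π : G →* F}

/-- Take `B` maximal among the normal subgroups of the kernel that miss `M`. If `M ⊔ B` were not the
kernel, a minimal normal subgroup outside it could be joined to `B` without meeting `M`. -/
theorem exists_normal_complement [Finite G] (hμ : muHom π ≠ 0) {M : Subgroup G}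
    (hM : IsMinimalNormal M) (hle : M ≤ π.ker) :
    ∃ B : Subgroup G, B.Normal ∧ M ⊓ B = ⊥ ∧ M ⊔ B = π.ker := by
  have hMn := hM.normal
  obtain ⟨B, hB⟩ := (Set.toFinite {B : Subgroup G | B.Normal ∧ B ≤ π.ker ∧ M ⊓ B = ⊥}).exists_maximal
    ⟨⊥, inferInstance, bot_le, inf_bot_eq M⟩
  obtain ⟨⟨hBn, hBk, hBM⟩, hmax⟩ := hB
  refine ⟨B, hBn, hBM, ?_⟩
  by_contra hne
  obtain ⟨M', hM'k, hM', hnot⟩ := exists_isMinimalNormal_not_le hμ (M ⊔ B) inferInstance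
    (lt_of_le_of_ne (sup_le hle hBk) hne)
  have hM'n := hM'.normal
  have hinf : M' ⊓ (M ⊔ B) = ⊥ :=
    (hM'.minimal _ inferInstance inf_le_left).resolve_right fun h => hnot (inf_eq_left.1 h)
  have hMB : M ⊓ (B ⊔ M') = ⊥ := by
    rw [eq_bot_iff]
    rintro x ⟨hx, hx'⟩
    obtain ⟨b, hb, m', hm', rfl⟩ := Subgroup.mem_sup_of_normal_right.1 hx'
    have h1 : m' ∈ M' ⊓ (M ⊔ B) := by
      refine ⟨hm', ?_⟩
      have := mul_mem (inv_mem ((le_sup_right : B ≤ M ⊔ B) hb)) ((le_sup_left : M ≤ M ⊔ B) hx)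
      rwa [inv_mul_cancel_left] at this
    rw [hinf, Subgroup.mem_bot] at h1
    subst h1
    rw [mul_one] at hx ⊢
    rw [← hBM]
    exact ⟨hx, hb⟩
  have h2 : B ⊔ M' ≤ B := hmax ⟨inferInstance, sup_le hBk hM'k, hMB⟩ le_sup_left
  exact hnot ((le_sup_right.trans h2).trans le_sup_right)

/-- A homomorphism to an extension that restricts to the identity of `S` is surjective. -/
theorem surjective_of_comp_eq {S : OuterGroup F} {E : Type} [Group E] {p : E →* F} {can : S.N →* E}
    (hcan : can.range = p.ker) (hπ : Function.Surjective π) {ψ : G →* E} {j : S.N →* G}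
    (h1 : p.comp ψ = π) (h2 : ψ.comp j = can) : Function.Surjective ψ := by
  intro e
  obtain ⟨x, hx⟩ := hπ (p e)
  have hk : e * (ψ x)⁻¹ ∈ can.range := by
    rw [hcan, MonoidHom.mem_ker, map_mul, map_inv, ← hx, ← h1]
    exact mul_inv_cancel _
  obtain ⟨s, hs⟩ := hk
  refine ⟨j s * x, ?_⟩
  rw [map_mul]
  have : ψ (j s) = can s := DFunLike.congr_fun h2 s
  rw [this, hs, inv_mul_cancel_right]

theorem OuterGroup.IsSimple.grpClass_fiberProduct_mem [Finite F] [Finite G] {L : Set FinGrpClass}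
    (hD : DownwardClosed L) (hG : grpClass G ∈ L) (hπ : Function.Surjective π) {S : OuterGroup F}
    (hS : S.IsSimple) (hn : S.IsNonabelian) {j : S.N →* G} (hj : IsEmb π S j) :
    grpClass S.fiberProduct ∈ L := by
  obtain ⟨ψ, hψ, hc⟩ := hj.exists_toFiberProduct
  have hr : S.toFiberProduct.range = S.fiberProductFst.ker := (nonabelianModel hS hn).range_can ()
  refine hD G _ ψ (surjective_of_comp_eq hr hπ hψ (j := j) ?_) hG
  ext1 s
  refine fiberProduct_ext ?_ ?_
  · exact (DFunLike.congr_fun hψ (j s)).trans (hj.le_ker ⟨s, rfl⟩)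
  · ext t
    apply hj.inj
    have := hc (j s) t
    rw [← map_mul, ← map_inv, ← map_mul] at this
    exact this.symm

/-- Since `y > 0`, some extension of `F` by `V` receives a surjection from `G` and so is in `L`;
then the split extension is in `L` as well. -/
theorem PrimeIrrep.grpClass_semidirect_mem [Finite F] [Finite G] {L : Set FinGrpClass}
    (hD : DownwardClosed L) (hJ : JoinClosed L) (hG : grpClass G ∈ L) (hπ : Function.Surjective π)
    (A : PrimeIrrep F) {j : A.outer.N →* G} (hj : IsEmb π A.outer j) {B : Subgroup G} (hB : B.Normal)
    (hjB : j.range ⊓ B = ⊥) (hK : j.range ⊔ B = π.ker) : grpClass A.Semidirect ∈ L := by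
  have h := A.model.card_hom hπ j hj B hB hjB hK
  have hpos : 0 < A.model.y := A.model.y_pos
  rw [← h] at hpos
  obtain ⟨⟨⟨c, ψ⟩, h1, h2, -⟩⟩ := (Nat.card_pos_iff.1 hpos).1
  have hc : grpClass (A.model.E c) ∈ L :=
    hD G _ ψ (surjective_of_comp_eq (A.model.range_can c) hπ h1 h2) hG
  obtain ⟨i⟩ := A.nonempty_semidirect_mulEquiv
  exact hD.mem_of_equiv i.symm (mem_extension_zero hD hJ (c := c) hc)

/-- Completeness of the systems: a simple factor of a relevant kernel satisfies the membership
condition in its system, because `G` itself surjects onto a suitable extension of `F` by it. -/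
theorem exists_isEmb_systemGroup [Finite F] [Finite G] {L : Set FinGrpClass} (hD : DownwardClosed L)
    (hJ : JoinClosed L) {n m : ℕ} {V : Fin n → PrimeIrrep F} {N : Fin m → OuterGroup F}
    (hV : IsIrrepSystem L V) (hN : IsNonabelianSystem L N) (hG : grpClass G ∈ L)
    (hπ : Function.Surjective π) (hμ : muHom π ≠ 0) {M : Subgroup G} (hM : IsMinimalNormal M)
    (hle : M ≤ π.ker) :
    ∃ i, ∃ j : (systemGroup V N i).N →* G, IsEmb π (systemGroup V N i) j ∧ j.range = M := by
  obtain ⟨S, j, hS, hj, rfl⟩ :=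
    exists_isEmb_of_isMinimalNormal hπ hM hle (ker_le_sup_centralizer hμ hM)
  by_cases hSn : S.IsNonabelian
  · obtain ⟨i, ⟨e⟩⟩ := hN.2.2 S ⟨hS, hSn, hS.grpClass_fiberProduct_mem hD hG hπ hSn hj⟩
    exact ⟨Sum.inr i, _, hj.comp_equiv e.symm⟩
  · obtain ⟨A, ⟨e⟩⟩ := hS.exists_primeIrrep hSn
    obtain ⟨hj', hr⟩ := hj.comp_equiv e
    obtain ⟨B, hB, hBM, hBK⟩ := exists_normal_complement hμ hM hle
    rw [← hr] at hBM hBK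
    obtain ⟨i, e', he'⟩ := hV.2.2 A
      (A.grpClass_semidirect_mem hD hJ hG hπ hj' hB hBM hBK)
    have hm : A.outer.IsMorphism (V i).outer (AddEquiv.toMultiplicative e').toMonoidHom :=
      (A.isMorphism_outer_iff _).2 fun g v => he' g v.toAdd
    let e'' : A.outer.Equiv (V i).outer := ⟨AddEquiv.toMultiplicative e', hm, hm.symm⟩
    obtain ⟨hj'', hr'⟩ := hj'.comp_equiv e''.symm
    exact ⟨Sum.inl i, _, hj'', hr'.trans hr⟩

end Complete

/-! ### The identity of Euler and the factors of the product formula -/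

section Euler

open Filter Topology

/-- The product of the `q^k - 1` for `1 ≤ k ≤ t`. -/
noncomputable def eulerDenom (q : ℕ) (t : ℕ) : ℝ := ∏ k ∈ Finset.range t, ((q : ℝ) ^ (k + 1) - 1)

theorem eulerDenom_succ (q t : ℕ) :
    eulerDenom q (t + 1) = eulerDenom q t * ((q : ℝ) ^ (t + 1) - 1) := Finset.prod_range_succ _ _

theorem succ_le_pow_sub_one {q : ℕ} (hq : 1 < q) (k : ℕ) : ((k + 1 : ℕ) : ℝ) ≤ (q : ℝ) ^ (k + 1) - 1 := by
  have h : k + 1 + 1 ≤ q ^ (k + 1) := Nat.lt_pow_self hq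
  have h' : ((k + 1 + 1 : ℕ) : ℝ) ≤ ((q ^ (k + 1) : ℕ) : ℝ) := by exact_mod_cast h
  push_cast at h' ⊢
  linarith

/-- A crude bound, enough to make the series converge everywhere and of the same shape as in the
non-abelian case. -/
theorem factorial_le_eulerDenom {q : ℕ} (hq : 1 < q) (t : ℕ) : (t.factorial : ℝ) ≤ eulerDenom q t := by
  rw [← Finset.prod_range_add_one_eq_factorial, Nat.cast_prod]
  exact Finset.prod_le_prod (fun _ _ => Nat.cast_nonneg _) fun k _ => succ_le_pow_sub_one hq k

theorem eulerDenom_pos {q : ℕ} (hq : 1 < q) (t : ℕ) : 0 < eulerDenom q t :=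
  (by exact_mod_cast t.factorial_pos : (0 : ℝ) < t.factorial).trans_le (factorial_le_eulerDenom hq t)

theorem summable_abs_mul_pow {κ : ℕ → ℝ} (hκ : ∀ t, |κ t| ≤ 1 / t.factorial) (x : ℝ) :
    Summable fun t => |κ t * x ^ t| := by
  refine (Real.summable_pow_div_factorial |x|).of_nonneg_of_le (fun _ => abs_nonneg _) fun t => ?_
  rw [abs_mul, abs_pow, div_eq_inv_mul, ← one_div]
  exact mul_le_mul_of_nonneg_right (hκ t) (by positivity)

theorem abs_eulerCoeff_le {q : ℕ} (hq : 1 < q) (t : ℕ) :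
    |(-1 : ℝ) ^ t / eulerDenom q t| ≤ 1 / t.factorial := by
  rw [abs_div, abs_pow, abs_neg, abs_one, one_pow, abs_of_pos (eulerDenom_pos hq t)]
  exact one_div_le_one_div_of_le (by exact_mod_cast t.factorial_pos) (factorial_le_eulerDenom hq t)

/-- The series of Euler. -/
noncomputable def eulerSeries (q : ℕ) (x : ℝ) : ℝ := ∑' t : ℕ, (-1 : ℝ) ^ t / eulerDenom q t * x ^ t

theorem summable_eulerSeries {q : ℕ} (hq : 1 < q) (x : ℝ) :
    Summable fun t : ℕ => (-1 : ℝ) ^ t / eulerDenom q t * x ^ t :=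
  (summable_abs_mul_pow (abs_eulerCoeff_le hq) x).of_abs

/-- Compare coefficients: in degree `t + 1` the difference of the two series carries the factor `q ^
(t + 1) - 1`, which cancels the last factor of the denominator. Iterating this functional equation
produces Euler's product. -/
theorem eulerSeries_mul {q : ℕ} (hq : 1 < q) (x : ℝ) :
    eulerSeries q (q * x) = (1 - x) * eulerSeries q x := by
  have h1 := summable_eulerSeries hq x
  have h2 := summable_eulerSeries hq (q * x)
  suffices h : eulerSeries q (q * x) - eulerSeries q x = -(x * eulerSeries q x) by linarith
  unfold eulerSeries
  rw [← h2.tsum_sub h1, ← tsum_mul_left, ← tsum_neg, (h2.sub h1).tsum_eq_zero_add]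
  have h0 : (-1 : ℝ) ^ 0 / eulerDenom q 0 * (q * x) ^ 0 - (-1) ^ 0 / eulerDenom q 0 * x ^ 0 = 0 := by
    simp
  rw [h0, zero_add]
  refine tsum_congr fun t => ?_
  have hp := (eulerDenom_pos hq t).ne'
  have hp' := (eulerDenom_pos hq (t + 1)).ne'
  rw [eulerDenom_succ] at hp' ⊢
  have hne : (q : ℝ) ^ (t + 1) - 1 ≠ 0 := right_ne_zero_of_mul hp'
  rw [mul_pow]
  field_simp
  ring

theorem eulerSeries_eq_prod {q : ℕ} (hq : 1 < q) (x : ℝ) (n : ℕ) :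
    eulerSeries q x = (∏ j ∈ Finset.range n, (1 - x * (q : ℝ) ^ (-((j : ℤ) + 1)))) *
      eulerSeries q (x * (q : ℝ) ^ (-(n : ℤ))) := by
  have hq0 : (q : ℝ) ≠ 0 := by
    have : q ≠ 0 := by omega
    exact_mod_cast this
  induction n with
  | zero => simp
  | succ n ih =>
    rw [ih, Finset.prod_range_succ, mul_assoc]
    congr 1
    have : x * (q : ℝ) ^ (-(n : ℤ)) = q * (x * (q : ℝ) ^ (-((n : ℤ) + 1))) := by
      rw [neg_add, zpow_add₀ hq0, zpow_neg_one]
      field_simp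
    rw [this, eulerSeries_mul hq]
    push_cast
    rfl

theorem tendsto_eulerSeries {q : ℕ} (hq : 1 < q) (x : ℝ) :
    Tendsto (fun n : ℕ => eulerSeries q (x * (q : ℝ) ^ (-(n : ℤ)))) atTop (𝓝 1) := by
  have h0 : ∑' t : ℕ, (-1 : ℝ) ^ t / eulerDenom q t * 0 ^ t = 1 := by
    rw [tsum_eq_single 0 fun t ht => by rw [zero_pow ht, mul_zero]]
    simp [eulerDenom]
  have hq1 : (1 : ℝ) < q := by exact_mod_cast hq
  have hz : ∀ n : ℕ, (q : ℝ) ^ (-(n : ℤ)) = ((q : ℝ)⁻¹) ^ n := fun n => by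
    rw [zpow_neg, zpow_natCast, inv_pow]
  have hle : ∀ n : ℕ, |x * (q : ℝ) ^ (-(n : ℤ))| ≤ |x| := fun n => by
    rw [hz, abs_mul, abs_of_nonneg (a := ((q : ℝ)⁻¹) ^ n) (by positivity)]
    exact mul_le_of_le_one_right (abs_nonneg x) (pow_le_one₀ (by positivity) (inv_le_one_of_one_le₀ hq1.le))
  have hlim : Tendsto (fun n : ℕ => x * (q : ℝ) ^ (-(n : ℤ))) atTop (𝓝 0) := by
    simp only [hz]
    rw [← mul_zero x]
    exact (tendsto_pow_atTop_nhds_zero_of_lt_one (by positivity) (inv_lt_one_of_one_lt₀ hq1)).const_mul x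
  rw [← h0]
  refine tendsto_tsum_of_dominated_convergence
    (bound := fun t => |(-1 : ℝ) ^ t / eulerDenom q t * |x| ^ t|)
    (summable_abs_mul_pow (abs_eulerCoeff_le hq) |x|) (fun t => (hlim.pow t).const_mul _)
    (Eventually.of_forall fun n t => ?_)
  rw [Real.norm_eq_abs, abs_mul, abs_mul _ (|x| ^ t), abs_pow, abs_of_nonneg (by positivity : 0 ≤ |x| ^ t)]
  exact mul_le_mul_of_nonneg_left (pow_le_pow_left₀ (abs_nonneg _) (hle n) t) (abs_nonneg _)

theorem multipliable_euler {q : ℕ} (hq : 1 < q) (x : ℝ) :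
    Multipliable fun j : ℕ => 1 - x * (q : ℝ) ^ (-((j : ℤ) + 1)) := by
  have hq1 : (1 : ℝ) < q := by exact_mod_cast hq
  have hs : Summable fun j : ℕ => -(x * (q : ℝ) ^ (-((j : ℤ) + 1))) := by
    refine ((summable_geometric_of_lt_one (r := (q : ℝ)⁻¹) (by positivity)
      (inv_lt_one_of_one_lt₀ hq1)).mul_left (x * (q : ℝ)⁻¹)).neg.congr fun j => ?_
    rw [neg_add, zpow_add₀ (by positivity), zpow_neg, zpow_natCast, zpow_neg_one, inv_pow]
    ring
  simpa only [sub_eq_add_neg] using Real.multipliable_one_add_of_summable hs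

theorem tprod_euler {q : ℕ} (hq : 1 < q) (x : ℝ) :
    ∏' j : ℕ, (1 - x * (q : ℝ) ^ (-((j : ℤ) + 1))) = eulerSeries q x := by
  have h1 := (multipliable_euler hq x).hasProd.tendsto_prod_nat
  have h2 := h1.mul (tendsto_eulerSeries hq x)
  rw [mul_one] at h2
  refine tendsto_nhds_unique h2 ?_
  simp only [← eulerSeries_eq_prod hq x]
  exact tendsto_const_nhds

/-- The factors are `1 - q ^ (z - j - 1)`. For `z ≤ 0` none is negative; for `z > 0` the one with `j
= z - 1` is zero. -/
theorem tprod_euler_nonneg {q : ℕ} (hq : 1 < q) (z : ℤ) :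
    0 ≤ ∏' j : ℕ, (1 - (q : ℝ) ^ z * (q : ℝ) ^ (-((j : ℤ) + 1))) := by
  have hq1 : (1 : ℝ) < q := by exact_mod_cast hq
  have h1 := (multipliable_euler hq ((q : ℝ) ^ z)).hasProd.tendsto_prod_nat
  have hterm : ∀ j : ℕ, (q : ℝ) ^ z * (q : ℝ) ^ (-((j : ℤ) + 1)) = (q : ℝ) ^ (z - (j + 1)) := fun j => by
    rw [← zpow_add₀ (by positivity), sub_eq_add_neg]
  rcases le_or_gt z 0 with hz | hz
  · refine ge_of_tendsto' h1 fun n => Finset.prod_nonneg fun j _ => ?_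
    rw [hterm, sub_nonneg]
    exact zpow_le_one_of_nonpos₀ hq1.le (by omega)
  · refine ge_of_tendsto h1 ((eventually_ge_atTop z.toNat).mono fun n hn => ?_)
    refine (Finset.prod_eq_zero (i := z.toNat - 1) (Finset.mem_range.2 (by omega)) ?_).ge
    rw [hterm]
    have : z - (((z.toNat - 1 : ℕ) : ℤ) + 1) = 0 := by omega
    rw [this, zpow_zero, sub_self]

end Euler

/-! ### The coefficients of a system -/

namespace SimpleSystem

variable {F : Type} [Group F] {ι : Type} [DecidableEq ι] (D : SimpleSystem F ι)

/-- The contribution of the type `i` with multiplicity `t` to the Möbius function, divided by the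
number of framings. -/
noncomputable def coeff (i : ι) (t : ℕ) : ℝ :=
  (∏ s ∈ Finset.range t, (-(((D.E i (s + 1) : ℝ) - D.E i s) / D.E i 1))) /
    ∏ s ∈ Finset.range t, ((D.E i t : ℝ) - D.E i s)

theorem muType_div_framingNumber [Fintype ι] (t : ι → ℕ) :
    D.muType t / D.framingNumber t t = ∏ i, D.coeff i (t i) := by
  unfold muType framingNumber coeff
  rw [Nat.cast_prod, ← Finset.prod_div_distrib]
  refine Finset.prod_congr rfl fun i _ => ?_
  rw [Nat.cast_prod]
  congr 1
  refine Finset.prod_congr rfl fun s hs => ?_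
  rw [Nat.cast_sub ((D.strictMono i) (Finset.mem_range.1 hs)).le]

end SimpleSystem

section Coefficients

variable {F : Type} [Group F] {n m : ℕ} {V : Fin n → PrimeIrrep F} {N : Fin m → OuterGroup F}
  (hV : ∀ i j, (V i).Iso (V j) → i = j) (hNs : ∀ j, (N j).IsSimple)
  (hNa : ∀ j, (N j).IsNonabelian) (hN : ∀ i j, Nonempty ((N i).Equiv (N j)) → i = j)

/-- The numerator is `(-1)^t q^(t(t-1)/2)`, the denominator the order of the general linear group of
rank `t` over the field with `q` elements, and the power of `q` cancels. -/
theorem coeff_inl (i : Fin n) (t : ℕ) :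
    (simpleSystem V N hV hNs hNa hN).coeff (Sum.inl i) t = (-1) ^ t / eulerDenom (V i).q t := by
  have hq := (V i).one_lt_q
  have hq1 : (1 : ℝ) < (V i).q := by exact_mod_cast hq
  have hE : ∀ s, (((simpleSystem V N hV hNs hNa hN).E (Sum.inl i) s : ℕ) : ℝ) =
      ((V i).q : ℝ) ^ s - 1 := fun s => by
    change (((V i).q ^ s - 1 : ℕ) : ℝ) = _
    rw [Nat.cast_sub (Nat.one_le_pow _ _ (by omega)), Nat.cast_pow, Nat.cast_one]
  unfold SimpleSystem.coeff
  simp only [hE]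
  have e1 : ∀ s ∈ Finset.range t, -((((V i).q : ℝ) ^ (s + 1) - 1 - (((V i).q : ℝ) ^ s - 1)) /
      (((V i).q : ℝ) ^ 1 - 1)) = -1 * ((V i).q : ℝ) ^ s := fun s _ => by
    have : ((V i).q : ℝ) ^ 1 - 1 ≠ 0 := by
      rw [pow_one]
      exact (sub_pos.2 hq1).ne'
    rw [neg_one_mul, neg_inj, div_eq_iff this]
    ring
  have e2 : ∀ s ∈ Finset.range t, ((V i).q : ℝ) ^ t - 1 - (((V i).q : ℝ) ^ s - 1) =
      ((V i).q : ℝ) ^ s * (((V i).q : ℝ) ^ (t - 1 - s + 1) - 1) := fun s hs => by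
    have hs := Finset.mem_range.1 hs
    rw [mul_sub, ← pow_add, mul_one]
    have : s + (t - 1 - s + 1) = t := by omega
    rw [this]
    ring
  rw [Finset.prod_congr rfl e1, Finset.prod_congr rfl e2, Finset.prod_mul_distrib,
    Finset.prod_mul_distrib, Finset.prod_range_reflect (fun s => ((V i).q : ℝ) ^ (s + 1) - 1) t,
    Finset.prod_const, Finset.card_range, mul_comm]
  have hne : ∏ s ∈ Finset.range t, ((V i).q : ℝ) ^ s ≠ 0 :=
    Finset.prod_ne_zero_iff.2 fun s _ => by positivity
  exact mul_div_mul_left _ _ hne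

/-- The denominator is the order of the wreath product of the automorphism group with the symmetric
group on `t` letters. -/
theorem coeff_inr (j : Fin m) (t : ℕ) :
    (simpleSystem V N hV hNs hNa hN).coeff (Sum.inr j) t =
      (-1) ^ t / (t.factorial * (Nat.card ((N j).Equiv (N j)) : ℝ) ^ t) := by
  have : Nonempty ((N j).Equiv (N j)) := ⟨OuterGroup.Equiv.refl _⟩
  have ha : (Nat.card ((N j).Equiv (N j)) : ℝ) ≠ 0 := by
    exact_mod_cast (Nat.card_pos (α := (N j).Equiv (N j))).ne'
  have hE : ∀ s, (((simpleSystem V N hV hNs hNa hN).E (Sum.inr j) s : ℕ) : ℝ) =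
      s * Nat.card ((N j).Equiv (N j)) := fun s => Nat.cast_mul _ _
  unfold SimpleSystem.coeff
  simp only [hE]
  generalize (Nat.card ((N j).Equiv (N j)) : ℝ) = a at *
  have e1 : ∀ s ∈ Finset.range t, -((((s + 1 : ℕ) : ℝ) * a - s * a) / ((1 : ℕ) * a)) = -1 := fun s _ => by
    push_cast
    field_simp
    ring
  have e2 : ∀ s ∈ Finset.range t, (t : ℝ) * a - s * a = ((t - 1 - s + 1 : ℕ) : ℝ) * a := fun s hs => by
    have hs := Finset.mem_range.1 hs
    have : ((t - 1 - s + 1 : ℕ) : ℝ) = (t : ℝ) - s := by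
      rw [← Nat.cast_sub hs.le]
      congr 1
      omega
    rw [this]
    ring
  rw [Finset.prod_congr rfl e1, Finset.prod_congr rfl e2, Finset.prod_mul_distrib, Finset.prod_const,
    Finset.prod_const, Finset.card_range, Finset.prod_range_reflect (fun s => ((s + 1 : ℕ) : ℝ)) t,
    ← Nat.cast_prod, Finset.prod_range_add_one_eq_factorial]

theorem abs_coeff_le (i : Fin n ⊕ Fin m) (t : ℕ) :
    |(simpleSystem V N hV hNs hNa hN).coeff i t| ≤ 1 / t.factorial := by
  rcases i with i | j
  · rw [coeff_inl]
    exact abs_eulerCoeff_le (V i).one_lt_q t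
  · have : Nonempty ((N j).Equiv (N j)) := ⟨OuterGroup.Equiv.refl _⟩
    have ha : (1 : ℝ) ≤ (Nat.card ((N j).Equiv (N j)) : ℝ) := by
      exact_mod_cast Nat.card_pos (α := (N j).Equiv (N j))
    have hf : (0 : ℝ) < t.factorial := by exact_mod_cast t.factorial_pos
    rw [coeff_inr, abs_div, abs_pow, abs_neg, abs_one, one_pow, abs_of_pos (by positivity)]
    exact one_div_le_one_div_of_le hf (le_mul_of_one_le_right hf.le (one_le_pow₀ ha))

theorem tsum_coeff_inl (i : Fin n) (x : ℝ) :
    ∑' t : ℕ, (simpleSystem V N hV hNs hNa hN).coeff (Sum.inl i) t * x ^ t =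
      ∏' j : ℕ, (1 - x * ((V i).q : ℝ) ^ (-((j : ℤ) + 1))) := by
  rw [tprod_euler (V i).one_lt_q]
  exact tsum_congr fun t => by rw [coeff_inl]

theorem tsum_coeff_inr (j : Fin m) (x : ℝ) :
    ∑' t : ℕ, (simpleSystem V N hV hNs hNa hN).coeff (Sum.inr j) t * x ^ t =
      Real.exp (-(x / Nat.card ((N j).Equiv (N j)))) := by
  rw [Real.exp_eq_exp_ℝ, NormedSpace.exp_eq_tsum_div]
  refine tsum_congr fun t => ?_
  rw [coeff_inr, neg_pow (x / _), div_pow]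
  generalize (Nat.card ((N j).Equiv (N j)) : ℝ) = a
  rw [div_mul_eq_mul_div, mul_div_assoc', div_div, mul_comm (a ^ t)]

end Coefficients

/-! ### Sums over the epimorphisms to `F` -/

section AutAction

variable {F G : Type} [Group F] [Group G]

/-- The epimorphisms in a given class modulo `Aut(F)` are parametrized by `Aut(F)`. -/
theorem card_surSetoid_class (c : Quotient (surSetoid G F)) :
    Nat.card {π : Sur G F // Quotient.mk (surSetoid G F) π = c} = Nat.card (MulAut F) := by
  obtain ⟨π₀, rfl⟩ := Quotient.exists_rep c
  symm
  refine Nat.card_congr (Equiv.ofBijective (fun α : MulAut F =>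
    ⟨⟨α.toMonoidHom.comp π₀.1, α.surjective.comp π₀.2⟩,
      Quotient.sound ((surSetoid G F).symm' ⟨α, rfl⟩)⟩) ⟨fun α β h => ?_, ?_⟩)
  · ext f
    obtain ⟨x, rfl⟩ := π₀.2 f
    have h1 : α.toMonoidHom.comp π₀.1 = β.toMonoidHom.comp π₀.1 :=
      congrArg (fun z : {π : Sur G F // Quotient.mk (surSetoid G F) π =
        Quotient.mk (surSetoid G F) π₀} => z.1.1) h
    exact DFunLike.congr_fun h1 x
  · rintro ⟨π, hπ⟩
    obtain ⟨α, hα⟩ := (surSetoid G F).symm' (Quotient.exact hπ)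
    exact ⟨α, Subtype.ext (Subtype.ext hα.symm)⟩

theorem sum_muHom_eq [Finite F] [Finite G] [Fintype (Sur G F)] :
    ∑ π : Sur G F, (muHom π.1 : ℝ) = Nat.card (MulAut F) * muHat F G := by
  classical
  let : Fintype (Quotient (surSetoid G F)) := Fintype.ofFinite _
  unfold muHat
  rw [finsum_eq_sum_of_fintype, Int.cast_sum, Finset.mul_sum,
    ← Finset.sum_fiberwise (g := fun π : Sur G F => Quotient.mk (surSetoid G F) π)]
  refine Finset.sum_congr rfl fun c _ => ?_
  rw [Finset.sum_congr rfl (g := fun _ => ((Quotient.lift (fun π : Sur G F => muHom π.1)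
    muHom_eq_of_surSetoid c : ℤ) : ℝ)) fun π hπ => by
      rw [← (Finset.mem_filter.1 hπ).2]
      rfl, Finset.sum_const, nsmul_eq_mul, ← card_surSetoid_class c, Nat.card_eq_fintype_card,
    Fintype.card_subtype]

/-- `Aut(F)` acts freely on epimorphisms and `μ` is constant on orbits, whence the division by `|Aut
F|`. -/
theorem hasSum_vTerm [Finite F] {L : Set FinGrpClass} {M : FinGrpClass → ℝ} {v : ℝ}
    (h : HasSum (fun x : Σ G : L, Sur G.1.rep F =>
      (muHom x.2.1 : ℝ) / Nat.card (MulAut x.1.1.rep) * M x.1.1) v) :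
    HasSum (fun G : L => vTerm F M G.1) (v / Nat.card (MulAut F)) := by
  let : ∀ G : L, Fintype (Sur G.1.rep F) := fun G => Fintype.ofFinite _
  have h1 := h.sigma fun G => hasSum_fintype _
  have h2 := h1.div_const (Nat.card (MulAut F) : ℝ)
  refine Eq.mp (congrArg (fun f => HasSum f _) (funext fun G => ?_)) h2
  have hne : (Nat.card (MulAut F) : ℝ) ≠ 0 := by
    exact_mod_cast (Nat.card_pos (α := MulAut F)).ne'
  change (∑ π : Sur G.1.rep F, (muHom π.1 : ℝ) / (Nat.card (MulAut G.1.rep) : ℝ) * M G.1) / _ = _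
  rw [← Finset.sum_mul, ← Finset.sum_div, sum_muHom_eq]
  unfold vTerm
  field_simp

end AutAction

/-! ### The main computation -/

section Main

variable {F : Type} [Group F] {ι : Type} [DecidableEq ι] [Fintype ι]

namespace SimpleSystem

theorem HasType.card_eq {D : SimpleSystem F ι} {G : Type} [Group G] [Finite G] {π : G →* F}
    (hπ : Function.Surjective π) {t : ι → ℕ} (h : D.HasType π t) :
    Nat.card G = Nat.card F * ∏ i, Nat.card (D.S i).N ^ t i := by
  obtain ⟨r, τ, J, hJ, rfl⟩ := h
  rw [← D.card_range J, hJ, ← Subgroup.card_mul_index π.ker, Subgroup.index_ker,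
    MonoidHom.range_eq_top.2 hπ, Subgroup.card_top, mul_comm]

theorem HasType.rpow_card {D : SimpleSystem F ι} {G : Type} [Group G] [Finite G] {π : G →* F}
    (hπ : Function.Surjective π) {t : ι → ℕ} (h : D.HasType π t) (u : ℝ) :
    (Nat.card G : ℝ) ^ (-u) =
      (Nat.card F : ℝ) ^ (-u) * ∏ i, ((Nat.card (D.S i).N : ℝ) ^ (-u)) ^ t i := by
  rw [h.card_eq hπ]
  push_cast
  rw [Real.mul_rpow (by positivity) (by positivity), ← Real.finsetProd_rpow _ _ (fun _ _ => by positivity)]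
  congr 1
  refine Finset.prod_congr rfl fun i _ => ?_
  rw [← Real.rpow_natCast, ← Real.rpow_natCast, ← Real.rpow_mul (by positivity),
    ← Real.rpow_mul (by positivity), mul_comm]

theorem HasType.muHom_eq {D : SimpleSystem F ι} {G : Type} [Group G] [Finite G] {π : G →* F}
    (hπ : Function.Surjective π) {t : ι → ℕ} (h : D.HasType π t) : (muHom π : ℝ) = D.muType t := by
  obtain ⟨r, τ, J, hJ, rfl⟩ := h
  exact D.muHom_eq_muType hπ τ J hJ

theorem HasType.distribCount_le {D : SimpleSystem F ι} {G : Type} [Group G] [Finite G] {π : G →* F}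
    (hπ : Function.Surjective π) {t : ι → ℕ} (h : D.HasType π t) :
    distribCount π ≤ ∏ i, 2 ^ t i := by
  obtain ⟨r, τ, J, hJ, rfl⟩ := h
  have h1 := _root_.distribCount_le hπ (fun k => D.simple (τ k)) J.2 hJ
  refine h1.trans_eq ?_
  have : ∏ k : Fin r, 2 = 2 ^ r := by simp
  rw [← this, ← Finset.prod_fiberwise (g := τ)]
  refine Finset.prod_congr rfl fun i _ => ?_
  rw [Finset.prod_const]
  rfl

variable (D : SimpleSystem F ι) {L : Set FinGrpClass} (M : ∀ i, ExtensionModel (D.S i))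

/-- The Möbius value, the mass and the moment are all multiplicative in the types, so each type
contributes one term of a power series. -/
theorem muType_mul_mass (A : ℝ) (b : ι → ℝ) (t : ι → ℕ) :
    (D.muType t * (A * ∏ i, b i ^ t i)) * ((∏ i, mass (M i) L ^ t i) / D.framingNumber t t) =
      A * ∏ i, (D.coeff i (t i) * (mass (M i) L * b i) ^ t i) := by
  rw [Finset.prod_mul_distrib, ← D.muType_div_framingNumber]
  simp only [mul_pow]
  rw [Finset.prod_mul_distrib]
  ring

theorem mass_nonneg {S : OuterGroup F} (M : ExtensionModel S) : 0 ≤ mass M L := by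
  unfold mass
  positivity

theorem summable_types (hcoeff : ∀ i t, |D.coeff i t| ≤ 1 / t.factorial) {A : ℝ} (hA : 0 ≤ A)
    (b : ι → ℝ) :
    Summable fun t : ι → ℕ => |D.muType t * (A * ∏ i, b i ^ t i)| *
      ((∏ i, mass (M i) L ^ t i) / D.framingNumber t t) := by
  have h := (hasSum_prod_pi (fun i k => |D.coeff i k * (mass (M i) L * b i) ^ k|) fun i => by
    simpa only [abs_abs] using summable_abs_mul_pow (hcoeff i) (mass (M i) L * b i)).summable.mul_left A
  refine h.congr fun t => ?_
  have hm : 0 ≤ (∏ i, mass (M i) L ^ t i) / (D.framingNumber t t : ℝ) :=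
    div_nonneg (Finset.prod_nonneg fun i _ => pow_nonneg (mass_nonneg _) _) (Nat.cast_nonneg _)
  have e : ∀ y : ℝ, |y| * ((∏ i, mass (M i) L ^ t i) / (D.framingNumber t t : ℝ)) =
      |y * ((∏ i, mass (M i) L ^ t i) / (D.framingNumber t t : ℝ))| := fun y => by
    rw [abs_mul, abs_of_nonneg hm]
  rw [e, muType_mul_mass, abs_mul, abs_of_nonneg hA, Finset.abs_prod]

section Sum

variable [Finite F]

theorem hasSum_muHom
    (hD : DownwardClosed L) (hJ : JoinClosed L) (hF : grpClass F ∈ L)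
    (hcoeff : ∀ i t, |D.coeff i t| ≤ 1 / t.factorial)
    (htype : ∀ x : Σ G : L, Sur G.1.rep F, muHom x.2.1 ≠ 0 → ∃ t, D.HasType x.2.1 t) (u : ℝ) :
    HasSum (fun x : Σ G : L, Sur G.1.rep F =>
      (muHom x.2.1 : ℝ) / Nat.card (MulAut x.1.1.rep) * cardMoment u x.1.1)
      ((Nat.card F : ℝ) ^ (-u) *
        ∏ i, ∑' k, D.coeff i k * (mass (M i) L * (Nat.card (D.S i).N : ℝ) ^ (-u)) ^ k) := by
  have hA : 0 ≤ (Nat.card F : ℝ) ^ (-u) := by positivity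
  have h := hasSum_of_types (fun (x : Σ G : L, Sur G.1.rep F) t => D.HasType x.2.1 t)
    (fun x t t' h h' => HasType.unique D x.2.2 h h')
    (w := fun x => 1 / (Nat.card (MulAut x.1.1.rep) : ℝ)) (fun x => by positivity)
    (D.hasSum_hasType hD hJ hF M) (D.summable_types M hcoeff hA fun i => (Nat.card (D.S i).N : ℝ) ^ (-u))
    (f := fun x => (muHom x.2.1 : ℝ) / Nat.card (MulAut x.1.1.rep) * cardMoment u x.1.1)
    (fun x t hx => by
      simp only [cardMoment]
      rw [hx.rpow_card x.2.2, hx.muHom_eq x.2.2]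
      ring)
    fun x hx => by
      have : muHom x.2.1 = 0 := by
        by_contra hne
        obtain ⟨t, ht⟩ := htype x hne
        exact hx t ht
      rw [this, Int.cast_zero, zero_div, zero_mul]
  refine Eq.mp (congrArg (HasSum _) ?_) h
  simp only [muType_mul_mass]
  rw [tsum_mul_left, (hasSum_prod_pi (fun i k => D.coeff i k *
    (mass (M i) L * (Nat.card (D.S i).N : ℝ) ^ (-u)) ^ k) fun i =>
    summable_abs_mul_pow (hcoeff i) _).tsum_eq]

/-- By `Z(π) ≤ 2 ^ r` the factor `Z(π)³` is at most `8 ^ r`, which is absorbed by scaling the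
argument of each power series; these converge everywhere. -/
theorem summable_wellBehaved (M : ∀ i, ExtensionModel (D.S i))
    (hD : DownwardClosed L) (hJ : JoinClosed L) (hF : grpClass F ∈ L)
    (hcoeff : ∀ i t, |D.coeff i t| ≤ 1 / t.factorial)
    (htype : ∀ x : Σ G : L, Sur G.1.rep F, muHom x.2.1 ≠ 0 → ∃ t, D.HasType x.2.1 t) (u : ℝ) :
    Summable fun x : Σ G : L, Sur G.1.rep F =>
      (|muHom x.2.1| : ℝ) / (Nat.card (MulAut x.1.1.rep) : ℝ) *
        (distribCount x.2.1 : ℝ) ^ 3 * |cardMoment u x.1.1| := by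
  classical
  have hA : 0 ≤ (Nat.card F : ℝ) ^ (-u) := by positivity
  let b : ι → ℝ := fun i => 8 * (Nat.card (D.S i).N : ℝ) ^ (-u)
  let g : (ι → ℕ) → ℝ := fun t => |D.muType t * ((Nat.card F : ℝ) ^ (-u) * ∏ i, b i ^ t i)|
  -- The majorant depends on the type of `x`. The type is chosen here, and by uniqueness the choice
  -- does not matter.
  let f : (Σ G : L, Sur G.1.rep F) → ℝ := fun x =>
    if hx : ∃ t, D.HasType x.2.1 t then g hx.choose * (1 / (Nat.card (MulAut x.1.1.rep) : ℝ)) else 0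
  have hfx : ∀ x t, D.HasType x.2.1 t → f x = g t * (1 / (Nat.card (MulAut x.1.1.rep) : ℝ)) := by
    intro x t hx
    have he : ∃ t, D.HasType x.2.1 t := ⟨t, hx⟩
    simp only [f]
    rw [dif_pos he, HasType.unique D x.2.2 he.choose_spec hx]
  have h := hasSum_of_types (fun (x : Σ G : L, Sur G.1.rep F) t => D.HasType x.2.1 t)
    (fun x t t' h h' => HasType.unique D x.2.2 h h')
    (w := fun x => 1 / (Nat.card (MulAut x.1.1.rep) : ℝ)) (fun x => by positivity)
    (D.hasSum_hasType hD hJ hF M) (g := g)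
    (by simpa only [g, abs_abs] using D.summable_types M hcoeff hA b) hfx
    (fun x hx => dif_neg fun ⟨t, ht⟩ => hx t ht)
  refine h.summable.of_nonneg_of_le (fun x => by positivity) fun x => ?_
  by_cases hμ : muHom x.2.1 = 0
  · rw [hμ, Int.cast_zero, abs_zero, zero_div, zero_mul, zero_mul]
    simp only [f]
    split_ifs <;> positivity
  · obtain ⟨t, ht⟩ := htype x hμ
    have hZ : (distribCount x.2.1 : ℝ) ≤ ∏ i, 2 ^ t i := by exact_mod_cast ht.distribCount_le x.2.2
    have hP : ∏ i, b i ^ t i = (∏ i, (2 : ℝ) ^ t i) ^ 3 *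
        ∏ i, ((Nat.card (D.S i).N : ℝ) ^ (-u)) ^ t i := by
      rw [← Finset.prod_pow, ← Finset.prod_mul_distrib]
      refine Finset.prod_congr rfl fun i _ => ?_
      simp only [b]
      rw [mul_pow, ← pow_mul, mul_comm (t i), pow_mul]
      norm_num
    have hB : 0 ≤ ∏ i, ((Nat.card (D.S i).N : ℝ) ^ (-u)) ^ t i :=
      Finset.prod_nonneg fun i _ => by positivity
    have hC : 0 ≤ ∏ i, (2 : ℝ) ^ t i := Finset.prod_nonneg fun i _ => by positivity
    rw [hfx x t ht]
    simp only [cardMoment, g]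
    rw [ht.rpow_card x.2.2, ht.muHom_eq x.2.2, hP]
    generalize ∏ i, ((Nat.card (D.S i).N : ℝ) ^ (-u)) ^ t i = B at *
    generalize (Nat.card F : ℝ) ^ (-u) = A at *
    generalize ∏ i, (2 : ℝ) ^ t i = C at *
    rw [abs_of_nonneg (mul_nonneg hA hB), abs_mul,
      abs_of_nonneg (mul_nonneg hA (mul_nonneg (pow_nonneg hC 3) hB))]
    have h3 := pow_le_pow_left₀ (Nat.cast_nonneg _) hZ 3
    have h4 : 0 ≤ |D.muType t| / (Nat.card (MulAut x.1.1.rep) : ℝ) := by positivity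
    calc _ ≤ |D.muType t| / (Nat.card (MulAut x.1.1.rep) : ℝ) * C ^ 3 * (A * B) :=
          mul_le_mul_of_nonneg_right (mul_le_mul_of_nonneg_left h3 h4) (mul_nonneg hA hB)
      _ = _ := by ring

end Sum

end SimpleSystem

end Main

/-! ### The product formula -/

section Formula

variable {L : Set FinGrpClass} {F : Type} [Group F] [Finite F] {n m : ℕ} {V : Fin n → PrimeIrrep F}
  {N : Fin m → OuterGroup F}

/-- The system of a level. -/
noncomputable def levelSystem (hV : IsIrrepSystem L V) (hN : IsNonabelianSystem L N) :
    SimpleSystem F (Fin n ⊕ Fin m) :=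
  simpleSystem V N hV.2.1 (fun j => (hN.1 j).1) (fun j => (hN.1 j).2.1) hN.2.1

/-- The models of a level. -/
noncomputable def levelModel (hV : IsIrrepSystem L V) (hN : IsNonabelianSystem L N) :
    ∀ i, ExtensionModel ((levelSystem hV hN).S i) :=
  systemModel V N (fun j => (hN.1 j).1) fun j => (hN.1 j).2.1

theorem exists_hasType_levelSystem (hL : IsLevel L) (hV : IsIrrepSystem L V)
    (hN : IsNonabelianSystem L N) (x : Σ G : L, Sur G.1.rep F) (hμ : muHom x.2.1 ≠ 0) :
    ∃ t, (levelSystem hV hN).HasType x.2.1 t := by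
  have hG : grpClass x.1.1.rep ∈ L := by
    rw [grpClass_rep]
    exact x.1.2
  obtain ⟨r, τ, J, hJ⟩ := (levelSystem hV hN).exists_framing x.2.2 hμ fun M hM hle =>
    exists_isEmb_systemGroup hL.downwardClosed hL.joinClosed hV hN hG x.2.2 hμ hM hle
  exact ⟨_, r, τ, J, hJ, rfl⟩

theorem abs_coeff_levelSystem_le (hV : IsIrrepSystem L V) (hN : IsNonabelianSystem L N) (i t) :
    |(levelSystem hV hN).coeff i t| ≤ 1 / t.factorial :=
  abs_coeff_le _ _ _ _ i t

theorem mass_nonabelianModel {S : OuterGroup F} (hS : S.IsSimple) (hn : S.IsNonabelian)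
    (h : grpClass S.fiberProduct ∈ L) : SimpleSystem.mass (nonabelianModel hS hn) L = 1 := by
  have : Nat.card {c : (nonabelianModel hS hn).X // grpClass ((nonabelianModel hS hn).E c) ∈ L} = 1 :=
    (Nat.card_congr (Equiv.subtypeUnivEquiv fun _ => h)).trans (Nat.card_unique (α := Unit))
  unfold SimpleSystem.mass
  rw [this]
  change ((1 : ℕ) : ℝ) / ((1 : ℕ) : ℝ) = 1
  simp

theorem hasSum_vTerm_cardMoment (hL : IsLevel L) (hF : grpClass F ∈ L) (hV : IsIrrepSystem L V)
    (hN : IsNonabelianSystem L N) (u : ℝ) :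
    HasSum (fun G : L => vTerm F (cardMoment u) G.1)
      ((Nat.card F : ℝ) ^ (-u) / (Nat.card (MulAut F) : ℝ) *
        (∏ i, ∏' j : ℕ, (1 - irrepRatio L u (V i) * ((V i).q : ℝ) ^ (-((j : ℤ) + 1)))) *
        ∏ i, Real.exp (-(1 / ((Nat.card (N i).N : ℝ) ^ u * (Nat.card ((N i).Equiv (N i)) : ℝ))))) := by
  have h := hasSum_vTerm ((levelSystem hV hN).hasSum_muHom (levelModel hV hN) hL.downwardClosed
    hL.joinClosed hF (abs_coeff_levelSystem_le hV hN) (exists_hasType_levelSystem hL hV hN) u)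
  refine Eq.mp (congrArg (HasSum _) ?_) h
  rw [Fintype.prod_sum_type]
  have h1 : ∀ i : Fin n, ∑' k, (levelSystem hV hN).coeff (Sum.inl i) k *
      (SimpleSystem.mass (levelModel hV hN (Sum.inl i)) L *
        (Nat.card ((levelSystem hV hN).S (Sum.inl i)).N : ℝ) ^ (-u)) ^ k =
      ∏' j : ℕ, (1 - irrepRatio L u (V i) * ((V i).q : ℝ) ^ (-((j : ℤ) + 1))) := fun i => by
    rw [(V i).irrepRatio_eq hL.downwardClosed]
    exact tsum_coeff_inl _ _ _ _ i _
  have h2 : ∀ j : Fin m, ∑' k, (levelSystem hV hN).coeff (Sum.inr j) k *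
      (SimpleSystem.mass (levelModel hV hN (Sum.inr j)) L *
        (Nat.card ((levelSystem hV hN).S (Sum.inr j)).N : ℝ) ^ (-u)) ^ k =
      Real.exp (-(1 / ((Nat.card (N j).N : ℝ) ^ u * (Nat.card ((N j).Equiv (N j)) : ℝ)))) := fun j => by
    have e : SimpleSystem.mass (levelModel hV hN (Sum.inr j)) L = 1 :=
      mass_nonabelianModel (hN.1 j).1 (hN.1 j).2.1 (hN.1 j).2.2
    rw [e, one_mul]
    refine (tsum_coeff_inr _ _ _ _ j _).trans ?_
    change Real.exp (-((Nat.card (N j).N : ℝ) ^ (-u) / _)) = _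
    rw [Real.rpow_neg (Nat.cast_nonneg _), ← one_div, div_div]
  rw [Finset.prod_congr rfl fun i _ => h1 i, Finset.prod_congr rfl fun j _ => h2 j]
  ring

/-- With `|V| = q ^ a` and `q ^ b` cocycles in the level, the ratio is `q ^ (b - a |F| - a k)`, an
integral power of `q`. -/
theorem tprod_irrepRatio_nonneg (hL : IsLevel L) (A : PrimeIrrep F) (hA : grpClass A.Semidirect ∈ L)
    (k : ℤ) : 0 ≤ ∏' j : ℕ, (1 - irrepRatio L k A * (A.q : ℝ) ^ (-((j : ℤ) + 1))) := by
  obtain ⟨⟨a, ha⟩, ⟨b, hb⟩⟩ := A.exists_card_eq_q_pow hL.downwardClosed hL.joinClosed hA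
  have hq : (A.q : ℝ) ≠ 0 := by
    have : A.q ≠ 0 := by
      have := A.one_lt_q
      omega
    exact_mod_cast this
  have e : irrepRatio L k A = (A.q : ℝ) ^ ((b : ℤ) - (a * Nat.card F : ℕ) - a * k) := by
    rw [A.irrepRatio_eq hL.downwardClosed]
    unfold SimpleSystem.mass
    change ((Nat.card {c : groupCohomology.cocycles₂ A.V // grpClass (CocycleExtension c) ∈ L} : ℝ) /
      ((Nat.card A.V ^ Nat.card F : ℕ) : ℝ)) * _ = _
    rw [hb, ha, ← Int.cast_neg, Real.rpow_intCast, sub_eq_add_neg _ ((a : ℤ) * k), zpow_add₀ hq,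
      zpow_sub₀ hq, zpow_natCast, zpow_natCast, neg_mul_eq_mul_neg, zpow_mul, zpow_natCast]
    push_cast
    rw [← pow_mul]
  rw [e]
  exact tprod_euler_nonneg A.one_lt_q _

end Formula

theorem mainTheorem7 (u : ℝ) :
    WellBehaved (cardMoment u) ∧
    (∀ L : Set FinGrpClass, IsLevel L →
      ∀ (F : Type) [Group F] [Finite F], grpClass F ∈ L →
        (∃ (n : ℕ) (V : Fin n → PrimeIrrep F), IsIrrepSystem L V) ∧
        (∃ (m : ℕ) (N : Fin m → OuterGroup F), IsNonabelianSystem L N) ∧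
        (Summable fun G : L => vTerm F (cardMoment u) G.1) ∧
        ∀ (n : ℕ) (V : Fin n → PrimeIrrep F) (m : ℕ) (N : Fin m → OuterGroup F),
          IsIrrepSystem L V → IsNonabelianSystem L N →
            (∀ i, Multipliable fun j : ℕ =>
              1 - irrepRatio L u (V i) * ((V i).q : ℝ) ^ (-((j : ℤ) + 1))) ∧
            vSum L F (cardMoment u) =
              (Nat.card F : ℝ) ^ (-u) / (Nat.card (MulAut F) : ℝ) *
                (∏ i, ∏' j : ℕ,
                  (1 - irrepRatio L u (V i) * ((V i).q : ℝ) ^ (-((j : ℤ) + 1)))) *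
                ∏ i, Real.exp
                  (-(1 / ((Nat.card (N i).N : ℝ) ^ u *
                    (Nat.card ((N i).Equiv (N i)) : ℝ))))) ∧
    ((∃ k : ℤ, u = k) →
      ∀ L : Set FinGrpClass, IsLevel L →
        ∀ (F : Type) [Group F] [Finite F], grpClass F ∈ L →
          0 ≤ vSum L F (cardMoment u)) := by
  refine ⟨fun L hL F _ _ hF => ?_, fun L hL F _ _ hF => ?_, ?_⟩
  · obtain ⟨n, V, hV⟩ := exists_isIrrepSystem (F := F) hL
    obtain ⟨m, N, hN⟩ := exists_isNonabelianSystem (F := F) hL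
    exact (levelSystem hV hN).summable_wellBehaved (levelModel hV hN) hL.downwardClosed
      hL.joinClosed hF (abs_coeff_levelSystem_le hV hN) (exists_hasType_levelSystem hL hV hN) u
  · obtain ⟨n, V, hV⟩ := exists_isIrrepSystem (F := F) hL
    obtain ⟨m, N, hN⟩ := exists_isNonabelianSystem (F := F) hL
    exact ⟨⟨n, V, hV⟩, ⟨m, N, hN⟩, (hasSum_vTerm_cardMoment hL hF hV hN u).summable,
      fun n V m N hV hN => ⟨fun i => multipliable_euler (V i).one_lt_q _,
        (hasSum_vTerm_cardMoment hL hF hV hN u).tsum_eq⟩⟩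
  · rintro ⟨k, rfl⟩ L hL F _ _ hF
    obtain ⟨n, V, hV⟩ := exists_isIrrepSystem (F := F) hL
    obtain ⟨m, N, hN⟩ := exists_isNonabelianSystem (F := F) hL
    unfold vSum
    rw [(hasSum_vTerm_cardMoment hL hF hV hN k).tsum_eq]
    refine mul_nonneg (mul_nonneg (by positivity) (Finset.prod_nonneg fun i _ => ?_))
      (Finset.prod_nonneg fun i _ => (Real.exp_pos _).le)
    exact tprod_irrepRatio_nonneg hL (V i) (hV.1 i) k
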